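/- Let $d\ge 2$ and let $P,Q,R\in\mathbb C[z,w]$ be homogeneous of degree $d$, with $(0,0)$ the only common zero of $P$ and $Q$. For $\varepsilon\in\mathbb C$ let $f=f_\varepsilon$ be the endomorphism $[z:w:t]\mapsto[P(z,w):Q(z,w):t^d+\varepsilon R(z,w)]$ of $\mathbb P^2$, let $f_\infty:[z:w]\mapsto[P(z,w):Q(z,w)]$ on $\mathbb P^1$ and $f_\infty^+:[z:w]\mapsto[P(z,w):Q(z,w):R(z,w)]$ from $\mathbb P^1$ to $\mathbb P^2$. For $\rho>0$ put $U_\rho=\{[z:w:t]\in\mathbb P^2:\ |t|<\rho\max(|z|,|w|)\}$. Let $X_{-1}\subset\mathbb P^1\times\mathbb P^1$ be the set of the pairs $(p,q)$ with $p\ne q$ and $f_\infty^+(p)=f_\infty^+(q)$, together with the pairs $(p,p)$ where $p$ is a critical point of $f_\infty$. Let $Y_{-2}\subset\mathbb P^1\times\mathbb P^1$ be the set of the pairs $([u],[v])$, $u,v\in\mathbb C^2\setminus\{0\}$, such that $P(u)=P(v)$, $Q(u)=Q(v)$ and $R(u)=\zeta R(v)$ for some $\zeta\in\mathbb C$ with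 $\zeta^d=1$, $\zeta\neq1$ (this contains the pairs $(p,p)$ with $R(p)=0$). With $\mathrm{pr}_1$ the first projection, put $X=f_\infty(\mathrm{pr}_1(X_{-1}))$, $Y=f_\infty^2(\mathrm{pr}_1(Y_{-2}))$ and $Z=X\cup Y$. Definitions. A trapping region of an endomorphism $g$ of $\mathbb P^2$ is an open set $U$ such that $g(U)$ is relatively compact in $U$; its attracting set is $\mathscr A=\bigcap_{n\ge0}g^n(U)$. The set $\mathscr A$ is of dimension $s$ if it supports a nonzero positive closed current of bidimension $(s,s)$ but none of bidimension $(l,l)$ with $l>s$. If $g$ has algebraic degree $\delta$, then $g$ is of small topological degree on $U$ if $U$ is a trapping region of $g$, its attracting set has some dimension $s$, and every point of $g(U)$ has strictly fewer than $\delta^{s}$ preimages under $g$ in $U$. **Proposition.** Suppose that $X\cap Y=\emptyset$ and $f_\infty^{-2}(Z)\cap f_\infty^{-1}(Z)\cap Z=\emptyset$. Then there is $\varepsilon_0>0$ such that for every $\varepsilon\in\mathbb C$ with $0<|\varepsilon|<\varepsilon_0$ there is $\rho>0$ such that $U_\rho$ is a trapping region of $f=f_\varepsilon$ and $f^3$ is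 of small topological degree on $f(U_\rho)$. -/

import Mathlib

open scoped LinearAlgebra.Projectivization ContDiff

noncomputable section

namespace SmallDegree

/-! ### Complex projective spaces and their endomorphisms -/

/-- The complex vector space `ℂⁿ`. -/
abbrev CV (n : ℕ) : Type := Fin n → ℂ

/-- The complex projective space `ℙ(ℂⁿ)`, of dimension `n - 1`. -/
abbrev PS (n : ℕ) : Type := ℙ ℂ (CV n)

/-- The quotient topology of projective space. -/
instance instTopologicalSpacePS (n : ℕ) : TopologicalSpace (PS n) :=
  TopologicalSpace.coinduced
    (fun v : {v : CV n // v ≠ 0} => Projectivization.mk ℂ v.1 v.2) inferInstance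

theorem eval_smul_of_isHomogeneous {n d : ℕ} {F : MvPolynomial (Fin n) ℂ}
    (hF : F.IsHomogeneous d) (t : ℂ) (v : CV n) :
    MvPolynomial.eval (t • v) F = t ^ d * MvPolynomial.eval v F := by
  rw [MvPolynomial.eval_eq, MvPolynomial.eval_eq, Finset.mul_sum]
  refine Finset.sum_congr rfl fun m hm => ?_
  have h1 : ∑ i ∈ m.support, m i = d := by
    have := hF (MvPolynomial.mem_support_iff.1 hm)
    change Finsupp.weight (fun _ => 1) m = d at this
    rwa [← Finsupp.degree_eq_weight_one, Finsupp.degree_apply] at this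
  simp only [Pi.smul_apply, smul_eq_mul, mul_pow, Finset.prod_mul_distrib,
    Finset.prod_pow_eq_pow_sum, h1]
  ring

/-- The map `[x] ↦ [F₁(x) : ⋯ : Fₘ(x)]` given by homogeneous polynomials of the same degree
without a common zero outside the origin. -/
def projMap {n m d : ℕ} (F : Fin m → MvPolynomial (Fin n) ℂ)
    (hF : ∀ i, (F i).IsHomogeneous d)
    (h0 : ∀ x : CV n, (∀ i, MvPolynomial.eval x (F i) = 0) → x = 0) : PS n → PS m :=
  Projectivization.lift
    (fun v => Projectivization.mk ℂ (fun i => MvPolynomial.eval v.1 (F i))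
      (fun h => v.2 (h0 v.1 fun i => congrFun h i)))
    (by
      intro a b t hab
      rw [Projectivization.mk_eq_mk_iff']
      refine ⟨t ^ d, ?_⟩
      funext i
      rw [hab, eval_smul_of_isHomogeneous (hF i)]
      rfl)

theorem projMap_mk {n m d : ℕ} (F : Fin m → MvPolynomial (Fin n) ℂ)
    (hF : ∀ i, (F i).IsHomogeneous d)
    (h0 : ∀ x : CV n, (∀ i, MvPolynomial.eval x (F i) = 0) → x = 0) (v : CV n) (hv : v ≠ 0) :
    projMap F hF h0 (Projectivization.mk ℂ v hv) =
      Projectivization.mk ℂ (fun i => MvPolynomial.eval v (F i))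
        (fun h => hv (h0 v fun i => congrFun h i)) := rfl

/-- `g` is a (holomorphic) endomorphism of projective space of algebraic degree `δ`. -/
def IsEndomorphism {n : ℕ} (g : PS n → PS n) (δ : ℕ) : Prop :=
  ∃ (F : Fin n → MvPolynomial (Fin n) ℂ) (hF : ∀ i, (F i).IsHomogeneous δ)
    (h0 : ∀ x : CV n, (∀ i, MvPolynomial.eval x (F i) = 0) → x = 0), g = projMap F hF h0

/-! ### Trapping regions and attracting sets -/

/-- `U` is open and `g(U)` is relatively compact in `U`. -/
def IsTrappingRegion {n : ℕ} (g : PS n → PS n) (U : Set (PS n)) : Prop :=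
  IsOpen U ∧ IsCompact (closure (g '' U)) ∧ closure (g '' U) ⊆ U

/-- The attracting set `⋂ₙ gⁿ(U)` of a trapping region `U`. -/
def attractingSet {n : ℕ} (g : PS n → PS n) (U : Set (PS n)) : Set (PS n) :=
  ⋂ k : ℕ, g^[k] '' U

/-! ### Positive closed currents on `ℙ²` -/

/-- The real vector space of smooth real differential `r`-forms on `ℙ²`. A form on `ℙ²` is
identified with its pull-back to `ℂ³ ∖ {0}` by the principal `ℂˣ`-bundle `ℂ³ ∖ {0} → ℙ²`; the
pull-backs are exactly the smooth forms that are killed by the vectors tangent to the fibres and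
invariant under the dilations `z ↦ c z`. The irrelevant value at the origin is set to `0`. -/
def smoothForms (r : ℕ) : Submodule ℝ (CV 3 → CV 3 [⋀^Fin r]→L[ℝ] ℝ) where
  carrier := {φ | φ 0 = 0 ∧ ContDiffOn ℝ ∞ φ {0}ᶜ ∧
    (∀ z ≠ 0, ∀ v : Fin r → CV 3, (∃ i, ∃ c : ℂ, v i = c • z) → φ z v = 0) ∧
    (∀ z ≠ 0, ∀ c : ℂ, c ≠ 0 → ∀ v : Fin r → CV 3, φ (c • z) (fun i => c • v i) = φ z v)}
  add_mem' := by
    rintro φ ψ ⟨a0, a1, a2, a3⟩ ⟨b0, b1, b2, b3⟩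
    refine ⟨by simp [a0, b0], a1.add b1, fun z hz v hv => ?_, fun z hz c hc v => ?_⟩
    · simp [a2 z hz v hv, b2 z hz v hv]
    · simp [a3 z hz c hc v, b3 z hz c hc v]
  zero_mem' := by
    refine ⟨rfl, contDiffOn_const, fun z hz v hv => ?_, fun z hz c hc v => ?_⟩ <;> simp
  smul_mem' := by
    rintro a φ ⟨a0, a1, a2, a3⟩
    refine ⟨by simp [a0], a1.const_smul a, fun z hz v hv => ?_, fun z hz c hc v => ?_⟩
    · simp [a2 z hz v hv]
    · simp [a3 z hz c hc v]

/-- The `2p`-tuple `(v₁, i v₁, …, vₚ, i vₚ)`. -/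
def complexTuple {p : ℕ} (v : Fin p → CV 3) : Fin (2 * p) → CV 3 := fun i =>
  (if i.val % 2 = 0 then (1 : ℂ) else Complex.I) • v ⟨i.val / 2, by omega⟩

/-- Continuity of a linear functional on the forms for the `C^∞` topology: it is bounded by a
`C^N` norm for some `N`. By homogeneity it is enough to take the suprema over a sphere. -/
def IsContinuousFunctional {r : ℕ} (T : smoothForms r →ₗ[ℝ] ℝ) : Prop :=
  ∃ (N : ℕ) (C : ℝ), ∀ (φ : smoothForms r) (M : ℝ),
    (∀ j ≤ N, ∀ z : CV 3, ‖z‖ = 1 → ‖iteratedFDeriv ℝ j φ.1 z‖ ≤ M) → |T φ| ≤ C * M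

/-- Positivity: `T` is nonnegative on every `2p`-form whose values on the tuples
`(v₁, i v₁, …, vₚ, i vₚ)` are nonnegative. Only the component of bidegree `(p, p)` of a form
contributes to these values, so `T` vanishes on the other components, which means that `T` is of
bidimension `(p, p)`. (On a complex surface all usual notions of positivity agree.) -/
def IsPositiveFunctional {p : ℕ} (T : smoothForms (2 * p) →ₗ[ℝ] ℝ) : Prop :=
  ∀ φ : smoothForms (2 * p),
    (∀ z ≠ 0, ∀ v : Fin p → CV 3, 0 ≤ φ.1 z (complexTuple v)) → 0 ≤ T φ

/-- Closedness: `T` vanishes on exact forms. -/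
def IsClosedFunctional : {p : ℕ} → (smoothForms (2 * p) →ₗ[ℝ] ℝ) → Prop
  | 0, _ => True
  | q + 1, T => ∀ (ψ : smoothForms (2 * q + 1)) (φ : smoothForms (2 * q + 1 + 1)),
      (∀ z ≠ 0, φ.1 z = extDeriv ψ.1 z) → T φ = 0

/-- A positive closed current of bidimension `(p, p)` on `ℙ²`. -/
structure IsPositiveClosedCurrent {p : ℕ} (T : smoothForms (2 * p) →ₗ[ℝ] ℝ) : Prop where
  continuous : IsContinuousFunctional T
  positive : IsPositiveFunctional T
  closed : IsClosedFunctional T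

/-- The (closed) set `A` contains the support of `T`: `T` vanishes on the forms that vanish in a
neighbourhood of `A`. -/
def IsSupportedIn {r : ℕ} (T : smoothForms r →ₗ[ℝ] ℝ) (A : Set (PS 3)) : Prop :=
  ∀ φ : smoothForms r,
    (∃ V : Set (PS 3), IsOpen V ∧ A ⊆ V ∧
      ∀ (z : CV 3) (hz : z ≠ 0), Projectivization.mk ℂ z hz ∈ V → φ.1 z = 0) → T φ = 0

/-- `A` supports a (nonzero) positive closed current of bidimension `(p, p)`. -/
def SupportsCurrent (A : Set (PS 3)) (p : ℕ) : Prop :=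
  ∃ T : smoothForms (2 * p) →ₗ[ℝ] ℝ, IsPositiveClosedCurrent T ∧ IsSupportedIn T A ∧ T ≠ 0

/-- An attracting set `A ⊆ ℙ²` is of dimension `s`: it supports a positive closed current of
bidimension `(s, s)` but none of bidimension `(l, l)` with `l > s` (bidimensions in `ℙ²` are at
most `(2, 2)`). -/
def HasDimension (A : Set (PS 3)) (s : ℕ) : Prop :=
  s ≤ 2 ∧ SupportsCurrent A s ∧ ∀ l, s < l → l ≤ 2 → ¬ SupportsCurrent A l

/-! ### Small topological degree -/

/-- The endomorphism `g` of `ℙ²`, of algebraic degree `δ`, is of small topological degree on `U`: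
`U` is a trapping region whose attracting set has dimension `s`, and every point of `g(U)` has
strictly less than `δ ^ s` preimages in `U`. -/
def IsOfSmallTopologicalDegreeOn (g : PS 3 → PS 3) (U : Set (PS 3)) : Prop :=
  ∃ δ s : ℕ, IsEndomorphism g δ ∧ IsTrappingRegion g U ∧ HasDimension (attractingSet g U) s ∧
    ∀ p ∈ g '' U, (g ⁻¹' {p} ∩ U).encard < ((δ ^ s : ℕ) : ℕ∞)

/-! ### The triples `(P, Q, R)` and the maps they define -/

/-- A triple `(P, Q, R)` of homogeneous polynomials of degree `d` in two variables such that
`(0, 0)` is the single common zero of `P` and `Q`. -/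
structure HomTriple (d : ℕ) where
  P : MvPolynomial (Fin 2) ℂ
  Q : MvPolynomial (Fin 2) ℂ
  R : MvPolynomial (Fin 2) ℂ
  homP : P.IsHomogeneous d
  homQ : Q.IsHomogeneous d
  homR : R.IsHomogeneous d
  common_zero : ∀ x : CV 2, MvPolynomial.eval x P = 0 → MvPolynomial.eval x Q = 0 → x = 0

namespace HomTriple

variable {d : ℕ} (T : HomTriple d)

/-- `f_∞ : [z : w] ↦ [P(z, w) : Q(z, w)]` on `ℙ¹`. -/
def fInf : PS 2 → PS 2 :=
  projMap (d := d) ![T.P, T.Q]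
    (by intro i; fin_cases i; exacts [T.homP, T.homQ])
    (fun x hx => T.common_zero x (hx 0) (hx 1))

/-- `f_∞⁺ : [z : w] ↦ [P(z, w) : Q(z, w) : R(z, w)]` from `ℙ¹` to `ℙ²`. -/
def fInfPlus : PS 2 → PS 3 :=
  projMap (d := d) ![T.P, T.Q, T.R]
    (by intro i; fin_cases i; exacts [T.homP, T.homQ, T.homR])
    (fun x hx => T.common_zero x (hx 0) (hx 1))

/-- The three polynomials `P(z, w)`, `Q(z, w)`, `t ^ d + ε R(z, w)` in the variables `z, w, t`. -/
def poly (ε : ℂ) : Fin 3 → MvPolynomial (Fin 3) ℂ :=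
  ![MvPolynomial.rename Fin.castSucc T.P, MvPolynomial.rename Fin.castSucc T.Q,
    MvPolynomial.X 2 ^ d + MvPolynomial.C ε * MvPolynomial.rename Fin.castSucc T.R]

theorem poly_isHomogeneous (ε : ℂ) (i : Fin 3) : (T.poly ε i).IsHomogeneous d := by
  fin_cases i
  · exact T.homP.rename_isHomogeneous
  · exact T.homQ.rename_isHomogeneous
  · refine MvPolynomial.IsHomogeneous.add ?_ ?_
    · simpa using (MvPolynomial.isHomogeneous_X ℂ (2 : Fin 3)).pow d
    · simpa using (MvPolynomial.isHomogeneous_C (Fin 3) ε).mul T.homR.rename_isHomogeneous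

theorem poly_common_zero (hd : d ≠ 0) (ε : ℂ) (x : CV 3)
    (hx : ∀ i, MvPolynomial.eval x (T.poly ε i) = 0) : x = 0 := by
  have h0 := hx 0
  have h1 := hx 1
  have h2 := hx 2
  simp only [poly, Matrix.cons_val_zero, Matrix.cons_val_one, Matrix.cons_val,
    MvPolynomial.eval_rename, map_add, map_mul, map_pow, MvPolynomial.eval_X,
    MvPolynomial.eval_C] at h0 h1 h2
  have hz := T.common_zero _ h0 h1
  have hR : MvPolynomial.eval (x ∘ Fin.castSucc) T.R = 0 := by
    have := eval_smul_of_isHomogeneous T.homR 0 (x ∘ Fin.castSucc)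
    rw [zero_smul, zero_pow hd, zero_mul] at this
    rw [hz, this]
  rw [hR, mul_zero, add_zero] at h2
  funext i
  fin_cases i
  · exact congrFun hz 0
  · exact congrFun hz 1
  · exact eq_zero_of_pow_eq_zero h2

/-- `f : [z : w : t] ↦ [P(z, w) : Q(z, w) : t ^ d + ε R(z, w)]` on `ℙ²`. -/
def f (hd : d ≠ 0) (ε : ℂ) : PS 3 → PS 3 :=
  projMap (T.poly ε) (T.poly_isHomogeneous ε) (T.poly_common_zero hd ε)

/-- The critical points of `f_∞`. At `[u]`, the differential of `f_∞` is the map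
`ℂ² / ℂ u → ℂ² / ℂ (P, Q)(u)` induced by the Jacobian matrix of `(P, Q)` at `u`, which maps `u`
to `d (P, Q)(u)`; so it vanishes if and only if the Jacobian determinant does. -/
def critical : Set (PS 2) :=
  {p | ∃ (u : CV 2) (hu : u ≠ 0), p = Projectivization.mk ℂ u hu ∧
    MvPolynomial.eval u (MvPolynomial.pderiv 0 T.P * MvPolynomial.pderiv 1 T.Q -
      MvPolynomial.pderiv 1 T.P * MvPolynomial.pderiv 0 T.Q) = 0}

/-- `X₋₁`: the pairs of distinct points with the same image by `f_∞⁺`, and the pairs `(p, p)`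
where `p` is a critical point of `f_∞`. -/
def Xm1 : Set (PS 2 × PS 2) :=
  {pq | pq.1 ≠ pq.2 ∧ T.fInfPlus pq.1 = T.fInfPlus pq.2} ∪
    {pq | pq.1 = pq.2 ∧ pq.1 ∈ T.critical}

/-- `Y₋₂`: the pairs `([u], [v])`, where `u` and `v` are normalized so that
`(P, Q)(u) = (P, Q)(v)`, such that `R(u) = ζ R(v)` for some `d`-th root of unity `ζ ≠ 1`.
For `[u] = [v]` this says that `R(u) = 0`. -/
def Ym2 : Set (PS 2 × PS 2) :=
  {pq | ∃ (u v : CV 2) (hu : u ≠ 0) (hv : v ≠ 0),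
    pq = (Projectivization.mk ℂ u hu, Projectivization.mk ℂ v hv) ∧
    MvPolynomial.eval u T.P = MvPolynomial.eval v T.P ∧
    MvPolynomial.eval u T.Q = MvPolynomial.eval v T.Q ∧
    ∃ ζ : ℂ, ζ ^ d = 1 ∧ ζ ≠ 1 ∧ MvPolynomial.eval u T.R = ζ * MvPolynomial.eval v T.R}

/-- `X = f_∞(pr₁(X₋₁))`. -/
def X : Set (PS 2) := T.fInf '' (Prod.fst '' T.Xm1)

/-- `Y = f_∞²(pr₁(Y₋₂))`. -/
def Y : Set (PS 2) := T.fInf^[2] '' (Prod.fst '' T.Ym2)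

/-- `Z = X ∪ Y`. -/
def Z : Set (PS 2) := T.X ∪ T.Y

end HomTriple

/-- `U_ρ = {[z : w : t] ; |t| < ρ max(|z|, |w|)}`. -/
def regionU (ρ : ℝ) : Set (PS 3) :=
  {p | ∃ (x : CV 3) (hx : x ≠ 0), p = Projectivization.mk ℂ x hx ∧
    ‖x 2‖ < ρ * max ‖x 0‖ ‖x 1‖}

end SmallDegree

end

noncomputable section

namespace SmallDegree

open Filter Topology

/-! ### The topology of projective space -/

/-! The radius is `ρ = K‖ε‖`. A point `[x]` of `f(U_ρ)` is the image of some `[w]` in `U_ρ`, and the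
term `w₂ ^ d` of its last coordinate has size `O(ρ ^ d)`, negligible compared with `ε` because `d ≥
2`. Hence `x₂` is nearly `ε R(v)` for some `v` with `(P, Q)(v) = head x`.

Let `[y]` have two distinct preimages `[x]`, `[x']` in `f(U_ρ)`, with lifts such that `F x = F x' =
y`. Both `head x` and `head x'` are mapped to `head y` by `(P, Q)`, and both `R(head x)` and `R(head
x')` are close to `y₂ / ε`. If their directions differ, `head y` is nearly in the cone over `X`. If
the directions agree, a root of unity makes the heads equal; then `x₂ = ξ x'₂` with `ξ ^ d = 1`, `ξ
≠ 1`, and comparing the previous images gives `R(v) ≈ ξ R(v')`, so `head y` is nearly in the cone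
over `Y`. Compactness and homogeneity turn the two hypotheses on `X`, `Y`, `Z` into uniform
statements about these near coincidences (`exists_not_nearX_and_nearY`, `exists_not_nearZ_chain`).

Away from `X` all preimages have one direction and at most `d` last coordinates; away from `Y` each
of the at most `d` directions carries one preimage; so there are always at most `d` of them
(`encard_preim_le`), and at most one away from `Z` (`encard_preim_le_one`). Along three successive
steps some point is away from `Z`, so `f^3` has at most `d ^ 2 < d ^ 3` preimages
(`encard_preim_three_lt`), where `d ^ 3` is its algebraic degree.

It remains to see that the attracting set has dimension `1`. A limit of the normalized push-forwards
of the line `t = 0` is a positive closed current on it; its mass does not vanish because `f^*`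
multiplies the class of the Fubini–Study form by `d` (`supportsCurrent_one`). There is none of
bidimension `(2, 2)`, since on `U_ρ`, which stays away from `[0 : 0 : 1]`, suitable volume forms
coincide with exact forms (`not_supportsCurrent_two`). -/

/-- The cone over a subset of projective space, with the origin removed. -/
def cone {n : ℕ} (U : Set (PS n)) : Set (CV n) :=
  {v | ∃ h : v ≠ 0, Projectivization.mk ℂ v h ∈ U}

/-- The nonzero vectors form an open set, so the quotient topology can be tested in `ℂⁿ` itself,
where analysis is available. -/
theorem isOpen_iff_cone {n : ℕ} {U : Set (PS n)} : IsOpen U ↔ IsOpen (cone U) := by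
  have h0 : IsOpen {v : CV n | v ≠ 0} := isOpen_compl_singleton
  rw [isOpen_coinduced, h0.isOpenEmbedding_subtypeVal.isOpen_iff_image_isOpen]
  have : Subtype.val '' ((fun v : {v : CV n // v ≠ 0} => Projectivization.mk ℂ v.1 v.2) ⁻¹' U) =
      cone U := by
    ext v
    constructor
    · rintro ⟨w, hw, rfl⟩
      exact ⟨w.2, hw⟩
    · rintro ⟨h, hv⟩
      exact ⟨⟨v, h⟩, hv, rfl⟩
  rw [← this]
  rfl

theorem continuous_mk {n : ℕ} :
    Continuous (fun v : {v : CV n // v ≠ 0} => Projectivization.mk ℂ v.1 v.2) :=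
  continuous_coinduced_rng

theorem eval_zero_of_isHomogeneous {n d : ℕ} (hd : d ≠ 0) {F : MvPolynomial (Fin n) ℂ}
    (hF : F.IsHomogeneous d) : MvPolynomial.eval 0 F = 0 := by
  have := eval_smul_of_isHomogeneous hF 0 0
  rwa [zero_smul, zero_pow hd, zero_mul] at this

theorem continuous_projMap {n m d : ℕ} (F : Fin m → MvPolynomial (Fin n) ℂ)
    (hF : ∀ i, (F i).IsHomogeneous d)
    (h0 : ∀ x : CV n, (∀ i, MvPolynomial.eval x (F i) = 0) → x = 0) :
    Continuous (projMap F hF h0) := by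
  refine continuous_coinduced_dom.2 ?_
  refine continuous_mk.comp (f := fun v : {v : CV n // v ≠ 0} =>
    (⟨fun i => MvPolynomial.eval v.1 (F i), fun h => v.2 (h0 v.1 fun i => congrFun h i)⟩ :
      {v : CV m // v ≠ 0})) ?_
  refine Continuous.subtype_mk ?_ _
  exact continuous_pi fun i => (MvPolynomial.continuous_eval (F i)).comp continuous_subtype_val

theorem exists_mk_norm_one {n : ℕ} (p : PS n) :
    ∃ (v : CV n) (h : v ≠ 0), ‖v‖ = 1 ∧ p = Projectivization.mk ℂ v h := by
  induction p using Projectivization.ind with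
  | h v hv =>
    have h1 : (‖v‖ : ℂ) ≠ 0 := by exact_mod_cast norm_ne_zero_iff.2 hv
    refine ⟨(‖v‖ : ℂ)⁻¹ • v, smul_ne_zero (inv_ne_zero h1) hv, ?_, ?_⟩
    · rw [norm_smul, norm_inv, Complex.norm_real, norm_norm, inv_mul_cancel₀]
      exact norm_ne_zero_iff.2 hv
    · rw [Projectivization.mk_eq_mk_iff']
      exact ⟨‖v‖, by rw [smul_smul, mul_inv_cancel₀ h1, one_smul]⟩

instance instCompactSpacePS (n : ℕ) : CompactSpace (PS n) := by
  have : CompactSpace (Metric.sphere (0 : CV n) 1) := isCompact_iff_compactSpace.1 (isCompact_sphere 0 1)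
  let g : Metric.sphere (0 : CV n) 1 → PS n := fun v =>
    Projectivization.mk ℂ v.1 (norm_ne_zero_iff.1 (by
      have := mem_sphere_zero_iff_norm.1 v.2
      rw [this]; exact one_ne_zero))
  have hg : Continuous g := continuous_mk.comp (f := fun v : Metric.sphere (0 : CV n) 1 =>
    (⟨v.1, norm_ne_zero_iff.1 (by
      have := mem_sphere_zero_iff_norm.1 v.2
      rw [this]; exact one_ne_zero)⟩ : {v : CV n // v ≠ 0})) (Continuous.subtype_mk continuous_subtype_val _)
  have hs : Function.Surjective g := fun p => by
    obtain ⟨v, h, hv, rfl⟩ := exists_mk_norm_one p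
    exact ⟨⟨v, mem_sphere_zero_iff_norm.2 hv⟩, rfl⟩
  exact ⟨by rw [← hs.range_eq]; exact isCompact_range hg⟩

instance instT2SpacePS (n : ℕ) : T2Space (PS n) := by
  refine ⟨fun p q hpq => ?_⟩
  obtain ⟨a, ha, hna, rfl⟩ := exists_mk_norm_one p
  -- The normalized sum of the absolute values of the `2 × 2` minors of `(v, a)`: a continuous
  -- function on projective space that vanishes only at `[a]`, hence separates it from any other
  -- point.
  let F : {v : CV n // v ≠ 0} → ℝ := fun v =>
    (∑ i, ∑ j, ‖v.1 i * a j - v.1 j * a i‖) / ‖v.1‖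
  let φ : PS n → ℝ := Projectivization.lift F (by
    intro v w t h
    have ht : t ≠ 0 := by rintro rfl; exact v.2 (by simp [h])
    have : ‖t‖ ≠ 0 := norm_ne_zero_iff.2 ht
    simp only [F, h, Pi.smul_apply, smul_eq_mul, mul_assoc, ← mul_sub, norm_mul, norm_smul,
      ← Finset.mul_sum]
    rw [mul_div_mul_left _ _ this])
  have hφ : Continuous φ := by
    refine continuous_coinduced_dom.2 ?_
    change Continuous F
    refine Continuous.div
      (continuous_finsetSum _ fun i _ => continuous_finsetSum _ fun j _ =>
        ((((continuous_apply i).comp continuous_subtype_val).mul continuous_const).sub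
          (((continuous_apply j).comp continuous_subtype_val).mul continuous_const)).norm)
      (by fun_prop) fun v => norm_ne_zero_iff.2 v.2
  refine separated_by_continuous hφ (x := Projectivization.mk ℂ a ha) (y := q) fun h => hpq ?_
  obtain ⟨b, hb, hnb, rfl⟩ := exists_mk_norm_one q
  have h1 : F ⟨b, hb⟩ = 0 := by
    have : φ (Projectivization.mk ℂ b hb) = F ⟨b, hb⟩ := rfl
    rw [← this, ← h]
    change F ⟨a, ha⟩ = 0
    simp [F, mul_comm]
  have h2 : ∀ i j, b i * a j = b j * a i := by
    simp only [F, hnb, div_one] at h1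
    intro i j
    rw [Finset.sum_eq_zero_iff_of_nonneg (fun _ _ => Finset.sum_nonneg fun _ _ => norm_nonneg _)] at h1
    have := h1 i (Finset.mem_univ i)
    rw [Finset.sum_eq_zero_iff_of_nonneg (fun _ _ => norm_nonneg _)] at this
    exact sub_eq_zero.1 (norm_eq_zero.1 (this j (Finset.mem_univ j)))
  obtain ⟨j, hj⟩ := Function.ne_iff.1 hb
  rw [Projectivization.mk_eq_mk_iff']
  refine ⟨a j / b j, ?_⟩
  funext i
  simp only [Pi.smul_apply, smul_eq_mul]
  have hj' : b j ≠ 0 := hj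
  field_simp
  rw [mul_comm, h2 i j]

/-! ### Homogeneous polynomial maps -/

/-- This links the formal partial derivatives in the definition of critical points to the analytic
derivative; it is strict for use in the inverse function theorem. -/
theorem exists_hasStrictFDerivAt_eval {n : ℕ} (F : MvPolynomial (Fin n) ℂ) (u : CV n) :
    ∃ L : CV n →L[ℂ] ℂ, HasStrictFDerivAt (fun v : CV n => MvPolynomial.eval v F) L u ∧
      ∀ v, L v = ∑ i, MvPolynomial.eval u (MvPolynomial.pderiv i F) * v i := by
  induction F using MvPolynomial.induction_on with
  | C a =>
    simp only [MvPolynomial.eval_C]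
    exact ⟨0, hasStrictFDerivAt_const a u, by simp⟩
  | add p q hp hq =>
    obtain ⟨L, hL, hL'⟩ := hp
    obtain ⟨M, hM, hM'⟩ := hq
    simp only [map_add]
    exact ⟨L + M, HasStrictFDerivAt.fun_add hL hM, fun v => by
      simp only [_root_.add_apply, hL', hM', add_mul, Finset.sum_add_distrib]⟩
  | mul_X p i hp =>
    obtain ⟨L, hL, hL'⟩ := hp
    have hX : HasStrictFDerivAt (fun v : CV n => v i) (ContinuousLinearMap.proj i : CV n →L[ℂ] ℂ) u :=
      (ContinuousLinearMap.proj i : CV n →L[ℂ] ℂ).hasStrictFDerivAt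
    simp only [map_mul, MvPolynomial.eval_X]
    refine ⟨_, HasStrictFDerivAt.fun_mul hL hX, fun v => ?_⟩
    simp only [_root_.add_apply, _root_.smul_apply, hL',
      ContinuousLinearMap.proj_apply, Derivation.leibniz, MvPolynomial.pderiv_X, smul_eq_mul,
      map_add, map_mul, MvPolynomial.eval_X, add_mul, Finset.sum_add_distrib]
    congr 1
    · rw [Finset.sum_eq_single i]
      · simp
      · intro j _ hj
        simp [hj.symm]
      · simp
    · rw [Finset.mul_sum]
      exact Finset.sum_congr rfl fun j _ => by rw [mul_assoc]

theorem exists_pos_bound_of_homogeneous {n d : ℕ} {E : Type*} [NormedAddCommGroup E]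
    [NormedSpace ℂ E] {g : CV n → E} (hd : d ≠ 0) (hg : Continuous g)
    (hs : ∀ (t : ℂ) v, g (t • v) = t ^ d • g v) :
    ∃ C : ℝ, 0 < C ∧ ∀ v, ‖g v‖ ≤ C * ‖v‖ ^ d := by
  obtain ⟨C, hC⟩ := ((isCompact_sphere (0 : CV n) 1).image hg).isBounded.exists_norm_le
  refine ⟨max C 1, lt_max_of_lt_right one_pos, fun v => ?_⟩
  rcases eq_or_ne v 0 with rfl | hv
  · have := hs 0 0
    rw [zero_pow hd, zero_smul, zero_smul] at this
    simp [this, hd]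
  · have h1 : ‖v‖ ≠ 0 := norm_ne_zero_iff.2 hv
    have h2 : v = (‖v‖ : ℂ) • ((‖v‖ : ℂ)⁻¹ • v) := by
      rw [smul_smul, mul_inv_cancel₀ (by exact_mod_cast h1), one_smul]
    have h3 : ‖(‖v‖ : ℂ)⁻¹ • v‖ = 1 := by
      rw [norm_smul, norm_inv, Complex.norm_real, norm_norm, inv_mul_cancel₀ h1]
    have h4 := hC _ (Set.mem_image_of_mem g (mem_sphere_zero_iff_norm.2 h3))
    calc ‖g v‖ = ‖v‖ ^ d * ‖g ((‖v‖ : ℂ)⁻¹ • v)‖ := by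
          conv_lhs => rw [h2, hs, norm_smul, norm_pow, Complex.norm_real, norm_norm]
      _ ≤ ‖v‖ ^ d * max C 1 := by gcongr; exact h4.trans (le_max_left _ _)
      _ = _ := mul_comm _ _

theorem exists_pos_lower_bound_of_homogeneous {n d : ℕ} {E : Type*} [NormedAddCommGroup E]
    [NormedSpace ℂ E] {g : CV n → E} (hd : d ≠ 0) (hg : Continuous g)
    (hs : ∀ (t : ℂ) v, g (t • v) = t ^ d • g v) (h0 : ∀ v, g v = 0 → v = 0) :
    ∃ c : ℝ, 0 < c ∧ ∀ v, c * ‖v‖ ^ d ≤ ‖g v‖ := by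
  have key : ∃ c : ℝ, 0 < c ∧ ∀ v ∈ Metric.sphere (0 : CV n) 1, c ≤ ‖g v‖ := by
    refine (isCompact_sphere (0 : CV n) 1).exists_forall_le' hg.norm.continuousOn (a := 0) ?_
    intro v hv
    refine norm_pos_iff.2 fun h => ?_
    have := mem_sphere_zero_iff_norm.1 hv
    rw [h0 v h, norm_zero] at this
    exact zero_ne_one this
  obtain ⟨c, hc, hC⟩ := key
  refine ⟨c, hc, fun v => ?_⟩
  rcases eq_or_ne v 0 with rfl | hv
  · simp [hd]
  · have h1 : ‖v‖ ≠ 0 := norm_ne_zero_iff.2 hv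
    have h2 : v = (‖v‖ : ℂ) • ((‖v‖ : ℂ)⁻¹ • v) := by
      rw [smul_smul, mul_inv_cancel₀ (by exact_mod_cast h1), one_smul]
    have h3 : ‖(‖v‖ : ℂ)⁻¹ • v‖ = 1 := by
      rw [norm_smul, norm_inv, Complex.norm_real, norm_norm, inv_mul_cancel₀ h1]
    have h4 := hC _ (mem_sphere_zero_iff_norm.2 h3)
    calc c * ‖v‖ ^ d ≤ ‖g ((‖v‖ : ℂ)⁻¹ • v)‖ * ‖v‖ ^ d := by gcongr
      _ = ‖g v‖ := by
          conv_rhs => rw [h2, hs, norm_smul, norm_pow, Complex.norm_real, norm_norm]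
          exact mul_comm _ _

theorem exists_pow_eq_complex {d : ℕ} (hd : d ≠ 0) (a : ℂ) : ∃ t : ℂ, t ^ d = a :=
  IsAlgClosed.exists_pow_nat_eq a (Nat.pos_of_ne_zero hd)

namespace HomTriple

variable {d : ℕ} (T : HomTriple d)

/-- The lift `(P, Q)` of `f_∞` to `ℂ²`. -/
def G (u : CV 2) : CV 2 := fun i => MvPolynomial.eval u (![T.P, T.Q] i)

/-- The polynomial function `R`. -/
def r (u : CV 2) : ℂ := MvPolynomial.eval u T.R

theorem homG (i : Fin 2) : (![T.P, T.Q] i).IsHomogeneous d := by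
  fin_cases i; exacts [T.homP, T.homQ]

theorem G_smul (t : ℂ) (u : CV 2) : T.G (t • u) = t ^ d • T.G u := by
  funext i
  exact eval_smul_of_isHomogeneous (T.homG i) t u

theorem r_smul (t : ℂ) (u : CV 2) : T.r (t • u) = t ^ d * T.r u :=
  eval_smul_of_isHomogeneous T.homR t u

theorem eq_zero_of_G_eq_zero {u : CV 2} (h : T.G u = 0) : u = 0 :=
  T.common_zero u (congrFun h 0) (congrFun h 1)

theorem G_ne_zero {u : CV 2} (h : u ≠ 0) : T.G u ≠ 0 := fun h' => h (T.eq_zero_of_G_eq_zero h')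

theorem continuous_G : Continuous T.G :=
  continuous_pi fun i => MvPolynomial.continuous_eval (![T.P, T.Q] i)

theorem continuous_r : Continuous T.r := MvPolynomial.continuous_eval T.R

theorem G_zero (hd : d ≠ 0) : T.G 0 = 0 := by
  have := T.G_smul 0 0
  rwa [zero_smul, zero_pow hd, zero_smul] at this

theorem ne_zero_of_G_eq (hd : d ≠ 0) {u b : CV 2} (hb : b ≠ 0) (h : T.G u = b) : u ≠ 0 := by
  rintro rfl
  exact hb (by rw [← h, T.G_zero hd])

theorem fInf_mk (u : CV 2) (hu : u ≠ 0) :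
    T.fInf (Projectivization.mk ℂ u hu) = Projectivization.mk ℂ (T.G u) (T.G_ne_zero hu) := rfl

/-! ### Approximate versions of `X` and `Y` -/

/-- `b` has two preimages by `(P, Q)` in different directions with nearly the same value of `R`. -/
def NearX (η : ℝ) (b : CV 2) : Prop :=
  ∃ u v : CV 2, T.G u = b ∧ T.G v = b ∧ (∀ c : ℂ, u ≠ c • v) ∧ ‖T.r u - T.r v‖ ≤ η * ‖b‖

/-- `b = (P, Q)²(u) = (P, Q)²(v)` where `R(u)` is nearly `ξ R(v)`, with `ξ` a nontrivial root of
unity. -/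
def NearY (η : ℝ) (b : CV 2) : Prop :=
  ∃ (u v : CV 2) (ξ : ℂ), T.G u = T.G v ∧ T.G (T.G u) = b ∧ ξ ^ d = 1 ∧ ξ ≠ 1 ∧
    ‖T.r u - ξ * T.r v‖ ≤ η * ‖T.G u‖

/-- `b` is nearly in the cone over `Z`. -/
def NearZ (η : ℝ) (b : CV 2) : Prop := T.NearX η b ∨ T.NearY η b

theorem NearX.mono {η η' : ℝ} (h : η ≤ η') {b : CV 2} : T.NearX η b → T.NearX η' b := by
  rintro ⟨u, v, h1, h2, h3, h4⟩
  exact ⟨u, v, h1, h2, h3, h4.trans (by gcongr)⟩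

theorem NearY.mono {η η' : ℝ} (h : η ≤ η') {b : CV 2} : T.NearY η b → T.NearY η' b := by
  rintro ⟨u, v, ξ, h1, h2, h3, h4, h5⟩
  exact ⟨u, v, ξ, h1, h2, h3, h4, h5.trans (by gcongr)⟩

theorem NearZ.mono {η η' : ℝ} (h : η ≤ η') {b : CV 2} : T.NearZ η b → T.NearZ η' b :=
  Or.imp (NearX.mono T h) (NearY.mono T h)

theorem NearX.smul (hd : d ≠ 0) {η : ℝ} {b : CV 2} (h : T.NearX η b) {c : ℂ} (hc : c ≠ 0) :
    T.NearX η (c • b) := by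
  obtain ⟨t, ht⟩ := exists_pow_eq_complex hd c
  have ht0 : t ≠ 0 := by rintro rfl; exact hc (by rw [← ht, zero_pow hd])
  obtain ⟨u, v, h1, h2, h3, h4⟩ := h
  refine ⟨t • u, t • v, by rw [T.G_smul, ht, h1], by rw [T.G_smul, ht, h2], fun a ha => h3 a ?_, ?_⟩
  · rw [smul_comm] at ha
    exact smul_right_injective _ ht0 ha
  · rw [T.r_smul, T.r_smul, ht, ← mul_sub, norm_mul, norm_smul, mul_left_comm]
    gcongr

theorem NearY.smul (hd : d ≠ 0) {η : ℝ} {b : CV 2} (h : T.NearY η b) (c : ℂ) :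
    T.NearY η (c • b) := by
  obtain ⟨s, hs⟩ := exists_pow_eq_complex hd c
  obtain ⟨t, ht⟩ := exists_pow_eq_complex hd s
  obtain ⟨u, v, ξ, h1, h2, h3, h4, h5⟩ := h
  refine ⟨t • u, t • v, ξ, by rw [T.G_smul, T.G_smul, h1],
    by rw [T.G_smul, ht, T.G_smul, hs, h2], h3, h4, ?_⟩
  rw [T.r_smul, T.r_smul, T.G_smul, ht, mul_left_comm, ← mul_sub, norm_mul, norm_smul,
    mul_left_comm]
  gcongr

theorem NearZ.smul (hd : d ≠ 0) {η : ℝ} {b : CV 2} (h : T.NearZ η b) {c : ℂ} (hc : c ≠ 0) :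
    T.NearZ η (c • b) :=
  h.imp (fun h => NearX.smul T hd h hc) (fun h => NearY.smul T hd h c)

theorem mem_X_of_pair (hd : d ≠ 0) {u v b : CV 2} (hb : b ≠ 0) (hu : T.G u = b) (hv : T.G v = b)
    (huv : ∀ c : ℂ, u ≠ c • v) (hr : T.r u = T.r v) : Projectivization.mk ℂ b hb ∈ T.X := by
  have hu0 := T.ne_zero_of_G_eq hd hb hu
  have hv0 := T.ne_zero_of_G_eq hd hb hv
  refine ⟨Projectivization.mk ℂ u hu0, ⟨(Projectivization.mk ℂ u hu0, Projectivization.mk ℂ v hv0),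
    Or.inl ⟨fun h => ?_, ?_⟩, rfl⟩, ?_⟩
  · obtain ⟨c, hc⟩ := (Projectivization.mk_eq_mk_iff' ..).1 h
    exact huv c hc.symm
  · simp only [fInfPlus, projMap_mk]
    congr 1
    funext i
    fin_cases i
    · exact congrFun (hu.trans hv.symm) 0
    · exact congrFun (hu.trans hv.symm) 1
    · exact hr
  · rw [T.fInf_mk]
    congr 1

theorem mem_X_of_critical {u b : CV 2} (hu0 : u ≠ 0) (hb : b ≠ 0) (hu : T.G u = b)
    (hJ : MvPolynomial.eval u (MvPolynomial.pderiv 0 T.P * MvPolynomial.pderiv 1 T.Q -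
      MvPolynomial.pderiv 1 T.P * MvPolynomial.pderiv 0 T.Q) = 0) :
    Projectivization.mk ℂ b hb ∈ T.X := by
  refine ⟨Projectivization.mk ℂ u hu0, ⟨(Projectivization.mk ℂ u hu0, Projectivization.mk ℂ u hu0),
    Or.inr ⟨rfl, u, hu0, rfl, hJ⟩, rfl⟩, ?_⟩
  rw [T.fInf_mk]
  congr 1

theorem mem_Y (hd : d ≠ 0) {u v b : CV 2} {ξ : ℂ} (hb : b ≠ 0) (huv : T.G u = T.G v)
    (hu : T.G (T.G u) = b) (hξ : ξ ^ d = 1) (hξ1 : ξ ≠ 1) (hr : T.r u = ξ * T.r v) :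
    Projectivization.mk ℂ b hb ∈ T.Y := by
  have hg0 := T.ne_zero_of_G_eq hd hb hu
  have hu0 := T.ne_zero_of_G_eq hd hg0 rfl
  have hv0 := T.ne_zero_of_G_eq hd hg0 huv.symm
  refine ⟨Projectivization.mk ℂ u hu0, ⟨(Projectivization.mk ℂ u hu0, Projectivization.mk ℂ v hv0),
    ⟨u, v, hu0, hv0, rfl, congrFun huv 0, congrFun huv 1, ξ, hξ, hξ1, hr⟩, rfl⟩, ?_⟩
  simp only [Function.iterate_succ, Function.iterate_zero, Function.comp, id, T.fInf_mk]
  congr 1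

/-! ### Compactness: from exact to approximate coincidences. -/

theorem exists_bound_of_G (hd : d ≠ 0) (K : ℝ) : ∃ B : ℝ, ∀ u, ‖T.G u‖ ≤ K → ‖u‖ ≤ B := by
  obtain ⟨c, hc, h⟩ := exists_pos_lower_bound_of_homogeneous hd T.continuous_G T.G_smul
    (fun v => T.eq_zero_of_G_eq_zero)
  refine ⟨max 1 (K / c), fun u hu => ?_⟩
  by_contra! hlt
  have h1 : 1 < ‖u‖ := (le_max_left _ _).trans_lt hlt
  have h2 : K / c < ‖u‖ := (le_max_right _ _).trans_lt hlt
  rw [div_lt_iff₀ hc] at h2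
  have h3 := le_self_pow₀ h1.le hd
  have := h u
  nlinarith

theorem exists_seq_of_not_eventually {N : ℝ → CV 2 → Prop} {b : CV 2}
    (h : ¬ ∃ η > 0, ∀ᶠ b' in 𝓝 b, ¬ N η b') :
    ∃ (η : ℕ → ℝ) (x : ℕ → CV 2), Tendsto η atTop (𝓝 0) ∧ Tendsto x atTop (𝓝 b) ∧
      ∀ n, N (η n) (x n) := by
  push Not at h
  have : ∀ n : ℕ, ∃ x ∈ Metric.ball b (1 / ((n : ℝ) + 1)), N (1 / ((n : ℝ) + 1)) x := by
    intro n
    have h1 := h (1 / ((n : ℝ) + 1)) (by positivity)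
    have h2 : ∀ᶠ x in 𝓝 b, x ∈ Metric.ball b (1 / ((n : ℝ) + 1)) :=
      Metric.ball_mem_nhds b (by positivity)
    obtain ⟨x, hx, hx'⟩ := (h1.and_eventually h2).exists
    exact ⟨x, hx', hx⟩
  choose x hx hN using this
  refine ⟨_, x, tendsto_one_div_add_atTop_nhds_zero_nat, ?_, hN⟩
  refine tendsto_iff_dist_tendsto_zero.2 (squeeze_zero (fun _ => dist_nonneg) (fun n => ?_)
    tendsto_one_div_add_atTop_nhds_zero_nat)
  exact (Metric.mem_ball.1 (hx n)).le

/-- Inverse function theorem for the lift `(P, Q)` of `f_∞`. -/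
theorem injOn_nhds_of_jacobian_ne_zero {u : CV 2}
    (hJ : MvPolynomial.eval u (MvPolynomial.pderiv 0 T.P * MvPolynomial.pderiv 1 T.Q -
      MvPolynomial.pderiv 1 T.P * MvPolynomial.pderiv 0 T.Q) ≠ 0) :
    ∃ s ∈ 𝓝 u, Set.InjOn T.G s := by
  let A : Matrix (Fin 2) (Fin 2) ℂ :=
    fun i j => MvPolynomial.eval u (MvPolynomial.pderiv j (![T.P, T.Q] i))
  have hdet : A.det ≠ 0 := by
    rw [Matrix.det_fin_two]
    simpa [A] using hJ
  let L : CV 2 →L[ℂ] CV 2 := LinearMap.toContinuousLinearMap (Matrix.toLin' A)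
  have hL : HasStrictFDerivAt T.G L u := by
    refine hasStrictFDerivAt_pi'.2 fun i => ?_
    obtain ⟨M, hM, hM'⟩ := exists_hasStrictFDerivAt_eval (![T.P, T.Q] i) u
    refine hM.congr_fderiv (ContinuousLinearMap.ext fun v => ?_)
    rw [hM']
    rfl
  let e : CV 2 ≃ₗ[ℂ] CV 2 := LinearMap.equivOfIsUnitDet (f := Matrix.toLin' A)
    (by rw [LinearMap.det_toLin']; exact isUnit_iff_ne_zero.2 hdet)
  let E : CV 2 ≃L[ℂ] CV 2 := e.toContinuousLinearEquiv
  have hE : (E : CV 2 →L[ℂ] CV 2) = L := by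
    refine ContinuousLinearMap.ext fun v => ?_
    exact LinearMap.equivOfIsUnitDet_apply _ v
  rw [← hE] at hL
  exact ⟨_, (hL.toOpenPartialHomeomorph T.G).open_source.mem_nhds
    hL.mem_toOpenPartialHomeomorph_source, (hL.toOpenPartialHomeomorph T.G).injOn⟩

/-- Otherwise there are pairs of preimages of points tending to `b`, with `η` tending to `0`; a
limit pair exists because `(P, Q)` is proper, and it puts `[b]` in `X`. -/
theorem exists_not_nearX (hd : d ≠ 0) {b : CV 2} (hb : b ≠ 0)
    (hX : Projectivization.mk ℂ b hb ∉ T.X) : ∃ η > 0, ∀ᶠ b' in 𝓝 b, ¬ T.NearX η b' := by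
  by_contra hcon
  obtain ⟨η, x, hη, hx, hN⟩ := exists_seq_of_not_eventually hcon
  choose u v hu hv huv hr using hN
  obtain ⟨K, hK⟩ := hx.norm.bddAbove_range
  have hK' : ∀ n, ‖x n‖ ≤ K := fun n => hK ⟨n, rfl⟩
  obtain ⟨B, hB⟩ := T.exists_bound_of_G hd K
  have hmem : ∀ n, (u n, v n) ∈ Metric.closedBall (0 : CV 2) B ×ˢ Metric.closedBall (0 : CV 2) B :=
    fun n => ⟨mem_closedBall_zero_iff.2 (hB _ (by rw [hu]; exact hK' n)),
      mem_closedBall_zero_iff.2 (hB _ (by rw [hv]; exact hK' n))⟩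
  obtain ⟨⟨u0, v0⟩, -, φ, hφ, hlim⟩ :=
    ((isCompact_closedBall (0 : CV 2) B).prod (isCompact_closedBall (0 : CV 2) B)).tendsto_subseq hmem
  have hlu : Tendsto (u ∘ φ) atTop (𝓝 u0) := (continuous_fst.tendsto _).comp hlim
  have hlv : Tendsto (v ∘ φ) atTop (𝓝 v0) := (continuous_snd.tendsto _).comp hlim
  have hxφ : Tendsto (x ∘ φ) atTop (𝓝 b) := hx.comp hφ.tendsto_atTop
  have hηφ : Tendsto (η ∘ φ) atTop (𝓝 0) := hη.comp hφ.tendsto_atTop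
  have hGu : T.G u0 = b := tendsto_nhds_unique ((T.continuous_G.tendsto u0).comp hlu)
    (hxφ.congr fun n => (hu _).symm)
  have hGv : T.G v0 = b := tendsto_nhds_unique ((T.continuous_G.tendsto v0).comp hlv)
    (hxφ.congr fun n => (hv _).symm)
  have hR : T.r u0 = T.r v0 := by
    have h1 : Tendsto (fun n => ‖T.r (u (φ n)) - T.r (v (φ n))‖) atTop (𝓝 ‖T.r u0 - T.r v0‖) :=
      (((T.continuous_r.tendsto u0).comp hlu).sub ((T.continuous_r.tendsto v0).comp hlv)).norm
    have h2 : Tendsto (fun n => η (φ n) * ‖x (φ n)‖) atTop (𝓝 (0 * ‖b‖)) := hηφ.mul hxφ.norm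
    have h3 := le_of_tendsto_of_tendsto' h1 h2 fun n => hr (φ n)
    rw [zero_mul] at h3
    exact sub_eq_zero.1 (norm_le_zero_iff.1 h3)
  -- The two directions may merge in the limit; this is where the critical points in `X₋₁` are
  -- needed. If the limit were not critical, `u` and `c • v`, which have the same image and tend to
  -- the same point, would coincide.
  by_cases hc : ∃ c : ℂ, u0 = c • v0
  · obtain ⟨c, hc⟩ := hc
    have hcd : c ^ d = 1 := by
      have h1 : c ^ d • b = (1 : ℂ) • b := by rw [one_smul, ← hGv, ← T.G_smul, ← hc, hGu, hGv]
      exact smul_left_injective ℂ hb h1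
    have hu0 : u0 ≠ 0 := T.ne_zero_of_G_eq hd hb hGu
    refine hX (T.mem_X_of_critical hu0 hb hGu ?_)
    by_contra hJ
    obtain ⟨s, hs, hinj⟩ := T.injOn_nhds_of_jacobian_ne_zero hJ
    have hlv' : Tendsto (fun n => c • v (φ n)) atTop (𝓝 u0) := by
      rw [hc]; exact hlv.const_smul c
    obtain ⟨n, hn1, hn2⟩ := ((hlu.eventually hs).and (hlv'.eventually hs)).exists
    refine huv (φ n) c (hinj hn1 hn2 ?_)
    change T.G (u (φ n)) = _
    rw [T.G_smul, hcd, one_smul, hu, hv]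
  · push Not at hc
    exact hX (T.mem_X_of_pair hd hb hGu hGv hc hR)

theorem exists_not_nearY (hd : d ≠ 0) {b : CV 2} (hb : b ≠ 0)
    (hY : Projectivization.mk ℂ b hb ∉ T.Y) : ∃ η > 0, ∀ᶠ b' in 𝓝 b, ¬ T.NearY η b' := by
  by_contra hcon
  obtain ⟨η, x, hη, hx, hN⟩ := exists_seq_of_not_eventually hcon
  choose u v ξ huv hu hξ hξ1 hr using hN
  obtain ⟨K, hK⟩ := hx.norm.bddAbove_range
  have hK' : ∀ n, ‖x n‖ ≤ K := fun n => hK ⟨n, rfl⟩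
  obtain ⟨B, hB⟩ := T.exists_bound_of_G hd K
  obtain ⟨B', hB'⟩ := T.exists_bound_of_G hd B
  have hbd : ∀ n, ‖u n‖ ≤ B' ∧ ‖v n‖ ≤ B' := fun n => by
    have h1 : ‖T.G (u n)‖ ≤ B := hB _ (by rw [hu]; exact hK' n)
    exact ⟨hB' _ h1, hB' _ (by rw [← huv]; exact h1)⟩
  -- Finiteness makes this set compact, so that the limit of the `ξ n` is still different from `1`.
  have hfin : {z : ℂ | z ^ d = 1 ∧ z ≠ 1}.Finite := by
    refine (Polynomial.nthRoots d (1 : ℂ)).toFinset.finite_toSet.subset fun z hz => ?_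
    simpa [Polynomial.mem_nthRoots (Nat.pos_of_ne_zero hd)] using hz.1
  have hmem : ∀ n, (u n, v n, ξ n) ∈ Metric.closedBall (0 : CV 2) B' ×ˢ
      Metric.closedBall (0 : CV 2) B' ×ˢ {z : ℂ | z ^ d = 1 ∧ z ≠ 1} :=
    fun n => ⟨mem_closedBall_zero_iff.2 (hbd n).1, mem_closedBall_zero_iff.2 (hbd n).2,
      hξ n, hξ1 n⟩
  obtain ⟨⟨u0, v0, ξ0⟩, ⟨-, -, hξ0, hξ10⟩, φ, hφ, hlim⟩ :=
    ((isCompact_closedBall (0 : CV 2) B').prod ((isCompact_closedBall (0 : CV 2) B').prod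
      hfin.isCompact)).tendsto_subseq hmem
  have hlu : Tendsto (u ∘ φ) atTop (𝓝 u0) := (continuous_fst.tendsto _).comp hlim
  have hlv : Tendsto (v ∘ φ) atTop (𝓝 v0) :=
    ((continuous_fst.comp continuous_snd).tendsto _).comp hlim
  have hlξ : Tendsto (ξ ∘ φ) atTop (𝓝 ξ0) :=
    ((continuous_snd.comp continuous_snd).tendsto _).comp hlim
  have hxφ : Tendsto (x ∘ φ) atTop (𝓝 b) := hx.comp hφ.tendsto_atTop
  have hηφ : Tendsto (η ∘ φ) atTop (𝓝 0) := hη.comp hφ.tendsto_atTop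
  have hlGu : Tendsto (fun n => T.G (u (φ n))) atTop (𝓝 (T.G u0)) :=
    (T.continuous_G.tendsto u0).comp hlu
  have hG : T.G u0 = T.G v0 := tendsto_nhds_unique hlGu
    (((T.continuous_G.tendsto v0).comp hlv).congr fun n => (huv _).symm)
  have hGG : T.G (T.G u0) = b := tendsto_nhds_unique ((T.continuous_G.tendsto _).comp hlGu)
    (hxφ.congr fun n => (hu _).symm)
  refine hY (T.mem_Y hd hb hG hGG hξ0 hξ10 ?_)
  have h1 : Tendsto (fun n => ‖T.r (u (φ n)) - ξ (φ n) * T.r (v (φ n))‖) atTop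
      (𝓝 ‖T.r u0 - ξ0 * T.r v0‖) :=
    (((T.continuous_r.tendsto u0).comp hlu).sub
      (hlξ.mul ((T.continuous_r.tendsto v0).comp hlv))).norm
  have h2 : Tendsto (fun n => η (φ n) * ‖T.G (u (φ n))‖) atTop (𝓝 (0 * ‖T.G u0‖)) :=
    hηφ.mul hlGu.norm
  have h3 := le_of_tendsto_of_tendsto' h1 h2 fun n => hr (φ n)
  rw [zero_mul] at h3
  exact sub_eq_zero.1 (norm_le_zero_iff.1 h3)

theorem exists_not_nearZ (hd : d ≠ 0) {b : CV 2} (hb : b ≠ 0)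
    (hZ : Projectivization.mk ℂ b hb ∉ T.Z) : ∃ η > 0, ∀ᶠ b' in 𝓝 b, ¬ T.NearZ η b' := by
  obtain ⟨η₁, h1, hX⟩ := T.exists_not_nearX hd hb fun h => hZ (Or.inl h)
  obtain ⟨η₂, h2, hY⟩ := T.exists_not_nearY hd hb fun h => hZ (Or.inr h)
  refine ⟨min η₁ η₂, lt_min h1 h2, ?_⟩
  filter_upwards [hX, hY] with b' hX' hY'
  rintro (h | h)
  · exact hX' (NearX.mono T (min_le_left _ _) h)
  · exact hY' (NearY.mono T (min_le_right _ _) h)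

/-- By invariance under scaling it suffices to treat the unit sphere, where finitely many
neighbourhoods are enough and the smallest `η` works. -/
theorem exists_uniform {N : ℝ → CV 2 → Prop} (hmono : ∀ η η' b, η ≤ η' → N η b → N η' b)
    (hsmul : ∀ η b, ∀ c : ℂ, c ≠ 0 → N η b → N η (c • b))
    (hloc : ∀ b : CV 2, b ≠ 0 → ∃ η > 0, ∀ᶠ b' in 𝓝 b, ¬ N η b') :
    ∃ η > 0, ∀ b : CV 2, b ≠ 0 → ¬ N η b := by
  have key : ∃ η > 0, ∀ b ∈ Metric.sphere (0 : CV 2) 1, ¬ N η b := by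
    refine (isCompact_sphere (0 : CV 2) 1).induction_on (p := fun s => ∃ η > 0, ∀ b ∈ s, ¬ N η b)
      ⟨1, one_pos, by simp⟩ ?_ ?_ ?_
    · rintro s t hst ⟨η, hη, h⟩
      exact ⟨η, hη, fun b hb => h b (hst hb)⟩
    · rintro s t ⟨η, hη, h⟩ ⟨η', hη', h'⟩
      refine ⟨min η η', lt_min hη hη', ?_⟩
      rintro b (hb | hb) hN
      · exact h b hb (hmono _ _ _ (min_le_left _ _) hN)
      · exact h' b hb (hmono _ _ _ (min_le_right _ _) hN)
    · intro b hb
      obtain ⟨η, hη, h⟩ := hloc b (norm_ne_zero_iff.1 (by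
        rw [mem_sphere_zero_iff_norm.1 hb]; exact one_ne_zero))
      exact ⟨_, mem_nhdsWithin_of_mem_nhds h, η, hη, fun _ h => h⟩
  obtain ⟨η, hη, h⟩ := key
  refine ⟨η, hη, fun b hb hN => ?_⟩
  have h1 : (‖b‖ : ℂ)⁻¹ ≠ 0 := inv_ne_zero (by exact_mod_cast norm_ne_zero_iff.2 hb)
  refine h ((‖b‖ : ℂ)⁻¹ • b) (mem_sphere_zero_iff_norm.2 ?_) (hsmul _ _ _ h1 hN)
  rw [norm_smul, norm_inv, Complex.norm_real, norm_norm, inv_mul_cancel₀]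
  exact norm_ne_zero_iff.2 hb

/-- Uniform form of `X ∩ Y = ∅`. -/
theorem exists_not_nearX_and_nearY (hd : d ≠ 0) (hXY : Disjoint T.X T.Y) :
    ∃ η > 0, ∀ b : CV 2, b ≠ 0 → ¬ (T.NearX η b ∧ T.NearY η b) := by
  refine exists_uniform (fun η η' b h => And.imp (NearX.mono T h) (NearY.mono T h))
    (fun η b c hc => And.imp (fun h => NearX.smul T hd h hc) (fun h => NearY.smul T hd h c)) ?_
  intro b hb
  by_cases hX : Projectivization.mk ℂ b hb ∈ T.X
  · obtain ⟨η, hη, h⟩ := T.exists_not_nearY hd hb (Set.disjoint_left.1 hXY hX)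
    exact ⟨η, hη, h.mono fun _ h h' => h h'.2⟩
  · obtain ⟨η, hη, h⟩ := T.exists_not_nearX hd hb hX
    exact ⟨η, hη, h.mono fun _ h h' => h h'.1⟩

/-- Uniform form of the second hypothesis: in any orbit segment of length three some point is
definitely off `Z`. -/
theorem exists_not_nearZ_chain (hd : d ≠ 0)
    (hZ : T.fInf^[2] ⁻¹' T.Z ∩ T.fInf ⁻¹' T.Z ∩ T.Z = ∅) :
    ∃ η > 0, ∀ b : CV 2, b ≠ 0 →
      ¬ (T.NearZ η b ∧ T.NearZ η (T.G b) ∧ T.NearZ η (T.G (T.G b))) := by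
  refine exists_uniform (fun η η' b h => And.imp (NearZ.mono T h)
    (And.imp (NearZ.mono T h) (NearZ.mono T h))) (fun η b c hc => ?_) ?_
  · rintro ⟨h1, h2, h3⟩
    rw [T.G_smul, T.G_smul]
    exact ⟨NearZ.smul T hd h1 hc, NearZ.smul T hd h2 (pow_ne_zero _ hc),
      NearZ.smul T hd h3 (pow_ne_zero _ (pow_ne_zero _ hc))⟩
  intro b hb
  have h : ¬ (Projectivization.mk ℂ _ (T.G_ne_zero (T.G_ne_zero hb)) ∈ T.Z ∧
      Projectivization.mk ℂ _ (T.G_ne_zero hb) ∈ T.Z ∧ Projectivization.mk ℂ b hb ∈ T.Z) := by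
    rintro ⟨h1, h2, h3⟩
    have : Projectivization.mk ℂ b hb ∈ T.fInf^[2] ⁻¹' T.Z ∩ T.fInf ⁻¹' T.Z ∩ T.Z :=
      ⟨⟨h1, h2⟩, h3⟩
    rw [hZ] at this
    exact this
  by_cases h3 : Projectivization.mk ℂ b hb ∈ T.Z
  · by_cases h2 : Projectivization.mk ℂ _ (T.G_ne_zero hb) ∈ T.Z
    · obtain ⟨η, hη, h⟩ := T.exists_not_nearZ hd _ fun h1 => h ⟨h1, h2, h3⟩
      exact ⟨η, hη, (((T.continuous_G.comp T.continuous_G).tendsto b).eventually h).mono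
        fun _ h h' => h h'.2.2⟩
    · obtain ⟨η, hη, h⟩ := T.exists_not_nearZ hd _ h2
      exact ⟨η, hη, ((T.continuous_G.tendsto b).eventually h).mono fun _ h h' => h h'.2.1⟩
  · obtain ⟨η, hη, h⟩ := T.exists_not_nearZ hd _ h3
    exact ⟨η, hη, h.mono fun _ h h' => h h'.1⟩

end HomTriple

/-! ### Fibres of the map on the line at infinity -/

/-- The restriction of a polynomial to the line `ζ ↦ ζ a + c`. -/
def linePoly {n : ℕ} (F : MvPolynomial (Fin n) ℂ) (a c : CV n) : Polynomial ℂ :=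
  MvPolynomial.aeval (fun i => Polynomial.C (a i) * Polynomial.X + Polynomial.C (c i)) F

theorem eval_linePoly {n : ℕ} (F : MvPolynomial (Fin n) ℂ) (a c : CV n) (ζ : ℂ) :
    (linePoly F a c).eval ζ = MvPolynomial.eval (ζ • a + c) F := by
  induction F using MvPolynomial.induction_on with
  | C x => simp [linePoly]
  | add p q hp hq =>
    simp only [linePoly, map_add, Polynomial.eval_add] at *
    rw [hp, hq]
  | mul_X p i hp =>
    have h1 : linePoly (p * MvPolynomial.X i) a c =
        linePoly p a c * (Polynomial.C (a i) * Polynomial.X + Polynomial.C (c i)) := by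
      rw [linePoly, map_mul, MvPolynomial.aeval_X]
      rfl
    rw [h1, Polynomial.eval_mul, hp]
    simp only [Polynomial.eval_add, Polynomial.eval_mul, Polynomial.eval_C, Polynomial.eval_X,
      map_mul, MvPolynomial.eval_X, Pi.add_apply, Pi.smul_apply, smul_eq_mul, mul_comm ζ]

theorem natDegree_linePoly_le {n d : ℕ} {F : MvPolynomial (Fin n) ℂ} (hF : F.IsHomogeneous d)
    (a c : CV n) : (linePoly F a c).natDegree ≤ d := by
  rw [linePoly, MvPolynomial.aeval_def, MvPolynomial.eval₂_eq]
  refine Polynomial.natDegree_sum_le_of_forall_le _ _ fun m hm => ?_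
  have h1 : ∑ i ∈ m.support, m i = d := by
    have := hF (MvPolynomial.mem_support_iff.1 hm)
    change Finsupp.weight (fun _ => 1) m = d at this
    rwa [← Finsupp.degree_eq_weight_one, Finsupp.degree_apply] at this
  refine (Polynomial.natDegree_C_mul_le _ _).trans ((Polynomial.natDegree_prod_le _ _).trans ?_)
  rw [← h1]
  refine Finset.sum_le_sum fun i _ => ?_
  refine Polynomial.natDegree_pow_le.trans ?_
  exact (Nat.mul_le_mul_left _ Polynomial.natDegree_linear_le).trans (by simp)

/-- A binary form of positive degree has a nontrivial zero. -/
theorem exists_ne_zero_eval_eq_zero {d : ℕ} (hd : d ≠ 0) {F : MvPolynomial (Fin 2) ℂ}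
    (hF : F.IsHomogeneous d) : ∃ u : CV 2, u ≠ 0 ∧ MvPolynomial.eval u F = 0 := by
  by_contra! hcon
  obtain ⟨c, hc, h⟩ := exists_pos_lower_bound_of_homogeneous (E := ℂ) hd
    (MvPolynomial.continuous_eval F) (fun t v => eval_smul_of_isHomogeneous hF t v)
    (fun v hv => by_contra fun hv' => hcon v hv' hv)
  -- Without zeros, the dehomogenized polynomial `F(ζ, 1)` is constant, which contradicts the growth
  -- `c ‖v‖ ^ d` of a form without nontrivial zeros.
  have hdeg : (linePoly F ![1, 0] ![0, 1]).degree = 0 := by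
    by_contra hdeg
    obtain ⟨ζ, hζ⟩ := IsAlgClosed.exists_root _ hdeg
    rw [Polynomial.IsRoot.def, eval_linePoly] at hζ
    refine hcon _ (fun h => ?_) hζ
    simpa using congrFun h 1
  let k := (linePoly F ![1, 0] ![0, 1]).coeff 0
  have hk : ∀ ζ : ℂ, MvPolynomial.eval (ζ • ![1, 0] + ![0, 1]) F = k := fun ζ => by
    rw [← eval_linePoly, Polynomial.eq_C_of_degree_eq_zero hdeg, Polynomial.eval_C]
  obtain ⟨n, hn⟩ := exists_nat_gt (‖k‖ / c)
  have h1 := h ((n + 1 : ℂ) • ![1, 0] + ![0, 1])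
  rw [hk] at h1
  have h2 : (n + 1 : ℝ) ≤ ‖((n + 1 : ℂ) • ![1, 0] + ![0, 1] : CV 2)‖ := by
    have := norm_le_pi_norm ((n + 1 : ℂ) • ![1, 0] + ![0, 1] : CV 2) 0
    simp only [Pi.add_apply, Pi.smul_apply, Matrix.cons_val_zero, smul_eq_mul, mul_one,
      add_zero] at this
    refine le_trans (le_of_eq ?_) this
    rw [show (n + 1 : ℂ) = ((n + 1 : ℕ) : ℂ) by push_cast; ring, Complex.norm_natCast]
    push_cast; ring
  have h3 := le_self_pow₀ (show (1 : ℝ) ≤ ‖((n + 1 : ℂ) • ![1, 0] + ![0, 1] : CV 2)‖ by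
    have : (0 : ℝ) ≤ n := n.cast_nonneg
    linarith) hd
  rw [div_lt_iff₀ hc] at hn
  nlinarith

theorem sum_mul_conj_ne_zero {u : CV 2} (hu : u ≠ 0) :
    u 0 * starRingEnd ℂ (u 0) + u 1 * starRingEnd ℂ (u 1) ≠ 0 := by
  intro h
  have h1 : ((Complex.normSq (u 0) + Complex.normSq (u 1) : ℝ) : ℂ) = 0 := by
    rw [Complex.ofReal_add, ← Complex.mul_conj, ← Complex.mul_conj]; exact h
  have h2 : Complex.normSq (u 0) + Complex.normSq (u 1) = 0 := by exact_mod_cast h1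
  have h3 := Complex.normSq_nonneg (u 0)
  have h4 := Complex.normSq_nonneg (u 1)
  have h5 : u 0 = 0 := Complex.normSq_eq_zero.1 (by linarith)
  have h6 : u 1 = 0 := Complex.normSq_eq_zero.1 (by linarith)
  refine hu (funext fun i => ?_)
  fin_cases i
  exacts [h5, h6]

namespace HomTriple

variable {d : ℕ} (T : HomTriple d)

/-- If `(P, Q)` took all its values in the line of `b`, a nontrivial zero of the component `i` with
`b i ≠ 0` would be a common zero of `P` and `Q`. -/
theorem exists_not_parallel (hd : d ≠ 0) {b : CV 2} (hb : b ≠ 0) :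
    ∃ a : CV 2, b 1 * T.G a 0 - b 0 * T.G a 1 ≠ 0 := by
  by_contra! h
  obtain ⟨i, hi⟩ := Function.ne_iff.1 hb
  obtain ⟨u, hu, hu'⟩ := exists_ne_zero_eval_eq_zero hd (T.homG i)
  have h1 : T.G u i = 0 := hu'
  refine hu (T.eq_zero_of_G_eq_zero ?_)
  have h2 := h u
  funext j
  fin_cases i <;> fin_cases j
  · exact h1
  · change T.G u 0 = 0 at h1
    rw [h1, mul_zero, zero_sub, neg_eq_zero] at h2
    exact (mul_eq_zero.1 h2).resolve_left hi
  · change T.G u 1 = 0 at h1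
    rw [h1, mul_zero, sub_zero] at h2
    exact (mul_eq_zero.1 h2).resolve_left hi
  · exact h1

/-- The fibre over `[b]` lies in the zero set of the binary form `b₁ P - b₀ Q`. All zeros avoid a
direction `a` where the form is nonzero, so they lie on an affine line parallel to `a`, and are
roots of a polynomial of degree at most `d`. -/
theorem encard_fInf_fibre_le (hd : d ≠ 0) (p : PS 2) : (T.fInf ⁻¹' {p}).encard ≤ d := by
  induction p using Projectivization.ind with
  | h b hb =>
    obtain ⟨a, ha⟩ := T.exists_not_parallel hd hb
    let H : MvPolynomial (Fin 2) ℂ := MvPolynomial.C (b 1) * T.P - MvPolynomial.C (b 0) * T.Q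
    have hH : H.IsHomogeneous d := by
      refine MvPolynomial.IsHomogeneous.sub ?_ ?_
      · simpa using (MvPolynomial.isHomogeneous_C (Fin 2) (b 1)).mul T.homP
      · simpa using (MvPolynomial.isHomogeneous_C (Fin 2) (b 0)).mul T.homQ
    have hHe : ∀ u, MvPolynomial.eval u H = b 1 * T.G u 0 - b 0 * T.G u 1 := fun u => by
      simp [H, G]
    rw [← hHe] at ha
    have ha0 : a ≠ 0 := by
      rintro rfl
      exact ha (eval_zero_of_isHomogeneous hd hH)
    -- A vector orthogonal to `a`; `(a, c)` is a basis, with the explicit coordinates of `hbasis`.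
    let c : CV 2 := ![-(starRingEnd ℂ (a 1)), starRingEnd ℂ (a 0)]
    let N : ℂ := a 0 * starRingEnd ℂ (a 0) + a 1 * starRingEnd ℂ (a 1)
    have hN : N ≠ 0 := sum_mul_conj_ne_zero ha0
    have hbasis : ∀ u : CV 2, u = ((u 0 * starRingEnd ℂ (a 0) + u 1 * starRingEnd ℂ (a 1)) / N) • a +
        ((a 0 * u 1 - a 1 * u 0) / N) • c := by
      intro u
      funext i
      fin_cases i
      · simp only [Pi.add_apply, Pi.smul_apply, smul_eq_mul, c, Fin.zero_eta, Matrix.cons_val_zero]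
        field_simp
        simp only [N]
        ring
      · simp only [Pi.add_apply, Pi.smul_apply, smul_eq_mul, c, Fin.mk_one, Matrix.cons_val_one,
          Matrix.cons_val_fin_one]
        field_simp
        simp only [N]
        ring
    have hne : ∀ ζ : ℂ, ζ • a + c ≠ 0 := by
      intro ζ h
      refine hN ?_
      have h0 := congrFun h 0
      have h1 := congrFun h 1
      simp only [Pi.add_apply, Pi.smul_apply, smul_eq_mul, c, Matrix.cons_val_zero, Pi.zero_apply,
        Matrix.cons_val_one, Matrix.cons_val_fin_one] at h0 h1
      simp only [N]
      linear_combination a 0 * h1 - a 1 * h0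
    let L := linePoly H a c
    -- If `H` vanished on the affine line `ζ a + c`, it would vanish by homogeneity at `a + ζ c` for
    -- `ζ ≠ 0`, then at `a` by continuity.
    have hL0 : L ≠ 0 := by
      intro h0
      change linePoly H a c = 0 at h0
      have hz : ∀ ζ : ℂ, MvPolynomial.eval (ζ • a + c) H = 0 := fun ζ => by
        rw [← eval_linePoly, h0, Polynomial.eval_zero]
      have hz' : ∀ ζ : ℂ, ζ ≠ 0 → MvPolynomial.eval (a + ζ • c) H = 0 := fun ζ hζ => by
        have : a + ζ • c = ζ • (ζ⁻¹ • a + c) := by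
          rw [smul_add, smul_smul, mul_inv_cancel₀ hζ, one_smul]
        rw [this, eval_smul_of_isHomogeneous hH, hz, mul_zero]
      have hcont : Continuous fun ζ : ℂ => MvPolynomial.eval (a + ζ • c) H :=
        (MvPolynomial.continuous_eval H).comp (by fun_prop)
      have h1 : Tendsto (fun ζ : ℂ => MvPolynomial.eval (a + ζ • c) H) (𝓝[≠] 0)
          (𝓝 (MvPolynomial.eval (a + (0 : ℂ) • c) H)) := hcont.continuousAt.continuousWithinAt
      have h2 : Tendsto (fun ζ : ℂ => MvPolynomial.eval (a + ζ • c) H) (𝓝[≠] 0) (𝓝 0) :=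
        tendsto_const_nhds.congr' (eventually_nhdsWithin_of_forall fun ζ hζ => (hz' ζ hζ).symm)
      refine ha ?_
      have := tendsto_nhds_unique h1 h2
      rwa [zero_smul, add_zero] at this
    have hsub : T.fInf ⁻¹' {Projectivization.mk ℂ b hb} ⊆
        (fun ζ : ℂ => Projectivization.mk ℂ (ζ • a + c) (hne ζ)) '' (L.roots.toFinset : Set ℂ) := by
      intro p hp
      induction p using Projectivization.ind with
      | h u hu =>
        rw [Set.mem_preimage, Set.mem_singleton_iff, T.fInf_mk, Projectivization.mk_eq_mk_iff'] at hp
        obtain ⟨t, ht⟩ := hp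
        have hu0 : MvPolynomial.eval u H = 0 := by
          rw [hHe, ← ht]
          simp only [Pi.smul_apply, smul_eq_mul]
          ring
        have hu1 := hbasis u
        set α := (u 0 * starRingEnd ℂ (a 0) + u 1 * starRingEnd ℂ (a 1)) / N
        set β := (a 0 * u 1 - a 1 * u 0) / N
        have hβ : β ≠ 0 := by
          intro hβ
          rw [hβ, zero_smul, add_zero] at hu1
          have hα : α ≠ 0 := by
            intro hα
            rw [hα, zero_smul] at hu1
            exact hu hu1
          rw [hu1, eval_smul_of_isHomogeneous hH] at hu0
          exact ha ((mul_eq_zero.1 hu0).resolve_left (pow_ne_zero _ hα))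
        have hu2 : u = β • ((α / β) • a + c) := by
          rw [smul_add, smul_smul, mul_div_cancel₀ _ hβ]
          exact hu1
        refine ⟨α / β, ?_, ?_⟩
        · rw [Finset.mem_coe, Multiset.mem_toFinset, Polynomial.mem_roots hL0, Polynomial.IsRoot.def,
            eval_linePoly]
          rw [hu2, eval_smul_of_isHomogeneous hH] at hu0
          exact (mul_eq_zero.1 hu0).resolve_left (pow_ne_zero _ hβ)
        · refine (Projectivization.mk_eq_mk_iff' ..).2 ⟨β⁻¹, ?_⟩
          conv_lhs => rw [hu2]
          rw [smul_smul, inv_mul_cancel₀ hβ, one_smul]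
    refine (Set.encard_le_encard hsub).trans ((Set.encard_image_le _ _).trans ?_)
    rw [Set.encard_coe_eq_coe_finsetCard]
    exact_mod_cast (Multiset.toFinset_card_le _).trans
      ((Polynomial.card_roots' L).trans (natDegree_linePoly_le hH a c))

/-! ### Openness -/

/-- Open mapping theorem; the power map is not locally constant since its fibres are finite. -/
theorem nhds_le_map_pow (hd : d ≠ 0) (t : ℂ) : 𝓝 (t ^ d) ≤ map (fun s : ℂ => s ^ d) (𝓝 t) := by
  refine (AnalyticAt.eventually_constant_or_nhds_le_map_nhds (g := fun s : ℂ => s ^ d)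
    (by fun_prop)).resolve_left fun h => ?_
  have hfin : {s : ℂ | s ^ d = t ^ d}.Finite := by
    refine (Polynomial.nthRoots d (t ^ d)).toFinset.finite_toSet.subset fun z hz => ?_
    simpa [Polynomial.mem_nthRoots (Nat.pos_of_ne_zero hd)] using hz
  exact infinite_of_mem_nhds t h hfin

/-- With `c` orthogonal to `u`, the affine line `u + ζ c` is a chart of `ℙ¹` at `[u]`. -/
theorem exists_transverse {u : CV 2} (hu : u ≠ 0) :
    ∃ c : CV 2, ∀ ζ ξ : ℂ, ∀ s : ℂ, u + ζ • c = s • (u + ξ • c) → ζ = ξ := by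
  refine ⟨![-(starRingEnd ℂ (u 1)), starRingEnd ℂ (u 0)], fun ζ ξ s h => ?_⟩
  have hN := sum_mul_conj_ne_zero hu
  have h0 := congrFun h 0
  have h1 := congrFun h 1
  simp only [Pi.add_apply, Pi.smul_apply, smul_eq_mul, Matrix.cons_val_zero,
    Matrix.cons_val_one, Matrix.cons_val_fin_one] at h0 h1
  have hs : s = 1 := by
    refine mul_right_cancel₀ hN ?_
    linear_combination -starRingEnd ℂ (u 0) * h0 - starRingEnd ℂ (u 1) * h1
  rw [hs] at h0 h1
  refine mul_right_cancel₀ hN ?_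
  linear_combination u 0 * h1 - u 1 * h0

theorem analyticAt_G_line (u c : CV 2) (k : Fin 2) :
    AnalyticAt ℂ (fun ζ : ℂ => T.G (u + ζ • c) k) 0 := by
  have hline : AnalyticAt ℂ (fun ζ : ℂ => u + ζ • c) 0 := by fun_prop
  exact (AnalyticOnNhd.eval_mvPolynomial (𝕜 := ℂ) (![T.P, T.Q] k) _ (Set.mem_univ _)).fun_comp hline

/-- Openness of `f_∞` at `[u]`, read in affine charts. By the open mapping theorem in one variable
it is enough that the quotient is not locally constant, and it is not because `f_∞` has finite
fibres. -/
theorem nhds_le_map_G_line (hd : d ≠ 0) {u c : CV 2} (hu : u ≠ 0)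
    (hc : ∀ ζ ξ : ℂ, ∀ s : ℂ, u + ζ • c = s • (u + ξ • c) → ζ = ξ) {i j : Fin 2}
    (hi : T.G u i ≠ 0) (hj : ∀ k, k = i ∨ k = j) :
    𝓝 (T.G u j / T.G u i) ≤ map (fun ζ : ℂ => T.G (u + ζ • c) j / T.G (u + ζ • c) i) (𝓝 0) := by
  have han := T.analyticAt_G_line u c
  have hi' : T.G (u + (0 : ℂ) • c) i ≠ 0 := by rwa [zero_smul, add_zero]
  have hq := (han j).fun_div (han i) hi'
  have hopen := hq.eventually_constant_or_nhds_le_map_nhds.resolve_left fun h => by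
    have hcont : ∀ᶠ ζ : ℂ in 𝓝 0, T.G (u + ζ • c) i ≠ 0 := (han i).continuousAt.eventually_ne hi'
    have hne : ∀ ζ : ℂ, u + ζ • c ≠ 0 := by
      intro ζ h0
      have := hc ζ (ζ + 1) 0 (by rw [h0, zero_smul])
      simp at this
    have hfin : (T.fInf ⁻¹' {Projectivization.mk ℂ (T.G u) (T.G_ne_zero hu)}).Finite :=
      Set.finite_of_encard_le_coe (T.encard_fInf_fibre_le hd _)
    have hinj : Function.Injective fun ζ : ℂ => Projectivization.mk ℂ (u + ζ • c) (hne ζ) := by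
      intro ζ ξ h
      obtain ⟨s, hs⟩ := (Projectivization.mk_eq_mk_iff' ..).1 h
      exact hc ζ ξ s hs.symm
    refine infinite_of_mem_nhds (0 : ℂ) ?_ (hfin.preimage hinj.injOn)
    filter_upwards [h, hcont] with ζ hζ hζ'
    rw [Set.mem_preimage, Set.mem_preimage, Set.mem_singleton_iff, T.fInf_mk,
      Projectivization.mk_eq_mk_iff']
    simp only [zero_smul, add_zero] at hζ
    refine ⟨T.G (u + ζ • c) i / T.G u i, ?_⟩
    funext k
    have hi'' : T.G u i ≠ 0 := hi
    rw [Pi.smul_apply, smul_eq_mul]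
    rcases hj k with rfl | rfl
    · field_simp
    · field_simp at hζ ⊢
      linear_combination -hζ
  simpa only [zero_smul, add_zero] using hopen

/-- Points near `u` are written `s (u + ζ c)`: the parameter `ζ` adjusts the direction of the image,
and `s`, acting through `s ^ d`, its length. Openness holds even at critical points, so the inverse
function theorem would not do. -/
theorem nhds_le_map_G (hd : d ≠ 0) {u : CV 2} (hu : u ≠ 0) : 𝓝 (T.G u) ≤ map T.G (𝓝 u) := by
  obtain ⟨c, hc⟩ := exists_transverse hu
  obtain ⟨i, hi⟩ := Function.ne_iff.1 (T.G_ne_zero hu)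
  obtain ⟨j, hj⟩ : ∃ j : Fin 2, ∀ k, k = i ∨ k = j := by
    fin_cases i
    · exact ⟨1, fun k => by fin_cases k <;> simp⟩
    · exact ⟨0, fun k => by fin_cases k <;> simp⟩
  have han := T.analyticAt_G_line u c
  have hi' : T.G (u + (0 : ℂ) • c) i ≠ 0 := by rwa [zero_smul, add_zero]
  intro W hW
  rw [mem_map] at hW
  have hmul : ContinuousAt (fun p : ℂ × ℂ => p.1 • (u + p.2 • c)) (1, 0) := by fun_prop
  have hmul' : (fun p : ℂ × ℂ => p.1 • (u + p.2 • c)) ⁻¹' (T.G ⁻¹' W) ∈ 𝓝 ((1 : ℂ), (0 : ℂ)) :=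
    hmul (by simpa using hW)
  rw [nhds_prod_eq, mem_prod_iff] at hmul'
  obtain ⟨A, hA, B, hB, hAB⟩ := hmul'
  have hA' : (fun s : ℂ => s ^ d) '' A ∈ 𝓝 (1 : ℂ) := by
    have := nhds_le_map_pow hd (1 : ℂ) (image_mem_map hA)
    rwa [one_pow] at this
  have hquot : ContinuousAt (fun p : CV 2 × ℂ => p.1 i / T.G (u + p.2 • c) i) (T.G u, 0) := by
    refine ContinuousAt.div (by fun_prop) ?_ hi'
    exact ((continuous_apply i).comp T.continuous_G).continuousAt.comp'
      (f := fun p : CV 2 × ℂ => u + p.2 • c) (by fun_prop)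
  -- The value of `s ^ d` required to reach `b` is close to `1` when `b` is close to `G u` and `ζ`
  -- to `0`, hence has a root `s` in `A`.
  have hquot' : (fun p : CV 2 × ℂ => p.1 i / T.G (u + p.2 • c) i) ⁻¹' ((fun s : ℂ => s ^ d) '' A) ∈
      𝓝 (T.G u, (0 : ℂ)) := hquot (by simpa [div_self hi] using hA')
  rw [nhds_prod_eq, mem_prod_iff] at hquot'
  obtain ⟨A', hA', B', hB', hAB'⟩ := hquot'
  have hBB : B ∩ B' ∩ {ζ | T.G (u + ζ • c) i ≠ 0} ∈ 𝓝 (0 : ℂ) :=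
    inter_mem (inter_mem hB hB') ((han i).continuousAt.eventually_ne hi')
  have h1 := T.nhds_le_map_G_line hd hu hc hi hj (image_mem_map hBB)
  have hr : ContinuousAt (fun b : CV 2 => b j / b i) (T.G u) :=
    ContinuousAt.div (continuous_apply j).continuousAt (continuous_apply i).continuousAt hi
  have hi0 : T.G u i ≠ 0 := hi
  have hev : ∀ᶠ b : CV 2 in 𝓝 (T.G u), b i ≠ 0 :=
    (continuous_apply i).continuousAt.eventually_ne hi0
  have hev' : ∀ᶠ b : CV 2 in 𝓝 (T.G u), ∃ ζ ∈ B ∩ B' ∩ {ζ | T.G (u + ζ • c) i ≠ 0},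
      T.G (u + ζ • c) j / T.G (u + ζ • c) i = b j / b i := hr.eventually h1
  filter_upwards [hev', hA', hev] with b hb hbA hbi
  obtain ⟨ζ, ⟨⟨hζB, hζB'⟩, hζ0⟩, hζ⟩ := hb
  have hex : ∃ s ∈ A, s ^ d = b i / T.G (u + ζ • c) i :=
    hAB' (show (b, ζ) ∈ A' ×ˢ B' from ⟨hbA, hζB'⟩)
  obtain ⟨s, hsA, hs'⟩ := hex
  have h2 := hAB (Set.mk_mem_prod hsA hζB)
  simp only [Set.mem_preimage] at h2
  suffices h3 : b = T.G (s • (u + ζ • c)) by rw [h3]; exact h2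
  rw [T.G_smul, hs']
  have hζ0' : T.G (u + ζ • c) i ≠ 0 := hζ0
  funext k
  rw [Pi.smul_apply, smul_eq_mul]
  rcases hj k with rfl | rfl
  · field_simp
  · field_simp at hζ ⊢
    linear_combination -hζ

end HomTriple

/-! ### The region `U_ρ` -/

/-- The first two coordinates. -/
def head (x : CV 3) : CV 2 := x ∘ Fin.castSucc

/-- The point of `ℂ³` with given first two coordinates and given last coordinate. -/
def glue (u : CV 2) (t : ℂ) : CV 3 := ![u 0, u 1, t]

theorem head_glue (u : CV 2) (t : ℂ) : head (glue u t) = u := by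
  funext i; fin_cases i <;> rfl

theorem glue_two (u : CV 2) (t : ℂ) : glue u t 2 = t := rfl

theorem glue_head (x : CV 3) : glue (head x) (x 2) = x := by
  funext i; fin_cases i <;> rfl

theorem head_smul (c : ℂ) (x : CV 3) : head (c • x) = c • head x := rfl

theorem continuous_head : Continuous head := by
  unfold head; fun_prop

theorem norm_head (x : CV 3) : ‖head x‖ = max ‖x 0‖ ‖x 1‖ := by
  refine le_antisymm ((pi_norm_le_iff_of_nonneg (by positivity)).2 fun i => ?_)
    (max_le (norm_le_pi_norm (head x) 0) (norm_le_pi_norm (head x) 1))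
  fin_cases i
  · exact le_max_left _ _
  · exact le_max_right _ _

theorem mk_mem_regionU {ρ : ℝ} {x : CV 3} (hx : x ≠ 0) :
    Projectivization.mk ℂ x hx ∈ regionU ρ ↔ ‖x 2‖ < ρ * ‖head x‖ := by
  constructor
  · rintro ⟨y, hy, hxy, h⟩
    obtain ⟨c, rfl⟩ := (Projectivization.mk_eq_mk_iff' ..).1 hxy
    have hc : 0 < ‖c‖ := norm_pos_iff.2 (by rintro rfl; exact hx (zero_smul _ _))
    rw [← norm_head] at h
    rw [head_smul, Pi.smul_apply, smul_eq_mul, norm_mul, norm_smul, mul_left_comm]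
    exact mul_lt_mul_of_pos_left h hc
  · intro h
    exact ⟨x, hx, rfl, by rwa [← norm_head]⟩

theorem head_ne_zero_of_lt {ρ : ℝ} {x : CV 3} (h : ‖x 2‖ < ρ * ‖head x‖) : head x ≠ 0 := by
  intro h0
  rw [h0, norm_zero, mul_zero] at h
  exact absurd h (norm_nonneg _).not_gt

theorem ne_zero_of_head {x : CV 3} (h : head x ≠ 0) : x ≠ 0 := by
  rintro rfl; exact h rfl

theorem glue_ne_zero {u : CV 2} (hu : u ≠ 0) (t : ℂ) : glue u t ≠ 0 :=
  ne_zero_of_head (by rwa [head_glue])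

theorem isOpen_regionU (ρ : ℝ) : IsOpen (regionU ρ) := by
  rw [isOpen_iff_cone]
  have : cone (regionU ρ) = {x : CV 3 | ‖x 2‖ < ρ * ‖head x‖} := by
    ext x
    constructor
    · rintro ⟨hx, h⟩
      exact (mk_mem_regionU hx).1 h
    · intro h
      have hx := ne_zero_of_head (head_ne_zero_of_lt h)
      exact ⟨hx, (mk_mem_regionU hx).2 h⟩
  rw [this]
  exact isOpen_lt (by fun_prop) (continuous_const.mul continuous_head.norm)

/-- The closed region `|t| ≤ ρ max(|z|, |w|)`. -/
def closedRegion (ρ : ℝ) : Set (PS 3) :=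
  {p | ∀ (x : CV 3) (hx : x ≠ 0), p = Projectivization.mk ℂ x hx → ‖x 2‖ ≤ ρ * ‖head x‖}

theorem mk_mem_closedRegion {ρ : ℝ} {x : CV 3} (hx : x ≠ 0) :
    Projectivization.mk ℂ x hx ∈ closedRegion ρ ↔ ‖x 2‖ ≤ ρ * ‖head x‖ := by
  constructor
  · intro h
    exact h x hx rfl
  · intro h y hy hxy
    obtain ⟨c, rfl⟩ := (Projectivization.mk_eq_mk_iff' ..).1 hxy
    have hc : 0 < ‖c‖ := norm_pos_iff.2 (by rintro rfl; exact hx (zero_smul _ _))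
    rw [head_smul, Pi.smul_apply, smul_eq_mul, norm_mul, norm_smul, mul_left_comm] at h
    exact le_of_mul_le_mul_left h hc

theorem isClosed_closedRegion (ρ : ℝ) : IsClosed (closedRegion ρ) := by
  rw [← isOpen_compl_iff, isOpen_iff_cone]
  have : cone (closedRegion ρ)ᶜ = {x : CV 3 | ρ * ‖head x‖ < ‖x 2‖} := by
    ext x
    constructor
    · rintro ⟨hx, h⟩
      rw [Set.mem_compl_iff, mk_mem_closedRegion hx, not_le] at h
      exact h
    · intro h
      have hx : x ≠ 0 := by
        rintro rfl
        have h' : ρ * ‖head (0 : CV 3)‖ < ‖(0 : CV 3) 2‖ := h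
        rw [show head (0 : CV 3) = 0 from rfl] at h'
        simp at h'
      refine ⟨hx, ?_⟩
      rw [Set.mem_compl_iff, mk_mem_closedRegion hx, not_le]
      exact h
  rw [this]
  exact isOpen_lt (continuous_const.mul continuous_head.norm) (by fun_prop)

theorem closedRegion_subset_regionU {ρ ρ' : ℝ} (h : ρ < ρ') :
    closedRegion ρ ⊆ regionU ρ' := by
  intro p hp
  induction p using Projectivization.ind with
  | h x hx =>
    rw [mk_mem_closedRegion hx] at hp
    rw [mk_mem_regionU hx]
    have hne : head x ≠ 0 := by
      intro h
      rw [h, norm_zero, mul_zero, norm_le_zero_iff] at hp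
      refine hx ?_
      rw [← glue_head x, h, hp]
      funext i; fin_cases i <;> rfl
    exact hp.trans_lt (mul_lt_mul_of_pos_right h (norm_pos_iff.2 hne))

namespace HomTriple

variable {d : ℕ} (T : HomTriple d)

/-- The lift of `f` to `ℂ³`. -/
def F (ε : ℂ) (x : CV 3) : CV 3 := fun i => MvPolynomial.eval x (T.poly ε i)

theorem F_smul (ε t : ℂ) (x : CV 3) : T.F ε (t • x) = t ^ d • T.F ε x := by
  funext i
  exact eval_smul_of_isHomogeneous (T.poly_isHomogeneous ε i) t x

theorem F_ne_zero (hd : d ≠ 0) (ε : ℂ) {x : CV 3} (hx : x ≠ 0) : T.F ε x ≠ 0 := fun h =>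
  hx (T.poly_common_zero hd ε x fun i => congrFun h i)

theorem f_mk (hd : d ≠ 0) (ε : ℂ) (x : CV 3) (hx : x ≠ 0) :
    T.f hd ε (Projectivization.mk ℂ x hx) = Projectivization.mk ℂ (T.F ε x) (T.F_ne_zero hd ε hx) :=
  rfl

theorem continuous_f (hd : d ≠ 0) (ε : ℂ) : Continuous (T.f hd ε) := continuous_projMap _ _ _

theorem head_F (ε : ℂ) (x : CV 3) : head (T.F ε x) = T.G (head x) := by
  funext i
  fin_cases i
  · simp [head, F, G, poly, MvPolynomial.eval_rename]
  · simp [head, F, G, poly, MvPolynomial.eval_rename]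

theorem F_two (ε : ℂ) (x : CV 3) : T.F ε x 2 = x 2 ^ d + ε * T.r (head x) := by
  simp [head, F, r, poly, MvPolynomial.eval_rename]

theorem eq_of_head_eq {x y : CV 3} (h : head x = head y) (h2 : x 2 = y 2) : x = y := by
  rw [← glue_head x, ← glue_head y, h, h2]

/-! ### Openness of `f` near the line at infinity -/

/-- The lift is a skew product: the head of the target is reached by openness of `G`, then the last
coordinate by openness of the power map. -/
theorem nhds_le_map_F (hd : d ≠ 0) (ε : ℂ) {x : CV 3} (hx : head x ≠ 0) :
    𝓝 (T.F ε x) ≤ map (T.F ε) (𝓝 x) := by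
  intro W hW
  rw [mem_map] at hW
  have hglue : Continuous fun p : CV 2 × ℂ => glue p.1 p.2 := by
    refine continuous_pi fun i => ?_
    fin_cases i
    · change Continuous fun p : CV 2 × ℂ => p.1 0
      fun_prop
    · change Continuous fun p : CV 2 × ℂ => p.1 1
      fun_prop
    · exact continuous_snd
  have h1 : (fun p : CV 2 × ℂ => glue p.1 p.2) ⁻¹' (T.F ε ⁻¹' W) ∈ 𝓝 (head x, x 2) :=
    hglue.continuousAt (by rw [glue_head]; exact hW)
  rw [nhds_prod_eq, mem_prod_iff] at h1
  obtain ⟨A, hA, B, hB, hAB⟩ := h1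
  have hS : (fun s : ℂ => s ^ d) '' B ∈ 𝓝 (x 2 ^ d) := nhds_le_map_pow hd _ (image_mem_map hB)
  have hcont : Continuous fun p : CV 2 × ℂ => p.2 - ε * T.r p.1 :=
    continuous_snd.sub (continuous_const.mul (T.continuous_r.comp continuous_fst))
  have h2 : (fun p : CV 2 × ℂ => p.2 - ε * T.r p.1) ⁻¹' ((fun s : ℂ => s ^ d) '' B) ∈
      𝓝 (head x, T.F ε x 2) :=
    hcont.continuousAt (by simpa [T.F_two] using hS)
  rw [nhds_prod_eq, mem_prod_iff] at h2
  obtain ⟨A', hA', B', hB', hAB'⟩ := h2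
  have h3 : T.G '' (A ∩ A') ∈ 𝓝 (head (T.F ε x)) := by
    rw [head_F]
    exact T.nhds_le_map_G hd hx (image_mem_map (inter_mem hA hA'))
  have h4 : ∀ᶠ y : CV 3 in 𝓝 (T.F ε x), head y ∈ T.G '' (A ∩ A') :=
    continuous_head.continuousAt.eventually h3
  have h5 : ∀ᶠ y : CV 3 in 𝓝 (T.F ε x), y 2 ∈ B' := (continuous_apply 2).continuousAt.eventually hB'
  filter_upwards [h4, h5] with y hy hy'
  obtain ⟨u, ⟨huA, huA'⟩, hu⟩ := hy
  have h6 := hAB' (Set.mk_mem_prod huA' hy')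
  simp only [Set.mem_preimage, Set.mem_image] at h6
  obtain ⟨s, hsB, hs⟩ := h6
  have h7 := hAB (Set.mk_mem_prod huA hsB)
  simp only [Set.mem_preimage] at h7
  have h8 : T.F ε (glue u s) = y := by
    refine eq_of_head_eq ?_ ?_
    · rw [head_F, head_glue, hu]
    · rw [F_two, head_glue, glue_two, hs]; ring
  rwa [h8] at h7

/-- Extracting a `d`-th root of the scaling factor makes the lift exact; the only freedom left is
multiplication by `d`-th roots of unity. -/
theorem exists_lift (hd : d ≠ 0) {ε : ℂ} {p : PS 3} {y : CV 3} (hy : y ≠ 0)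
    (h : T.f hd ε p = Projectivization.mk ℂ y hy) :
    ∃ (x : CV 3) (hx : x ≠ 0), p = Projectivization.mk ℂ x hx ∧ T.F ε x = y := by
  induction p using Projectivization.ind with
  | h x hx =>
    rw [T.f_mk, Projectivization.mk_eq_mk_iff'] at h
    obtain ⟨a, ha⟩ := h
    have ha0 : a ≠ 0 := by
      rintro rfl
      rw [zero_smul] at ha
      exact T.F_ne_zero hd ε hx ha.symm
    obtain ⟨t, ht⟩ := exists_pow_eq_complex hd a⁻¹
    have ht0 : t ≠ 0 := by
      rintro rfl
      rw [zero_pow hd] at ht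
      exact inv_ne_zero ha0 ht.symm
    refine ⟨t • x, smul_ne_zero ht0 hx, ?_, ?_⟩
    · exact (Projectivization.mk_eq_mk_iff' ..).2
        ⟨t⁻¹, by rw [smul_smul, inv_mul_cancel₀ ht0, one_smul]⟩
    · rw [T.F_smul, ht, ← ha, smul_smul, inv_mul_cancel₀ ha0, one_smul]

theorem isOpen_image_f (hd : d ≠ 0) (ε : ℂ) {V : Set (PS 3)} (hV : IsOpen V)
    (hV' : ∀ x ∈ cone V, head x ≠ 0) : IsOpen (T.f hd ε '' V) := by
  rw [isOpen_iff_cone] at *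
  have : cone (T.f hd ε '' V) = T.F ε '' cone V := by
    ext y
    constructor
    · rintro ⟨hy, p, hp, hpy⟩
      obtain ⟨x, hx, rfl, hxy⟩ := T.exists_lift hd hy hpy
      exact ⟨x, ⟨hx, hp⟩, hxy⟩
    · rintro ⟨x, ⟨hx, hp⟩, rfl⟩
      exact ⟨T.F_ne_zero hd ε hx, _, hp, T.f_mk hd ε x hx⟩
  rw [this, isOpen_iff_mem_nhds]
  rintro _ ⟨x, hx, rfl⟩
  exact T.nhds_le_map_F hd ε (hV' x hx) (image_mem_map (hV.mem_nhds hx))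

/-! ### Trapping -/

/-- On `U_ρ` the new last coordinate is at most `(ρ ^ d + ‖ε‖ C) ‖u‖ ^ d`, where `u` is the head,
while the new head is at least `c ‖u‖ ^ d`. -/
theorem image_regionU_subset {c C ρ : ℝ} {ε : ℂ} (hd : d ≠ 0)
    (hG : ∀ u, c * ‖u‖ ^ d ≤ ‖T.G u‖) (hr : ∀ u, ‖T.r u‖ ≤ C * ‖u‖ ^ d)
    (h : 2 * (ρ ^ d + ‖ε‖ * C) ≤ c * ρ) (hρ : 0 < ρ) :
    T.f hd ε '' regionU ρ ⊆ closedRegion (ρ / 2) := by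
  rintro _ ⟨p, hp, rfl⟩
  induction p using Projectivization.ind with
  | h x hx =>
    rw [mk_mem_regionU] at hp
    rw [f_mk, mk_mem_closedRegion, head_F, F_two]
    have h1 : ‖x 2 ^ d‖ ≤ ρ ^ d * ‖head x‖ ^ d := by
      rw [norm_pow, ← mul_pow]
      exact pow_le_pow_left₀ (norm_nonneg _) hp.le d
    have h2 : ‖ε * T.r (head x)‖ ≤ ‖ε‖ * (C * ‖head x‖ ^ d) := by
      rw [norm_mul]
      exact mul_le_mul_of_nonneg_left (hr _) (norm_nonneg _)
    have h3 := norm_add_le (x 2 ^ d) (ε * T.r (head x))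
    have h4 := hG (head x)
    have h5 : 0 ≤ ‖head x‖ ^ d := by positivity
    have h6 : ρ / 2 * (c * ‖head x‖ ^ d) ≤ ρ / 2 * ‖T.G (head x)‖ := by gcongr
    nlinarith

theorem isTrappingRegion_regionU (hd : d ≠ 0) {ε : ℂ} {ρ : ℝ} (hρ : 0 < ρ)
    (h : T.f hd ε '' regionU ρ ⊆ closedRegion (ρ / 2)) :
    IsTrappingRegion (T.f hd ε) (regionU ρ) :=
  ⟨isOpen_regionU ρ, isClosed_closure.isCompact,
    (closure_minimal h (isClosed_closedRegion _)).trans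
      (closedRegion_subset_regionU (by linarith))⟩

/-- The set `f³(f(U))` lies in `f(closure (f(U)))`, which is compact and contained in `f(U)`.
Openness of `f(U)` is where the open mapping results are used. -/
theorem isTrappingRegion_image (hd : d ≠ 0) {ε : ℂ} {ρ : ℝ}
    (h : IsTrappingRegion (T.f hd ε) (regionU ρ)) :
    IsTrappingRegion (T.f hd ε)^[3] (T.f hd ε '' regionU ρ) := by
  obtain ⟨h1, h2, h3⟩ := h
  have h4 : T.f hd ε '' regionU ρ ⊆ regionU ρ := subset_closure.trans h3
  refine ⟨T.isOpen_image_f hd ε h1 fun x ⟨hx, hx'⟩ =>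
    head_ne_zero_of_lt ((mk_mem_regionU hx).1 hx'), isClosed_closure.isCompact, ?_⟩
  have h5 : (T.f hd ε)^[3] '' (T.f hd ε '' regionU ρ) ⊆
      T.f hd ε '' closure (T.f hd ε '' regionU ρ) := by
    rintro _ ⟨_, ⟨p, hp, rfl⟩, rfl⟩
    refine ⟨(T.f hd ε)^[3] p, subset_closure ⟨(T.f hd ε)^[2] p, ?_, rfl⟩, rfl⟩
    exact h4 ⟨_, h4 ⟨p, hp, rfl⟩, rfl⟩
  exact (closure_minimal h5 (h2.image (T.continuous_f hd ε)).isClosed).trans (Set.image_mono h3)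

end HomTriple

/-! ### Counting preimages -/

theorem encard_biUnion_le_mul {α β : Type*} {S : Set α} {U : α → Set β} {m k : ℕ}
    (hS : S.encard ≤ m) (hU : ∀ x ∈ S, (U x).encard ≤ k) :
    (⋃ x ∈ S, U x).encard ≤ (m * k : ℕ) := by
  classical
  have hSf : S.Finite := Set.finite_of_encard_le_coe hS
  have hUf : ∀ x ∈ S, (U x).Finite := fun x hx => Set.finite_of_encard_le_coe (hU x hx)
  have key : ∀ s : Finset α, (∀ x ∈ s, x ∈ S) →
      (⋃ x ∈ s, U x).encard ≤ (s.card * k : ℕ) := by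
    intro s
    induction s using Finset.induction_on with
    | empty => simp
    | insert a s ha ih =>
      intro h
      rw [Finset.set_biUnion_insert, Finset.card_insert_of_notMem ha]
      refine (Set.encard_union_le _ _).trans ?_
      refine (add_le_add (hU a (h a (Finset.mem_insert_self a s)))
        (ih fun x hx => h x (Finset.mem_insert_of_mem hx))).trans ?_
      rw [← Nat.cast_add, Nat.cast_le]
      exact le_of_eq (by ring)
  have h1 := key hSf.toFinset fun x hx => hSf.mem_toFinset.1 hx
  have h2 : (⋃ x ∈ hSf.toFinset, U x) = ⋃ x ∈ S, U x := by simp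
  rw [h2] at h1
  refine h1.trans ?_
  rw [hSf.encard_eq_coe_toFinset_card, Nat.cast_le] at hS
  exact_mod_cast Nat.mul_le_mul_right k hS

namespace HomTriple

variable {d : ℕ} (T : HomTriple d)

/-- The lifts of the preimages in `f(U_ρ)` of `[y]`, with the estimates they satisfy. -/
structure IsGoodPreimage (ε : ℂ) (κ : ℝ) (y x : CV 3) : Prop where
  head_ne : head x ≠ 0
  map_eq : T.F ε x = y
  -- The quantity on the left is `‖x₂ ^ d‖`, small because `[x]` is in `U_ρ`.
  close : ‖y 2 - ε * T.r (head x)‖ ≤ κ * ‖head y‖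
  -- The same estimate one step earlier; it expresses that `[x]` is in `f(U_ρ)` and not only in
  -- `U_ρ`.
  close_prev : ∃ v : CV 2, T.G v = head x ∧ ‖x 2 - ε * T.r v‖ ≤ κ * ‖head x‖

variable {T} in
theorem IsGoodPreimage.smul {ε : ℂ} {κ : ℝ} {y x : CV 3} (h : T.IsGoodPreimage ε κ y x)
    (hd : d ≠ 0) {c : ℂ} (hc : c ^ d = 1) : T.IsGoodPreimage ε κ y (c • x) := by
  have hc0 : c ≠ 0 := by
    rintro rfl
    rw [zero_pow hd] at hc
    exact zero_ne_one hc
  obtain ⟨t, ht⟩ := exists_pow_eq_complex hd c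
  obtain ⟨v, hv, hv'⟩ := h.close_prev
  refine ⟨?_, ?_, ?_, t • v, ?_, ?_⟩
  · rw [head_smul]; exact smul_ne_zero hc0 h.head_ne
  · rw [T.F_smul, hc, one_smul, h.map_eq]
  · rw [head_smul, T.r_smul, hc, one_mul]; exact h.close
  · rw [T.G_smul, ht, hv, head_smul]
  · rw [T.r_smul, ht, head_smul, norm_smul, Pi.smul_apply, smul_eq_mul, mul_left_comm, ← mul_sub,
      norm_mul, mul_left_comm]
    gcongr

theorem exists_goodPreimage (hd : d ≠ 0) {ε : ℂ} {ρ c : ℝ} (hc : 0 < c)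
    (hG : ∀ u, c * ‖u‖ ^ d ≤ ‖T.G u‖) (hU : T.f hd ε '' regionU ρ ⊆ regionU ρ)
    {y : CV 3} (hy : y ≠ 0) {p : PS 3} (hp : p ∈ T.f hd ε '' regionU ρ)
    (hpy : T.f hd ε p = Projectivization.mk ℂ y hy) :
    ∃ (x : CV 3) (hx : x ≠ 0), p = Projectivization.mk ℂ x hx ∧
      T.IsGoodPreimage ε (ρ ^ d / c) y x := by
  obtain ⟨x, hx, rfl, hxy⟩ := T.exists_lift hd hy hpy
  -- This is applied twice, to the step from `x` to `y` and to the step from a preimage `w` to `x`.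
  have key : ∀ x y : CV 3, T.F ε x = y → ‖x 2‖ < ρ * ‖head x‖ →
      ‖y 2 - ε * T.r (head x)‖ ≤ ρ ^ d / c * ‖head y‖ := by
    rintro x _ rfl hx
    rw [F_two, head_F, add_sub_cancel_right, norm_pow]
    have h1 : ‖x 2‖ ^ d ≤ ρ ^ d * ‖head x‖ ^ d := by
      rw [← mul_pow]
      exact pow_le_pow_left₀ (norm_nonneg _) hx.le d
    have hρ : 0 ≤ ρ := by
      by_contra! hneg
      nlinarith [norm_nonneg (x 2), norm_nonneg (head x)]
    calc ‖x 2‖ ^ d ≤ ρ ^ d / c * (c * ‖head x‖ ^ d) := by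
          rw [← mul_assoc, div_mul_cancel₀ _ hc.ne']; exact h1
      _ ≤ _ := by gcongr; exact hG _
  have hxU : ‖x 2‖ < ρ * ‖head x‖ := (mk_mem_regionU hx).1 (hU hp)
  refine ⟨x, hx, rfl, head_ne_zero_of_lt hxU, hxy, key x y hxy hxU, ?_⟩
  obtain ⟨q, hq, hqp⟩ := hp
  obtain ⟨w, hw, rfl, hwx⟩ := T.exists_lift hd hx hqp
  exact ⟨head w, by rw [← hwx, head_F], key w x hwx ((mk_mem_regionU hw).1 hq)⟩

/-! ### Comparison of two preimages of the same point. -/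

variable {T}

theorem IsGoodPreimage.G_head {ε : ℂ} {κ : ℝ} {y x : CV 3} (h : T.IsGoodPreimage ε κ y x) :
    T.G (head x) = head y := by
  rw [← h.map_eq, head_F]

theorem IsGoodPreimage.root_of_head_eq {ε : ℂ} {κ : ℝ} {y x x' : CV 3}
    (h : T.IsGoodPreimage ε κ y x) (h' : T.IsGoodPreimage ε κ y x') {c : ℂ}
    (hc : head x = c • head x') : c ^ d = 1 := by
  have h1 : c ^ d • T.G (head x') = (1 : ℂ) • T.G (head x') := by
    rw [one_smul, ← T.G_smul, ← hc, h.G_head, h'.G_head]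
  exact smul_left_injective ℂ (T.G_ne_zero h'.head_ne) h1

/-- Both `ε R(head x)` and `ε R(head x')` are within `κ ‖head y‖` of `y₂`, so different directions
would make `head y` near `X`. -/
theorem IsGoodPreimage.exists_smul_of_not_nearX {ε : ℂ} {κ η : ℝ} {y x x' : CV 3}
    (hε : 0 < ‖ε‖) (hκ : 2 * κ ≤ η * ‖ε‖)
    (h : T.IsGoodPreimage ε κ y x) (h' : T.IsGoodPreimage ε κ y x')
    (hX : ¬ T.NearX η (head y)) : ∃ c : ℂ, head x = c • head x' := by
  by_contra! hne
  refine hX ⟨head x, head x', h.G_head, h'.G_head, hne, ?_⟩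
  have h1 : ‖ε * (T.r (head x) - T.r (head x'))‖ ≤ 2 * κ * ‖head y‖ := by
    have : ε * (T.r (head x) - T.r (head x')) =
        (y 2 - ε * T.r (head x')) - (y 2 - ε * T.r (head x)) := by ring
    rw [this]
    refine (norm_sub_le _ _).trans ?_
    have := h.close
    have := h'.close
    linarith
  rw [norm_mul] at h1
  have h2 : 2 * κ * ‖head y‖ ≤ η * ‖ε‖ * ‖head y‖ := by gcongr
  refine le_of_mul_le_mul_left (h1.trans (h2.trans (le_of_eq ?_))) hε
  ring

/-- With equal heads, `x₂` and `x'₂` have the same `d`-th power. If they differ, their ratio is a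
nontrivial root of unity `ξ`, and `x₂ ≈ ε R(v)`, `x'₂ ≈ ε R(v')` give `R(v) ≈ ξ R(v')`. -/
theorem IsGoodPreimage.eq_of_not_nearY {ε : ℂ} {κ η : ℝ} {y x x' : CV 3} (hd : d ≠ 0)
    (hε : 0 < ‖ε‖) (hκ : 2 * κ ≤ η * ‖ε‖)
    (h : T.IsGoodPreimage ε κ y x) (h' : T.IsGoodPreimage ε κ y x')
    (hY : ¬ T.NearY η (head y)) (hh : head x = head x') : x = x' := by
  refine eq_of_head_eq hh ?_
  by_contra hne
  have hpow : x 2 ^ d = x' 2 ^ d := by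
    have h1 := congrFun h.map_eq 2
    have h2 := congrFun h'.map_eq 2
    rw [F_two] at h1 h2
    rw [hh] at h1
    linear_combination h1 - h2
  have h0 : x' 2 ≠ 0 := by
    intro h0
    rw [h0, zero_pow hd] at hpow
    exact hne ((pow_eq_zero_iff hd).1 hpow |>.trans h0.symm)
  obtain ⟨v, hv, hv'⟩ := h.close_prev
  obtain ⟨v', hw, hw'⟩ := h'.close_prev
  have hξ : (x 2 / x' 2) ^ d = 1 := by
    rw [div_pow, hpow, div_self (pow_ne_zero _ h0)]
  refine hY ⟨v, v', x 2 / x' 2, by rw [hv, hw, hh], by rw [hv, h.G_head], hξ, fun h1 => ?_, ?_⟩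
  · exact hne ((div_eq_one_iff_eq h0).1 h1)
  have hξn : ‖x 2 / x' 2‖ = 1 := Complex.norm_eq_one_of_pow_eq_one hξ hd
  rw [hv]
  rw [← hh] at hw'
  have h1 : ‖ε * (T.r v - x 2 / x' 2 * T.r v')‖ ≤ 2 * κ * ‖head x‖ := by
    have : ε * (T.r v - x 2 / x' 2 * T.r v') =
        x 2 / x' 2 * (x' 2 - ε * T.r v') - (x 2 - ε * T.r v) := by
      field_simp
      ring
    rw [this]
    refine (norm_sub_le _ _).trans ?_
    rw [norm_mul, hξn, one_mul]
    linarith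
  rw [norm_mul] at h1
  have h2 : 2 * κ * ‖head x‖ ≤ η * ‖ε‖ * ‖head x‖ := by gcongr
  refine le_of_mul_le_mul_left (h1.trans (h2.trans (le_of_eq ?_))) hε
  ring

/-! ### Number of preimages under `f` and under its third iterate. -/

variable (T)

/-- The preimages in `f(U_ρ)`. -/
def preim (hd : d ≠ 0) (ε : ℂ) (ρ : ℝ) (p : PS 3) : Set (PS 3) :=
  T.f hd ε ⁻¹' {p} ∩ T.f hd ε '' regionU ρ

/-- `p` is nearly in the cone over `Z`. -/
def IsNearZ (η : ℝ) (p : PS 3) : Prop :=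
  ∃ (y : CV 3) (hy : y ≠ 0), p = Projectivization.mk ℂ y hy ∧ T.NearZ η (head y)

/-- The head of `y` cannot be near both `X` and `Y`. Off `Y` a preimage is determined by its
direction, which lies in a fibre of `f_∞`; off `X` it is determined by a `d`-th root. -/
theorem encard_preim_le (hd : d ≠ 0) {ε : ℂ} {ρ c η : ℝ} (hc : 0 < c) (hε : 0 < ‖ε‖)
    (hG : ∀ u, c * ‖u‖ ^ d ≤ ‖T.G u‖) (hU : T.f hd ε '' regionU ρ ⊆ regionU ρ)
    (hκ : 2 * (ρ ^ d / c) ≤ η * ‖ε‖)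
    (hXY : ∀ b : CV 2, b ≠ 0 → ¬ (T.NearX η b ∧ T.NearY η b)) (p : PS 3) :
    (T.preim hd ε ρ p).encard ≤ d := by
  rcases (T.preim hd ε ρ p).eq_empty_or_nonempty with he | ⟨q, hq⟩
  · simp [he]
  induction p using Projectivization.ind with
  | h y hy =>
    obtain ⟨x₀, hx₀, -, h₀⟩ := T.exists_goodPreimage hd hc hG hU hy hq.2 hq.1
    have hy0 : head y ≠ 0 := by rw [← h₀.G_head]; exact T.G_ne_zero h₀.head_ne
    by_cases hX : T.NearX η (head y)
    · have hY : ¬ T.NearY η (head y) := fun h => hXY _ hy0 ⟨hX, h⟩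
      classical
      -- The direction of a good lift; the value off the set of preimages is an arbitrary default.
      let dir : PS 3 → PS 2 := fun p =>
        if h : ∃ (x : CV 3) (_ : x ≠ 0), p = Projectivization.mk ℂ x ‹_› ∧
          T.IsGoodPreimage ε (ρ ^ d / c) y x then
        Projectivization.mk ℂ (head h.choose) h.choose_spec.choose_spec.2.head_ne
        else Projectivization.mk ℂ (head x₀) h₀.head_ne
      have hdir : ∀ p ∈ T.preim hd ε ρ (Projectivization.mk ℂ y hy),
          ∃ (x : CV 3) (hx : x ≠ 0) (h : head x ≠ 0), p = Projectivization.mk ℂ x hx ∧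
          T.IsGoodPreimage ε (ρ ^ d / c) y x ∧ dir p = Projectivization.mk ℂ (head x) h := by
        intro p hp
        have h := T.exists_goodPreimage hd hc hG hU hy hp.2 hp.1
        exact ⟨h.choose, h.choose_spec.choose, h.choose_spec.choose_spec.2.head_ne,
          h.choose_spec.choose_spec.1, h.choose_spec.choose_spec.2, dif_pos h⟩
      have hinj : Set.InjOn dir (T.preim hd ε ρ (Projectivization.mk ℂ y hy)) := by
        intro p hp p' hp' hpp
        obtain ⟨x, hx, hhx, rfl, hg, he⟩ := hdir p hp
        obtain ⟨x', hx', hhx', rfl, hg', he'⟩ := hdir p' hp'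
        rw [he, he', Projectivization.mk_eq_mk_iff'] at hpp
        obtain ⟨a, ha⟩ := hpp
        have hroot := hg.root_of_head_eq hg' ha.symm
        have := (hg'.smul hd hroot).eq_of_not_nearY hd hε hκ hg hY (by rw [head_smul, ha])
        exact (Projectivization.mk_eq_mk_iff' ..).2 ⟨a, this⟩
      rw [← hinj.encard_image]
      refine (Set.encard_le_encard ?_).trans
        (T.encard_fInf_fibre_le hd (Projectivization.mk ℂ (head y) hy0))
      rintro _ ⟨p, hp, rfl⟩
      obtain ⟨x, hx, hhx, rfl, hg, he⟩ := hdir p hp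
      rw [he, Set.mem_preimage, Set.mem_singleton_iff, T.fInf_mk]
      congr 1
      exact hg.G_head
    -- All preimages share the direction of `head x₀`. Once their head is normalized to `head x₀`,
    -- the last coordinate is a `d`-th root of `y₂ - ε R(head x₀)`.
    · have hsub : T.preim hd ε ρ (Projectivization.mk ℂ y hy) ⊆
          (fun t => Projectivization.mk ℂ (glue (head x₀) t) (glue_ne_zero h₀.head_ne t)) ''
          ((Polynomial.nthRoots d (y 2 - ε * T.r (head x₀))).toFinset : Set ℂ) := by
        intro p hp
        obtain ⟨x, hx, rfl, hg⟩ := T.exists_goodPreimage hd hc hG hU hy hp.2 hp.1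
        obtain ⟨a, ha⟩ := h₀.exists_smul_of_not_nearX hε hκ hg hX
        have hroot := h₀.root_of_head_eq hg ha
        refine ⟨a * x 2, ?_, ?_⟩
        · rw [Finset.mem_coe, Multiset.mem_toFinset, Polynomial.mem_nthRoots (Nat.pos_of_ne_zero hd),
            mul_pow, hroot, one_mul, ha, T.r_smul, hroot, one_mul, ← hg.map_eq, F_two]
          ring
        · refine (Projectivization.mk_eq_mk_iff' ..).2 ⟨a, eq_of_head_eq ?_ rfl⟩
          rw [head_glue, head_smul, ha]
      refine (Set.encard_le_encard hsub).trans ((Set.encard_image_le _ _).trans ?_)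
      rw [Set.encard_coe_eq_coe_finsetCard]
      exact Nat.cast_le.2 ((Multiset.toFinset_card_le _).trans
        (Polynomial.card_nthRoots d (y 2 - ε * T.r (head x₀))))

theorem encard_preim_le_one (hd : d ≠ 0) {ε : ℂ} {ρ c η : ℝ} (hc : 0 < c) (hε : 0 < ‖ε‖)
    (hG : ∀ u, c * ‖u‖ ^ d ≤ ‖T.G u‖) (hU : T.f hd ε '' regionU ρ ⊆ regionU ρ)
    (hκ : 2 * (ρ ^ d / c) ≤ η * ‖ε‖) {p : PS 3} (hp : ¬ T.IsNearZ η p) :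
    (T.preim hd ε ρ p).encard ≤ 1 := by
  rw [Set.encard_le_one_iff]
  intro q q' hq hq'
  induction p using Projectivization.ind with
  | h y hy =>
    have hX : ¬ T.NearX η (head y) := fun h => hp ⟨y, hy, rfl, Or.inl h⟩
    have hY : ¬ T.NearY η (head y) := fun h => hp ⟨y, hy, rfl, Or.inr h⟩
    obtain ⟨x, hx, rfl, hg⟩ := T.exists_goodPreimage hd hc hG hU hy hq.2 hq.1
    obtain ⟨x', hx', rfl, hg'⟩ := T.exists_goodPreimage hd hc hG hU hy hq'.2 hq'.1
    obtain ⟨a, ha⟩ := hg.exists_smul_of_not_nearX hε hκ hg' hX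
    have hroot := hg.root_of_head_eq hg' ha
    have := (hg'.smul hd hroot).eq_of_not_nearY hd hε hκ hg hY (by rw [head_smul, ha])
    exact (Projectivization.mk_eq_mk_iff' ..).2 ⟨a, this⟩

theorem isNearZ_mk (hd : d ≠ 0) {η : ℝ} {y : CV 3} (hy : y ≠ 0)
    (h : T.IsNearZ η (Projectivization.mk ℂ y hy)) : T.NearZ η (head y) := by
  obtain ⟨z, hz, hyz, h⟩ := h
  obtain ⟨a, rfl⟩ := (Projectivization.mk_eq_mk_iff' ..).1 hyz
  refine NearZ.smul T hd h ?_
  rintro rfl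
  exact hy (zero_smul _ _)

/-- The preimages form a tree of depth three with at most `d` branches at each node and one branch
at nodes off `Z`. Each path from the root meets such a node, so there are at most `d ^ 2` leaves. -/
theorem encard_preim_three_lt (hd : 2 ≤ d) (hd0 : d ≠ 0) {ε : ℂ} {ρ c η : ℝ} (hc : 0 < c)
    (hε : 0 < ‖ε‖)
    (hG : ∀ u, c * ‖u‖ ^ d ≤ ‖T.G u‖) (hU : T.f hd0 ε '' regionU ρ ⊆ regionU ρ)
    (hκ : 2 * (ρ ^ d / c) ≤ η * ‖ε‖)
    (hXY : ∀ b : CV 2, b ≠ 0 → ¬ (T.NearX η b ∧ T.NearY η b))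
    (hZ : ∀ b : CV 2, b ≠ 0 →
      ¬ (T.NearZ η b ∧ T.NearZ η (T.G b) ∧ T.NearZ η (T.G (T.G b)))) (p : PS 3) :
    ((T.f hd0 ε)^[3] ⁻¹' {p} ∩ T.f hd0 ε '' regionU ρ).encard < ((d ^ 3 : ℕ) : ℕ∞) := by
  have hle := T.encard_preim_le hd0 hc hε hG hU hκ hXY
  have hone := fun p => T.encard_preim_le_one hd0 hc hε hG hU hκ (p := p)
  have hsub : (T.f hd0 ε)^[3] ⁻¹' {p} ∩ T.f hd0 ε '' regionU ρ ⊆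
      ⋃ x ∈ T.preim hd0 ε ρ p, ⋃ y ∈ T.preim hd0 ε ρ x, T.preim hd0 ε ρ y := by
    rintro q ⟨hq, hq'⟩
    have h1 : T.f hd0 ε q ∈ T.f hd0 ε '' regionU ρ := ⟨q, hU hq', rfl⟩
    have h2 : T.f hd0 ε (T.f hd0 ε q) ∈ T.f hd0 ε '' regionU ρ := ⟨_, hU h1, rfl⟩
    simp only [Set.mem_iUnion]
    exact ⟨_, ⟨hq, h2⟩, _, ⟨rfl, h1⟩, rfl, hq'⟩
  -- The chain condition is used at `b = head y`, the deepest of the three nodes; those above it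
  -- have heads `G b` and `G (G b)`, since `x = f(y)` and `p = f(x)`.
  have hchain : ∀ x ∈ T.preim hd0 ε ρ p, ∀ y ∈ T.preim hd0 ε ρ x,
      T.IsNearZ η p → T.IsNearZ η x → ¬ T.IsNearZ η y := by
    rintro x ⟨hx, hx'⟩ y ⟨hy, hy'⟩ hp1 hx1 hy1
    rw [Set.mem_preimage, Set.mem_singleton_iff] at hx hy
    subst hx
    subst hy
    have h2 := hU hy'
    induction y using Projectivization.ind with
    | h y hy =>
      have h3 := head_ne_zero_of_lt ((mk_mem_regionU hy).1 h2)
      refine hZ (head y) h3 ⟨T.isNearZ_mk hd0 hy hy1, ?_, ?_⟩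
      · rw [f_mk] at hx1
        have := T.isNearZ_mk hd0 _ hx1
        rwa [head_F] at this
      · rw [f_mk, f_mk] at hp1
        have := T.isNearZ_mk hd0 _ hp1
        rwa [head_F, head_F] at this
  have htwo : ∀ x ∈ T.preim hd0 ε ρ p, T.IsNearZ η p →
      (⋃ y ∈ T.preim hd0 ε ρ x, T.preim hd0 ε ρ y).encard ≤ (d : ℕ) := by
    intro x hx hp
    by_cases hxZ : T.IsNearZ η x
    · have := encard_biUnion_le_mul (U := T.preim hd0 ε ρ) (m := d) (k := 1) (hle x) fun y hy => by
        simpa using hone y (hchain x hx y hy hp hxZ)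
      simpa using this
    · have := encard_biUnion_le_mul (U := T.preim hd0 ε ρ) (m := 1) (k := d)
        (by simpa using hone x hxZ) fun y _ => hle y
      simpa using this
  have hfin : (⋃ x ∈ T.preim hd0 ε ρ p, ⋃ y ∈ T.preim hd0 ε ρ x, T.preim hd0 ε ρ y).encard ≤
      (d * d : ℕ) := by
    by_cases hp : T.IsNearZ η p
    · exact encard_biUnion_le_mul (hle p) fun x hx => htwo x hx hp
    · have := encard_biUnion_le_mul (m := 1) (k := d * d) (by simpa using hone p hp)
        fun x (_ : x ∈ T.preim hd0 ε ρ p) =>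
          encard_biUnion_le_mul (U := T.preim hd0 ε ρ) (hle x) fun y _ => hle y
      simpa using this
  refine (Set.encard_le_encard hsub).trans_lt (hfin.trans_lt ?_)
  rw [Nat.cast_lt, pow_succ, pow_two]
  have : 0 < d * d := by positivity
  nlinarith

end HomTriple

/-! ### Iterates and attracting sets -/

theorem IsEndomorphism.comp {n a b : ℕ} {g h : PS n → PS n} (hg : IsEndomorphism g a)
    (hh : IsEndomorphism h b) : IsEndomorphism (g ∘ h) (b * a) := by
  obtain ⟨A, hA, hA0, rfl⟩ := hg
  obtain ⟨B, hB, hB0, rfl⟩ := hh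
  have hev : ∀ x i, MvPolynomial.eval x (MvPolynomial.aeval B (A i)) =
      MvPolynomial.eval (fun j => MvPolynomial.eval x (B j)) (A i) := fun x i => by
    have := MvPolynomial.eval₂_comp_left (MvPolynomial.eval x) (algebraMap ℂ _) B (A i)
    rw [MvPolynomial.aeval_def, this]
    rw [MvPolynomial.eval, MvPolynomial.coe_eval₂Hom]
    congr 1
    ext c
    simp
  refine ⟨fun i => MvPolynomial.aeval B (A i), fun i => (hA i).aeval B hB, fun x hx => ?_, ?_⟩
  · simp only [hev] at hx
    exact hB0 x fun i => congrFun (hA0 _ hx) i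
  · funext p
    induction p using Projectivization.ind with
    | h x hx =>
      simp only [Function.comp, projMap_mk, hev]

/-- The compact sets `g^n(closure (g(U)))` decrease to a subset of the attracting set, so one of
them is already inside the open set `V`. -/
theorem exists_forall_iterate_image_subset {g : PS 3 → PS 3} (hg : Continuous g)
    {U V : Set (PS 3)} (hU : IsTrappingRegion g U) (hV : IsOpen V)
    (hAV : attractingSet g^[3] (g '' U) ⊆ V) : ∃ N, ∀ n ≥ N, g^[n] '' U ⊆ V := by
  obtain ⟨-, hcomp, hsub⟩ := hU
  set C := closure (g '' U)
  have hCg : g '' C ⊆ C := (Set.image_mono hsub).trans subset_closure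
  have hanti : Antitone fun n => g^[n] '' C := antitone_nat_of_succ_le fun n => by
    rw [Function.iterate_succ, Set.image_comp]
    exact Set.image_mono hCg
  have hK : ∀ n, IsCompact (g^[n] '' C) := fun n => hcomp.image (hg.iterate n)
  have hmem : ∀ x ∈ ⋂ n, g^[n] '' C, V ∈ 𝓝 x := by
    intro x hx
    refine hV.mem_nhds (hAV ?_)
    rw [attractingSet, Set.mem_iInter]
    intro k
    rw [Set.mem_iInter] at hx
    -- The extra iterate sends `closure (g '' U)`, which is contained in `U`, into `g '' U`.
    have h1 := hx (3 * k + 1)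
    rw [← Function.iterate_mul]
    have h2 : g^[3 * k + 1] '' C ⊆ g^[3 * k] '' (g '' U) := by
      rw [Function.iterate_succ, Set.image_comp]
      exact Set.image_mono (Set.image_mono hsub)
    exact h2 h1
  obtain ⟨N, hN⟩ := exists_subset_nhds_of_isCompact (V := fun n => g^[n] '' C)
    hanti.directed_ge hK hmem
  refine ⟨N + 1, fun n hn => ?_⟩
  obtain ⟨m, rfl⟩ := Nat.exists_eq_add_of_le hn
  have h1 : g^[N + 1 + m] '' U ⊆ g^[N + m] '' C := by
    rw [show N + 1 + m = (N + m) + 1 by ring, Function.iterate_succ, Set.image_comp]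
    exact Set.image_mono subset_closure
  exact h1.trans ((hanti (Nat.le_add_right N m)).trans hN)

theorem attractingSet_subset (g : PS 3 → PS 3) (U : Set (PS 3)) : attractingSet g U ⊆ U := by
  intro x hx
  have := Set.mem_iInter.1 hx 0
  simpa using this

/-! ### Smoothness of families of alternating forms -/

/-- Evaluation on tuples of basis vectors embeds the forms linearly in a finite product of lines,
and this embedding has a linear left inverse. -/
theorem contDiffOn_alternating_iff {X : Type*} [NormedAddCommGroup X] [NormedSpace ℝ X]
    {n r : ℕ} {f : X → CV n [⋀^Fin r]→L[ℝ] ℝ} {s : Set X} :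
    ContDiffOn ℝ ∞ f s ↔ ∀ v, ContDiffOn ℝ ∞ (fun x => f x v) s := by
  constructor
  · intro h v
    exact (ContinuousAlternatingMap.apply ℝ (CV n) ℝ v).contDiff.comp_contDiffOn h
  · intro h
    let b := Module.finBasis ℝ (CV n)
    let ev : (CV n [⋀^Fin r]→L[ℝ] ℝ) →ₗ[ℝ] ((Fin r → Fin (Module.finrank ℝ (CV n))) → ℝ) :=
      { toFun := fun φ k => φ fun i => b (k i)
        map_add' := fun _ _ => rfl
        map_smul' := fun _ _ => rfl }
    have hinj : Function.Injective ev := by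
      intro φ ψ hφ
      refine ContinuousAlternatingMap.toContinuousMultilinearMap_injective
        (ContinuousMultilinearMap.toMultilinearMap_injective ?_)
      refine Module.Basis.ext_multilinear (fun _ => b) fun k => congrFun hφ k
    have hfin : FiniteDimensional ℝ (CV n [⋀^Fin r]→L[ℝ] ℝ) :=
      FiniteDimensional.of_injective ev hinj
    obtain ⟨L, hL⟩ := LinearMap.exists_leftInverse_of_injective ev (LinearMap.ker_eq_bot.2 hinj)
    have hf : f = fun x => LinearMap.toContinuousLinearMap L (ev (f x)) := by
      funext x
      exact (LinearMap.congr_fun hL (f x)).symm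
    rw [hf]
    refine (LinearMap.toContinuousLinearMap L).contDiff.comp_contDiffOn ?_
    exact contDiffOn_pi.2 fun k => h _

theorem ContDiffOn.alternating_apply {X E : Type*} [NormedAddCommGroup X] [NormedSpace ℝ X]
    [NormedAddCommGroup E] [NormedSpace ℝ E]
    {r : ℕ} {f : X → E [⋀^Fin r]→L[ℝ] ℝ} {v : Fin r → X → E} {s : Set X}
    (hf : ContDiffOn ℝ ∞ f s) (hv : ∀ i, ContDiffOn ℝ ∞ (v i) s) :
    ContDiffOn ℝ ∞ (fun x => f x fun i => v i x) s := by
  let L : (E [⋀^Fin r]→L[ℝ] ℝ) →L[ℝ] ContinuousMultilinearMap ℝ (fun _ : Fin r => E) ℝ :=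
    ContinuousAlternatingMap.toContinuousMultilinearMapCLM ℝ
  have h := L.analyticOnNhd_uncurry_of_multilinear.contDiffOn (n := ∞) (s := Set.univ)
    uniqueDiffOn_univ
  exact h.comp (hf.prodMk (contDiffOn_pi.2 hv)) (Set.mapsTo_univ _ _)

/-! ### Pull-back of forms by homogeneous holomorphic maps -/

/-- A homogeneous holomorphic map of `ℂ³` without zeros outside the origin. -/
structure IsHomMap (δ : ℕ) (H : CV 3 → CV 3) : Prop where
  contDiff : ContDiff ℂ ∞ H
  zero : H 0 = 0
  ne_zero : ∀ z, z ≠ 0 → H z ≠ 0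
  smul : ∀ (c : ℂ) z, H (c • z) = c ^ δ • H z

namespace IsHomMap

variable {δ : ℕ} {H : CV 3 → CV 3}

theorem differentiable (hH : IsHomMap δ H) : Differentiable ℂ H :=
  hH.contDiff.differentiable (by simp)

theorem contDiff_real (hH : IsHomMap δ H) : ContDiff ℝ ∞ H := hH.contDiff.restrict_scalars ℝ

theorem fderiv_real (hH : IsHomMap δ H) (z : CV 3) (v : CV 3) :
    fderiv ℝ H z v = fderiv ℂ H z v := by
  rw [((hH.differentiable z).hasFDerivAt.restrictScalars ℝ).fderiv]
  rfl

theorem fderiv_smul_right (hH : IsHomMap δ H) (c : ℂ) (z v : CV 3) :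
    fderiv ℝ H z (c • v) = c • fderiv ℝ H z v := by
  rw [hH.fderiv_real, hH.fderiv_real, map_smul]

/-- Euler's identity. It shows that `dH` maps vectors tangent to the fibres to vectors tangent to
the fibres, so that pull-backs descend to `ℙ²`. -/
theorem fderiv_self (hH : IsHomMap δ H) (z : CV 3) : fderiv ℝ H z z = (δ : ℂ) • H z := by
  rw [hH.fderiv_real]
  have h1 : HasDerivAt (fun t : ℂ => H (t • z)) (fderiv ℂ H z z) 1 := by
    have h2 : HasDerivAt (fun t : ℂ => t • z) z 1 := by
      simpa using (hasDerivAt_id (1 : ℂ)).smul_const z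
    have h3 : HasFDerivAt H (fderiv ℂ H z) ((1 : ℂ) • z) := by
      rw [one_smul]; exact (hH.differentiable z).hasFDerivAt
    exact h3.comp_hasDerivAt (1 : ℂ) h2
  have h4 : HasDerivAt (fun t : ℂ => H (t • z)) ((δ : ℂ) • H z) 1 := by
    simp only [hH.smul]
    simpa using (hasDerivAt_pow δ (1 : ℂ)).smul_const (H z)
  exact h1.unique h4

theorem fderiv_smul (hH : IsHomMap δ H) (c : ℂ) (z v : CV 3) :
    fderiv ℝ H (c • z) (c • v) = c ^ δ • fderiv ℝ H z v := by
  rw [hH.fderiv_real, hH.fderiv_real]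
  have h1 : HasFDerivAt (fun x => H (c • x)) ((fderiv ℂ H (c • z)).comp
      (c • ContinuousLinearMap.id ℂ (CV 3))) z :=
    (hH.differentiable (c • z)).hasFDerivAt.comp z ((hasFDerivAt_id (𝕜 := ℂ) z).const_smul c)
  have h2 : HasFDerivAt (fun x => H (c • x)) (c ^ δ • fderiv ℂ H z) z := by
    simp only [hH.smul]
    exact (hH.differentiable z).hasFDerivAt.const_smul (c ^ δ)
  have := DFunLike.congr_fun (h1.unique h2) v
  simpa using this

/-- The pull-back of forms. -/
def pull (hH : IsHomMap δ H) (r : ℕ) : smoothForms r →ₗ[ℝ] smoothForms r where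
  toFun φ := ⟨fun z => (φ.1 (H z)).compContinuousLinearMap (fderiv ℝ H z), by
    obtain ⟨φ, h0, h1, h2, h3⟩ := φ
    refine ⟨?_, ?_, ?_, ?_⟩
    · ext v
      simp [hH.zero, h0]
    · rw [contDiffOn_alternating_iff]
      intro v
      have hφ : ContDiffOn ℝ ∞ (fun z => φ (H z)) {0}ᶜ :=
        h1.comp hH.contDiff_real.contDiffOn fun z hz => hH.ne_zero z hz
      refine ContDiffOn.alternating_apply (v := fun i z => fderiv ℝ H z (v i)) hφ fun i => ?_
      exact ((hH.contDiff_real.fderiv_right (m := ∞) (by simp)).clm_apply contDiff_const).contDiffOn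
    · rintro z hz v ⟨i, c, hv⟩
      refine h2 (H z) (hH.ne_zero z hz) _ ⟨i, c * δ, ?_⟩
      change fderiv ℝ H z (v i) = _
      rw [hv, hH.fderiv_smul_right, hH.fderiv_self, smul_smul]
    · intro z hz c hc v
      have h := h3 (H z) (hH.ne_zero z hz) (c ^ δ) (pow_ne_zero _ hc) fun i => fderiv ℝ H z (v i)
      simp only [ContinuousAlternatingMap.compContinuousLinearMap_apply, Function.comp_def,
        hH.fderiv_smul, hH.smul]
      exact h⟩
  map_add' φ ψ := rfl
  map_smul' a φ := rfl

theorem pull_apply (hH : IsHomMap δ H) {r : ℕ} (φ : smoothForms r) (z : CV 3)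
    (v : Fin r → CV 3) : (hH.pull r φ).1 z v = φ.1 (H z) fun i => fderiv ℝ H z (v i) := rfl

theorem two_le_infty : minSmoothness ℝ 2 ≤ (∞ : WithTop ℕ∞) := by
  rw [minSmoothness_of_isRCLikeNormedField]
  exact WithTop.coe_le_coe.2 le_top

theorem _root_.SmallDegree.differentiableAt_of_contDiffOn {E : Type*} [NormedAddCommGroup E]
    [NormedSpace ℝ E] {f : CV 3 → E} (hf : ContDiffOn ℝ ∞ f {0}ᶜ) {z : CV 3}
    (hz : z ≠ 0) : DifferentiableAt ℝ f z :=
  (hf.contDiffAt (isOpen_compl_singleton.mem_nhds hz)).differentiableAt (by simp)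

theorem pull_extDeriv (hH : IsHomMap δ H) {r : ℕ} {ψ : smoothForms r} {φ : smoothForms (r + 1)}
    (h : ∀ z ≠ 0, φ.1 z = extDeriv ψ.1 z) :
    ∀ z ≠ 0, (hH.pull (r + 1) φ).1 z = extDeriv (hH.pull r ψ).1 z := by
  intro z hz
  have h1 : extDeriv (fun x => (ψ.1 (H x)).compContinuousLinearMap (fderiv ℝ H x)) z =
      (extDeriv ψ.1 (H z)).compContinuousLinearMap (fderiv ℝ H z) := extDeriv_pullback
    (differentiableAt_of_contDiffOn ψ.2.2.1 (hH.ne_zero z hz)) hH.contDiff_real.contDiffAt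
    two_le_infty
  refine Eq.trans ?_ h1.symm
  rw [← h _ (hH.ne_zero z hz)]
  rfl

end IsHomMap

theorem HomTriple.isHomMap_F {d : ℕ} (T : HomTriple d) (hd : d ≠ 0) (ε : ℂ) :
    IsHomMap d (T.F ε) where
  contDiff := contDiff_pi.2 fun i =>
    (AnalyticOnNhd.eval_mvPolynomial (𝕜 := ℂ) (T.poly ε i)).contDiff
  zero := by
    have := T.F_smul ε 0 0
    rwa [zero_smul, zero_pow hd, zero_smul] at this
  ne_zero _ := T.F_ne_zero hd ε
  smul := T.F_smul ε

/-! ### The Fubini–Study form -/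

/-- The real coordinates as linear functionals. -/
def reL (i : Fin 3) : CV 3 →L[ℝ] ℝ := Complex.reCLM.comp (ContinuousLinearMap.proj i)

/-- The imaginary parts of the coordinates as linear functionals. -/
def imL (i : Fin 3) : CV 3 →L[ℝ] ℝ := Complex.imCLM.comp (ContinuousLinearMap.proj i)

/-- The imaginary part of the standard Hermitian product. -/
def herIm : CV 3 →L[ℝ] CV 3 →L[ℝ] ℝ :=
  ∑ i, ((reL i).smulRight (imL i) - (imL i).smulRight (reL i))

/-- The real part of the standard Hermitian product. -/
def herRe : CV 3 →L[ℝ] CV 3 →L[ℝ] ℝ :=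
  ∑ i, ((reL i).smulRight (reL i) + (imL i).smulRight (imL i))

/-- The square of the standard Hermitian norm. -/
def nsq (z : CV 3) : ℝ := herRe z z

theorem herIm_apply (z v : CV 3) :
    herIm z v = ∑ i, ((z i).re * (v i).im - (z i).im * (v i).re) := by
  simp [herIm, reL, imL]

theorem herRe_apply (z v : CV 3) :
    herRe z v = ∑ i, ((z i).re * (v i).re + (z i).im * (v i).im) := by
  simp [herRe, reL, imL]

theorem nsq_eq (z : CV 3) : nsq z = ∑ i, ‖z i‖ ^ 2 := by
  rw [nsq, herRe_apply]
  refine Finset.sum_congr rfl fun i _ => ?_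
  rw [← Complex.normSq_eq_norm_sq, Complex.normSq_apply]

theorem norm_sq_le_nsq (z : CV 3) : ‖z‖ ^ 2 ≤ nsq z := by
  have h : ‖z‖ ≤ √(nsq z) := by
    refine (pi_norm_le_iff_of_nonneg (Real.sqrt_nonneg _)).2 fun i => Real.le_sqrt_of_sq_le ?_
    rw [nsq_eq]
    exact Finset.single_le_sum (f := fun i => ‖z i‖ ^ 2) (fun _ _ => by positivity)
      (Finset.mem_univ i)
  have h0 : 0 ≤ nsq z := by rw [nsq_eq]; positivity
  calc ‖z‖ ^ 2 ≤ √(nsq z) ^ 2 := by gcongr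
    _ = nsq z := Real.sq_sqrt h0

theorem nsq_le (z : CV 3) : nsq z ≤ 3 * ‖z‖ ^ 2 := by
  rw [nsq_eq]
  calc ∑ i, ‖z i‖ ^ 2 ≤ ∑ _i : Fin 3, ‖z‖ ^ 2 := by
        gcongr with i; exact norm_le_pi_norm z i
    _ = _ := by simp

theorem nsq_nonneg (z : CV 3) : 0 ≤ nsq z := (sq_nonneg _).trans (norm_sq_le_nsq z)

theorem nsq_pos {z : CV 3} (hz : z ≠ 0) : 0 < nsq z :=
  (pow_pos (norm_pos_iff.2 hz) 2).trans_le (norm_sq_le_nsq z)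

theorem nsq_smul (c : ℂ) (z : CV 3) : nsq (c • z) = ‖c‖ ^ 2 * nsq z := by
  simp only [nsq_eq, Pi.smul_apply, smul_eq_mul, norm_mul, mul_pow, Finset.mul_sum]

theorem herIm_self (z : CV 3) : herIm z z = 0 := by
  simp only [herIm_apply, Fin.sum_univ_three]; ring

theorem herIm_swap (z v : CV 3) : herIm z v = -herIm v z := by
  simp only [herIm_apply, Fin.sum_univ_three]; ring

theorem herRe_swap (z v : CV 3) : herRe z v = herRe v z := by
  simp only [herRe_apply, Fin.sum_univ_three]; ring

theorem herIm_smul_right (c : ℂ) (z v : CV 3) :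
    herIm z (c • v) = c.re * herIm z v + c.im * herRe z v := by
  simp only [herIm_apply, herRe_apply, Fin.sum_univ_three, Pi.smul_apply, smul_eq_mul,
    Complex.mul_re, Complex.mul_im]
  ring

theorem herRe_smul_right (c : ℂ) (z v : CV 3) :
    herRe z (c • v) = c.re * herRe z v - c.im * herIm z v := by
  simp only [herIm_apply, herRe_apply, Fin.sum_univ_three, Pi.smul_apply, smul_eq_mul,
    Complex.mul_re, Complex.mul_im]
  ring

theorem herIm_smul_smul (c : ℂ) (z v : CV 3) : herIm (c • z) (c • v) = ‖c‖ ^ 2 * herIm z v := by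
  rw [← Complex.normSq_eq_norm_sq, Complex.normSq_apply]
  simp only [herIm_apply, Fin.sum_univ_three, Pi.smul_apply, smul_eq_mul,
    Complex.mul_re, Complex.mul_im]
  ring

theorem herRe_smul_smul (c : ℂ) (z v : CV 3) : herRe (c • z) (c • v) = ‖c‖ ^ 2 * herRe z v := by
  rw [← Complex.normSq_eq_norm_sq, Complex.normSq_apply]
  simp only [herRe_apply, Fin.sum_univ_three, Pi.smul_apply, smul_eq_mul,
    Complex.mul_re, Complex.mul_im]
  ring

theorem contDiff_nsq : ContDiff ℝ ∞ nsq := by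
  have : nsq = fun z => herRe z z := rfl
  rw [this]
  exact herRe.contDiff.clm_apply contDiff_id

theorem hasFDerivAt_nsq (z : CV 3) : HasFDerivAt nsq ((2 : ℝ) • herRe z) z := by
  have h := (herRe.hasFDerivAt (x := z)).clm_apply (hasFDerivAt_id z)
  refine h.congr_fderiv (ContinuousLinearMap.ext fun v => ?_)
  simp [herRe_swap v z, two_mul]

/-- The connection form `Im⟨z, dz⟩ / |z|²`. -/
def conn (z : CV 3) : CV 3 [⋀^Fin 1]→L[ℝ] ℝ :=
  ContinuousAlternatingMap.ofSubsingleton ℝ (CV 3) ℝ 0 ((nsq z)⁻¹ • herIm z)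

theorem conn_apply (z : CV 3) (v : Fin 1 → CV 3) : conn z v = herIm z (v 0) / nsq z := by
  simp [conn, div_eq_inv_mul]

theorem contDiffOn_conn : ContDiffOn ℝ ∞ conn {0}ᶜ := by
  rw [contDiffOn_alternating_iff]
  intro v
  simp only [conn_apply]
  exact ((herIm.contDiff.clm_apply contDiff_const).contDiffOn).div contDiff_nsq.contDiffOn
    fun z hz => (nsq_pos hz).ne'

theorem hasFDerivAt_herIm_div {z : CV 3} (hz : z ≠ 0) (v : CV 3) :
    ∃ L : CV 3 →L[ℝ] ℝ, HasFDerivAt (fun x => herIm x v / nsq x) L z ∧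
      ∀ w, L w = herIm w v / nsq z - 2 * herIm z v * herRe z w / nsq z ^ 2 := by
  have h1 : HasFDerivAt (fun x => herIm x v) (herIm.flip v) z := (herIm.flip v).hasFDerivAt
  have hn := (nsq_pos hz).ne'
  have h2 : HasFDerivAt (fun x => (nsq x)⁻¹) ((-(nsq z ^ 2)⁻¹) • ((2 : ℝ) • herRe z)) z :=
    (hasDerivAt_inv hn).comp_hasFDerivAt z (hasFDerivAt_nsq z)
  simp only [div_eq_mul_inv]
  refine ⟨_, h1.fun_mul h2, fun w => ?_⟩
  simp
  field_simp
  ring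

/-- The connection form takes the value `1` on `i z`, so it does not descend to `ℙ²`; its
differential does, as the formula shows. -/
theorem extDeriv_conn_apply {z : CV 3} (hz : z ≠ 0) (v : Fin 2 → CV 3) :
    extDeriv conn z v = 2 * herIm (v 0) (v 1) / nsq z -
      2 * (herRe z (v 0) * herIm z (v 1) - herRe z (v 1) * herIm z (v 0)) / nsq z ^ 2 := by
  rw [extDeriv_apply (differentiableAt_of_contDiffOn contDiffOn_conn hz), Fin.sum_univ_two]
  simp only [conn_apply]
  obtain ⟨L, hL, hL'⟩ := hasFDerivAt_herIm_div hz (v 1)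
  obtain ⟨M, hM, hM'⟩ := hasFDerivAt_herIm_div hz (v 0)
  have e1 : (Fin.removeNth 0 v : Fin 1 → CV 3) 0 = v 1 := rfl
  have e2 : (Fin.removeNth 1 v : Fin 1 → CV 3) 0 = v 0 := rfl
  rw [e1, e2, hL.fderiv, hM.fderiv, hL', hM', herIm_swap (v 1) (v 0)]
  simp
  ring

open Classical in
/-- The Fubini–Study form, as a form on `ℂ³ ∖ {0}`. -/
def fs : smoothForms 2 := ⟨fun z => if z = 0 then 0 else extDeriv conn z, by
  refine ⟨if_pos rfl, ?_, ?_, ?_⟩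
  · rw [contDiffOn_alternating_iff]
    intro v
    have h : ContDiffOn ℝ ∞ (fun z => 2 * herIm (v 0) (v 1) / nsq z -
      2 * (herRe z (v 0) * herIm z (v 1) - herRe z (v 1) * herIm z (v 0)) / nsq z ^ 2) {0}ᶜ := by
      refine ContDiffOn.sub ?_ ?_
      · exact contDiffOn_const.div contDiff_nsq.contDiffOn fun z hz => (nsq_pos hz).ne'
      · refine ContDiffOn.div (ContDiff.contDiffOn ?_) (contDiff_nsq.pow 2).contDiffOn
          fun z hz => (pow_pos (nsq_pos hz) 2).ne'
        have hR : ∀ w, ContDiff ℝ ∞ fun z => herRe z w := fun w =>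
          herRe.contDiff.clm_apply contDiff_const
        have hI : ∀ w, ContDiff ℝ ∞ fun z => herIm z w := fun w =>
          herIm.contDiff.clm_apply contDiff_const
        exact contDiff_const.mul (((hR _).mul (hI _)).sub ((hR _).mul (hI _)))
    refine h.congr fun z hz => ?_
    rw [if_neg (show z ≠ 0 from hz), extDeriv_conn_apply hz]
  · rintro z hz v ⟨i, c, hv⟩
    simp only
    rw [if_neg hz, extDeriv_conn_apply hz]
    have hn := (nsq_pos hz).ne'
    have h0 : herRe z z = nsq z := rfl
    fin_cases i
    · change v 0 = c • z at hv
      rw [hv, herIm_swap (c • z), herIm_smul_right, herIm_smul_right, herRe_smul_right, herIm_self,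
        h0, herIm_swap (v 1), herRe_swap (v 1)]
      field_simp
      ring
    · change v 1 = c • z at hv
      rw [hv, herIm_smul_right, herIm_smul_right, herRe_smul_right, herIm_self,
        h0, herIm_swap (v 0), herRe_swap (v 0)]
      field_simp
      ring
  · intro z hz c hc v
    have hcz := smul_ne_zero hc hz
    simp only
    rw [if_neg hz, if_neg hcz, extDeriv_conn_apply hz, extDeriv_conn_apply hcz]
    simp only [herIm_smul_smul, herRe_smul_smul, nsq_smul]
    have hn := (nsq_pos hz).ne'
    have hc' : ‖c‖ ≠ 0 := norm_ne_zero_iff.2 hc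
    field_simp⟩

theorem fs_eq {z : CV 3} (hz : z ≠ 0) : fs.1 z = extDeriv conn z := if_neg hz

theorem fs_apply {z : CV 3} (hz : z ≠ 0) (v : Fin 2 → CV 3) :
    fs.1 z v = 2 * herIm (v 0) (v 1) / nsq z -
      2 * (herRe z (v 0) * herIm z (v 1) - herRe z (v 1) * herIm z (v 0)) / nsq z ^ 2 := by
  rw [fs_eq hz, extDeriv_conn_apply hz]

theorem complexTuple_zero (v : Fin 1 → CV 3) : complexTuple v 0 = v 0 := by
  simp [complexTuple]

theorem complexTuple_one (v : Fin 1 → CV 3) : complexTuple v 1 = Complex.I • v 0 := by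
  simp [complexTuple]

/-- The numerator is, up to the factor `2`, the Cauchy–Schwarz defect of `z` and `v`, which is
positive off the fibre direction. -/
theorem fs_complexTuple {z : CV 3} (hz : z ≠ 0) (v : Fin 1 → CV 3) :
    fs.1 z (complexTuple v) =
      2 * (nsq z * nsq (v 0) - herRe z (v 0) ^ 2 - herIm z (v 0) ^ 2) / nsq z ^ 2 := by
  rw [fs_apply hz, complexTuple_zero, complexTuple_one, herIm_smul_right, herIm_smul_right,
    herRe_smul_right, herIm_self]
  have hn := (nsq_pos hz).ne'
  simp only [Complex.I_re, Complex.I_im]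
  rw [show herRe (v 0) (v 0) = nsq (v 0) from rfl]
  field_simp
  ring

/-! ### Bounds for forms in terms of the Fubini–Study form. -/

theorem norm_form_le {r : ℕ} (φ : smoothForms r) {M : ℝ}
    (hM : ∀ z : CV 3, ‖z‖ = 1 → ‖φ.1 z‖ ≤ M) {z : CV 3} (hz : z ≠ 0) (v : Fin r → CV 3) :
    |φ.1 z v| ≤ M * ∏ i, (‖v i‖ / ‖z‖) := by
  have h1 : ‖z‖ ≠ 0 := norm_ne_zero_iff.2 hz
  have h2 : (‖z‖ : ℂ)⁻¹ ≠ 0 := inv_ne_zero (by exact_mod_cast h1)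
  have h3 : ‖(‖z‖ : ℂ)⁻¹ • z‖ = 1 := by
    rw [norm_smul, norm_inv, Complex.norm_real, norm_norm, inv_mul_cancel₀ h1]
  rw [← φ.2.2.2.2 z hz _ h2 v]
  refine ((φ.1 _).le_opNorm _).trans ?_
  have h4 := hM _ h3
  simp only [norm_smul, norm_inv, Complex.norm_real, norm_norm]
  simp only [div_eq_inv_mul]
  gcongr

/-- In the multilinear expansion every term but one contains a vector tangent to the fibre. -/
theorem form_add_smul {r : ℕ} (φ : smoothForms r) {z : CV 3} (hz : z ≠ 0) (v : Fin r → CV 3)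
    (c : Fin r → ℂ) : φ.1 z (fun i => v i + c i • z) = φ.1 z v := by
  have h := (φ.1 z).toMultilinearMap.map_add_univ v (fun i => c i • z)
  rw [Finset.sum_eq_single Finset.univ] at h
  · rw [Finset.piecewise_univ] at h
    exact h
  · intro s _ hs
    obtain ⟨i, hi⟩ : ∃ i, i ∉ s := by
      by_contra! hcon
      exact hs (Finset.eq_univ_iff_forall.2 hcon)
    exact φ.2.2.2.1 z hz _ ⟨i, c i, Finset.piecewise_eq_of_notMem s _ _ hi⟩
  · simp

/-- Every form of degree two is bounded by the Fubini–Study form on complex lines. -/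
theorem abs_form_le_fs (φ : smoothForms (2 * 1)) {M : ℝ}
    (hM : ∀ z : CV 3, ‖z‖ = 1 → ‖φ.1 z‖ ≤ M) {z : CV 3} (hz : z ≠ 0) (v : Fin 1 → CV 3) :
    |φ.1 z (complexTuple v)| ≤ 3 / 2 * M * fs.1 z (complexTuple v) := by
  have hn := nsq_pos hz
  have hM0 : 0 ≤ M := by
    obtain ⟨w, -, hw, -⟩ := exists_mk_norm_one (Projectivization.mk ℂ z hz)
    exact (norm_nonneg _).trans (hM w hw)
  -- The coefficient of the Hermitian projection of `v 0` to `ℂ z`, so that `w` is the component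
  -- orthogonal to `z`.
  let a : ℂ := ⟨herRe z (v 0) / nsq z, herIm z (v 0) / nsq z⟩
  let w : CV 3 := v 0 - a • z
  have h1 : φ.1 z (complexTuple v) = φ.1 z (complexTuple fun _ => w) := by
    rw [← form_add_smul φ hz (complexTuple fun _ => w)
      (fun i => (if i.val % 2 = 0 then 1 else Complex.I) * a)]
    congr 1
    funext i
    simp only [complexTuple, w]
    rw [mul_smul, ← smul_add, sub_add_cancel, Subsingleton.elim (⟨i.val / 2, _⟩ : Fin 1) 0]
  have h2 : nsq w * nsq z = nsq z * nsq (v 0) - herRe z (v 0) ^ 2 - herIm z (v 0) ^ 2 := by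
    have h : nsq w = nsq (v 0) - 2 * herRe (v 0) (a • z) + nsq (a • z) := by
      simp only [nsq, w, map_sub, sub_apply]
      rw [herRe_swap (a • z) (v 0)]
      ring
    rw [h, herRe_smul_right, nsq_smul, herRe_swap (v 0), herIm_swap (v 0),
      ← Complex.normSq_eq_norm_sq, Complex.normSq_apply]
    simp only [a]
    field_simp
    ring
  rw [fs_complexTuple hz, ← h2, h1]
  refine (norm_form_le φ hM hz _).trans ?_
  have h3 : ∏ i, (‖complexTuple (fun _ : Fin 1 => w) i‖ / ‖z‖) = ‖w‖ ^ 2 / ‖z‖ ^ 2 := by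
    change ∏ i : Fin 2, _ = _
    rw [Fin.prod_univ_two, complexTuple_zero, complexTuple_one, norm_smul, Complex.norm_I, one_mul]
    field_simp
  have hz0 : 0 < ‖z‖ := norm_pos_iff.2 hz
  -- The factor `3` comes from comparing the sup norm with the Hermitian norm on `ℂ³`, and the `2`
  -- from the normalization of `fs`.
  rw [h3, show 3 / 2 * M * (2 * (nsq w * nsq z) / nsq z ^ 2) = M * (3 * nsq w / nsq z) by
    field_simp]
  refine mul_le_mul_of_nonneg_left ?_ hM0
  rw [div_le_div_iff₀ (by positivity) hn]
  have h4 := norm_sq_le_nsq w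
  have h5 := nsq_le z
  have h6 : ‖w‖ ^ 2 * nsq z ≤ nsq w * (3 * ‖z‖ ^ 2) :=
    mul_le_mul h4 h5 hn.le (nsq_nonneg w)
  linarith

open MeasureTheory

/-! ### The pull-back of the Fubini–Study form -/

/-- `H^* conn - δ conn`, a form on projective space whose differential is `H^* fs - δ fs`. -/
def connDiff {δ : ℕ} {H : CV 3 → CV 3} (hH : IsHomMap δ H) : smoothForms 1 :=
  ⟨fun z => (conn (H z)).compContinuousLinearMap (fderiv ℝ H z) + (-δ : ℝ) • conn z, by
    have hval : ∀ z (v : Fin 1 → CV 3),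
        ((conn (H z)).compContinuousLinearMap (fderiv ℝ H z) + (-δ : ℝ) • conn z) v =
        herIm (H z) (fderiv ℝ H z (v 0)) / nsq (H z) - δ * (herIm z (v 0) / nsq z) := by
      intro z v
      have h1 : (conn (H z)).compContinuousLinearMap (fderiv ℝ H z) v =
          herIm (H z) (fderiv ℝ H z (v 0)) / nsq (H z) :=
        conn_apply (H z) fun i => fderiv ℝ H z (v i)
      rw [ContinuousAlternatingMap.add_apply, ContinuousAlternatingMap.smul_apply, h1, conn_apply,
        smul_eq_mul]
      ring
    refine ⟨?_, ?_, ?_, ?_⟩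
    · ext v
      simp only
      rw [hval, hH.zero]
      simp
    · have h1 : ContDiffOn ℝ ∞ (fun z => conn (H z)) {0}ᶜ :=
        contDiffOn_conn.comp hH.contDiff_real.contDiffOn fun z hz => hH.ne_zero z hz
      refine ContDiffOn.add ?_ (contDiffOn_conn.const_smul _)
      rw [contDiffOn_alternating_iff]
      intro v
      refine ContDiffOn.alternating_apply (v := fun i z => fderiv ℝ H z (v i)) h1 fun i => ?_
      exact ((hH.contDiff_real.fderiv_right (m := ∞) (by simp)).clm_apply contDiff_const).contDiffOn
    · rintro z hz v ⟨i, c, hv⟩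
      simp only
      rw [hval]
      obtain rfl : i = 0 := Subsingleton.elim _ _
      have hn := (nsq_pos hz).ne'
      have hn' := (nsq_pos (hH.ne_zero z hz)).ne'
      rw [hv, hH.fderiv_smul_right, hH.fderiv_self, smul_smul, herIm_smul_right, herIm_smul_right,
        herIm_self, herIm_self, show herRe z z = nsq z from rfl,
        show herRe (H z) (H z) = nsq (H z) from rfl]
      simp
      field_simp
      ring
    · intro z hz c hc v
      simp only
      rw [hval, hval, hH.fderiv_smul, hH.smul, herIm_smul_smul, herIm_smul_smul, nsq_smul, nsq_smul]
      have hn := (nsq_pos hz).ne'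
      have hn' := (nsq_pos (hH.ne_zero z hz)).ne'
      have hc' : ‖c‖ ≠ 0 := norm_ne_zero_iff.2 hc
      have hc'' : ‖c ^ δ‖ ≠ 0 := norm_ne_zero_iff.2 (pow_ne_zero _ hc)
      field_simp⟩

theorem extDeriv_connDiff {δ : ℕ} {H : CV 3 → CV 3} (hH : IsHomMap δ H) :
    ∀ z ≠ 0, (hH.pull 2 fs + (-δ : ℝ) • fs).1 z = extDeriv (connDiff hH).1 z := by
  intro z hz
  have hHz := hH.ne_zero z hz
  have h1 : extDeriv (fun x => (conn (H x)).compContinuousLinearMap (fderiv ℝ H x)) z =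
      (extDeriv conn (H z)).compContinuousLinearMap (fderiv ℝ H z) := extDeriv_pullback
    (differentiableAt_of_contDiffOn contDiffOn_conn hHz) hH.contDiff_real.contDiffAt
    IsHomMap.two_le_infty
  have hd1 : DifferentiableAt ℝ
      (fun x => (conn (H x)).compContinuousLinearMap (fderiv ℝ H x)) z := by
    refine DifferentiableAt.continuousAlternatingMapCompContinuousLinearMap
      ((differentiableAt_of_contDiffOn contDiffOn_conn hHz).fun_comp' z
        (hH.contDiff_real.differentiable (by simp) z)) ?_
    exact (hH.contDiff_real.fderiv_right (m := ∞) (by simp)).differentiable (by simp) z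
  have hd2 := differentiableAt_of_contDiffOn contDiffOn_conn hz
  have hd3 : DifferentiableAt ℝ (fun z => (-δ : ℝ) • conn z) z :=
    DifferentiableAt.fun_const_smul hd2 (-δ : ℝ)
  have h2 : extDeriv (connDiff hH).1 z =
      extDeriv (fun x => (conn (H x)).compContinuousLinearMap (fderiv ℝ H x)) z +
        extDeriv ((-δ : ℝ) • conn) z := extDeriv_add hd1 hd3
  rw [h2, extDeriv_smul, h1, ← fs_eq hHz, ← fs_eq hz]
  rfl

/-- The forms `H^* fs` and `δ fs` are cohomologous on `ℙ²`: in `connDiff` the vertical parts of the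
two connection forms cancel, by Euler's identity. -/
theorem closed_apply_pull_fs {δ : ℕ} {H : CV 3 → CV 3} (hH : IsHomMap δ H)
    {T : smoothForms (2 * 1) →ₗ[ℝ] ℝ} (hT : IsClosedFunctional T) :
    T (hH.pull (2 * 1) fs) = δ * T fs := by
  have h : T (hH.pull 2 fs + (-δ : ℝ) • fs) = 0 := hT (connDiff hH) _ (extDeriv_connDiff hH)
  rw [map_add, map_smul, smul_eq_mul] at h
  change T (hH.pull 2 fs) = _
  linarith

theorem exists_norm_le (r : ℕ) (φ : smoothForms r) :
    ∃ M : ℝ, ∀ z : CV 3, ‖z‖ = 1 → ‖φ.1 z‖ ≤ M := by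
  have hc : ContinuousOn φ.1 (Metric.sphere 0 1) := φ.2.2.1.continuousOn.mono fun z hz => by
    rintro rfl
    simp at hz
  obtain ⟨M, hM⟩ := ((isCompact_sphere (0 : CV 3) 1).image_of_continuousOn hc).isBounded.exists_norm_le
  exact ⟨M, fun z hz => hM _ ⟨z, mem_sphere_zero_iff_norm.2 hz, rfl⟩⟩

/-- A positive current has order zero and is controlled by its mass `T fs`. -/
theorem abs_le_of_positive {T : smoothForms (2 * 1) →ₗ[ℝ] ℝ} (hT : IsPositiveFunctional T)
    (φ : smoothForms (2 * 1)) {M : ℝ} (hM : ∀ z : CV 3, ‖z‖ = 1 → ‖φ.1 z‖ ≤ M) :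
    |T φ| ≤ 3 / 2 * M * T fs := by
  have h1 : 0 ≤ T ((3 / 2 * M) • fs + (-1 : ℝ) • φ) := hT _ fun z hz v => by
    have := abs_le.1 (abs_form_le_fs φ hM hz v)
    change 0 ≤ 3 / 2 * M * fs.1 z (complexTuple v) + -1 * φ.1 z (complexTuple v)
    linarith
  have h2 : 0 ≤ T ((3 / 2 * M) • fs + φ) := hT _ fun z hz v => by
    have := abs_le.1 (abs_form_le_fs φ hM hz v)
    change 0 ≤ 3 / 2 * M * fs.1 z (complexTuple v) + φ.1 z (complexTuple v)
    linarith
  rw [map_add, map_smul, map_smul, smul_eq_mul, smul_eq_mul] at h1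
  rw [map_add, map_smul, smul_eq_mul] at h2
  exact abs_le.2 ⟨by linarith, by linarith⟩

/-! ### The current of integration on the line `t = 0` -/

/-- The direction of the line. -/
def lineDir : CV 3 := ![1, 0, 0]

/-- The affine parametrization of the line. -/
def linePt (p : ℝ × ℝ) : CV 3 := ![p.1 + p.2 * Complex.I, 1, 0]

theorem linePt_ne_zero (p : ℝ × ℝ) : linePt p ≠ 0 := fun h => one_ne_zero (congrFun h 1)

theorem linePt_eq (p : ℝ × ℝ) :
    linePt p = ![0, 1, 0] + (p.1 • lineDir + p.2 • (Complex.I • lineDir)) := by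
  funext i
  fin_cases i <;> simp [linePt, lineDir]

theorem contDiff_linePt : ContDiff ℝ ∞ linePt := by
  have : linePt = fun p => ![0, 1, 0] + (p.1 • lineDir + p.2 • (Complex.I • lineDir)) :=
    funext linePt_eq
  rw [this]
  exact contDiff_const.add ((contDiff_fst.smul contDiff_const).add
    (contDiff_snd.smul contDiff_const))

theorem hasFDerivAt_linePt (p : ℝ × ℝ) : ∃ L : ℝ × ℝ →L[ℝ] CV 3, HasFDerivAt linePt L p ∧
    L (1, 0) = lineDir ∧ L (0, 1) = Complex.I • lineDir := by
  have h1 : HasFDerivAt (fun q : ℝ × ℝ => q.1 • lineDir)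
      ((ContinuousLinearMap.fst ℝ ℝ ℝ).smulRight lineDir) p :=
    ((ContinuousLinearMap.fst ℝ ℝ ℝ).smulRight lineDir).hasFDerivAt
  have h2 : HasFDerivAt (fun q : ℝ × ℝ => q.2 • (Complex.I • lineDir))
      ((ContinuousLinearMap.snd ℝ ℝ ℝ).smulRight (Complex.I • lineDir)) p :=
    ((ContinuousLinearMap.snd ℝ ℝ ℝ).smulRight (Complex.I • lineDir)).hasFDerivAt
  have : linePt = fun p => ![0, 1, 0] + (p.1 • lineDir + p.2 • (Complex.I • lineDir)) :=
    funext linePt_eq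
  rw [this]
  exact ⟨_, (h1.fun_add h2).const_add _, by simp, by simp⟩

theorem nsq_linePt (p : ℝ × ℝ) : nsq (linePt p) = 1 + p.1 ^ 2 + p.2 ^ 2 := by
  simp [nsq, herRe_apply, Fin.sum_univ_three, linePt]
  ring

/-- The restriction of a form to the line. -/
def lineForm (φ : smoothForms (2 * 1)) (p : ℝ × ℝ) : ℝ :=
  φ.1 (linePt p) (complexTuple fun _ => lineDir)

theorem lineForm_fs (p : ℝ × ℝ) : lineForm fs p = 2 / (1 + p.1 ^ 2 + p.2 ^ 2) ^ 2 := by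
  rw [lineForm, fs_complexTuple (linePt_ne_zero p), nsq_linePt]
  simp [nsq, herRe_apply, herIm_apply, Fin.sum_univ_three, linePt, lineDir]
  ring

theorem continuous_lineForm (φ : smoothForms (2 * 1)) : Continuous (lineForm φ) := by
  have h : ContDiffOn ℝ ∞ (fun p => φ.1 (linePt p)) Set.univ :=
    φ.2.2.1.comp contDiff_linePt.contDiffOn fun p _ => linePt_ne_zero p
  exact (contDiffOn_univ.1 (contDiffOn_alternating_iff.1 h _)).continuous

theorem abs_lineForm_le (φ : smoothForms (2 * 1)) {M : ℝ}
    (hM : ∀ z : CV 3, ‖z‖ = 1 → ‖φ.1 z‖ ≤ M) (p : ℝ × ℝ) :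
    |lineForm φ p| ≤ 3 / 2 * M * lineForm fs p :=
  abs_form_le_fs φ hM (linePt_ne_zero p) _

theorem integrable_lineForm_fs : Integrable (lineForm fs) := by
  have h : Integrable fun p : ℝ × ℝ => 2 * ((1 + p.1 ^ 2)⁻¹ * (1 + p.2 ^ 2)⁻¹) :=
    (integrable_inv_one_add_sq.mul_prod integrable_inv_one_add_sq).const_mul 2
  refine h.mono' (continuous_lineForm fs).aestronglyMeasurable (Eventually.of_forall fun p => ?_)
  rw [lineForm_fs, Real.norm_of_nonneg (by positivity), div_eq_mul_inv, ← mul_inv]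
  gcongr
  nlinarith [sq_nonneg p.1, sq_nonneg p.2, mul_nonneg (sq_nonneg p.1) (sq_nonneg p.2)]

theorem integrable_lineForm (φ : smoothForms (2 * 1)) : Integrable (lineForm φ) := by
  obtain ⟨M, hM⟩ := exists_norm_le _ φ
  exact (integrable_lineForm_fs.const_mul (3 / 2 * M)).mono'
    (continuous_lineForm φ).aestronglyMeasurable (Eventually.of_forall (abs_lineForm_le φ hM))

/-- The current of integration on the line `t = 0`. -/
def lineCurrent : smoothForms (2 * 1) →ₗ[ℝ] ℝ where
  toFun φ := ∫ p, lineForm φ p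
  map_add' φ ψ := integral_add (integrable_lineForm φ) (integrable_lineForm ψ)
  map_smul' a φ := integral_const_mul a (lineForm φ)

theorem lineCurrent_positive : IsPositiveFunctional lineCurrent := fun _ hφ =>
  integral_nonneg fun p => hφ _ (linePt_ne_zero p) _

theorem lineCurrent_fs_pos : 0 < lineCurrent fs := by
  have h := (integral_pos_iff_support_of_nonneg (f := lineForm fs)
    (fun p => by rw [lineForm_fs, Pi.zero_apply]; positivity) integrable_lineForm_fs).2
  refine h ?_
  have : Function.support (lineForm fs) = Set.univ := by
    refine Set.eq_univ_of_forall fun p => ?_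
    rw [Function.mem_support, lineForm_fs]
    positivity
  rw [this]
  simp

/-- Modulo the fibre, the direction of the line at the parameter `ζ` is a vector of size `1 / |ζ|`,
and dilation invariance divides once more by `‖linePt p‖ ≥ |ζ|`. -/
theorem abs_oneForm_linePt_le (ψ : smoothForms 1) {M : ℝ}
    (hM : ∀ z : CV 3, ‖z‖ = 1 → ‖ψ.1 z‖ ≤ M) (hM0 : 0 ≤ M) (c : ℂ) (hc : ‖c‖ = 1) {R : ℝ}
    (hR : 0 < R) {p : ℝ × ℝ} (hp : R ≤ |p.1| ∨ R ≤ |p.2|) :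
    |ψ.1 (linePt p) fun _ => c • lineDir| ≤ M / R ^ 2 := by
  set ζ : ℂ := p.1 + p.2 * Complex.I with hζ
  have h1 : R ≤ ‖ζ‖ := by
    rcases hp with hp | hp
    · refine hp.trans ?_
      have := Complex.abs_re_le_norm ζ
      simpa [hζ] using this
    · refine hp.trans ?_
      have := Complex.abs_im_le_norm ζ
      simpa [hζ] using this
  have h0 : ζ ≠ 0 := norm_pos_iff.1 (hR.trans_le h1)
  rw [← form_add_smul ψ (linePt_ne_zero p) _ fun _ => -(c * ζ⁻¹)]
  refine (norm_form_le ψ hM (linePt_ne_zero p) _).trans ?_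
  rw [Fin.prod_univ_one]
  have h2 : c • lineDir + -(c * ζ⁻¹) • linePt p = (c * ζ⁻¹) • ![0, -1, 0] := by
    funext i
    fin_cases i
    · simp [lineDir, linePt, ← hζ, h0]
    · simp [lineDir, linePt]
    · simp [lineDir, linePt]
  have h3 : ‖(![0, -1, 0] : CV 3)‖ ≤ 1 := by
    refine (pi_norm_le_iff_of_nonneg zero_le_one).2 fun i => ?_
    fin_cases i <;> simp
  have h4 : ‖ζ‖ ≤ ‖linePt p‖ := norm_le_pi_norm (linePt p) 0
  rw [h2, norm_smul, norm_mul, hc, one_mul, norm_inv, div_eq_mul_inv M]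
  refine mul_le_mul_of_nonneg_left ?_ hM0
  calc ‖ζ‖⁻¹ * ‖(![0, -1, 0] : CV 3)‖ / ‖linePt p‖ ≤ R⁻¹ * 1 / R := by
        gcongr
        exact h1.trans h4
    _ = (R ^ 2)⁻¹ := by field_simp

/-- This writes the restriction of `dψ` to the line as the divergence of a plane vector field. -/
theorem lineForm_extDeriv (ψ : smoothForms 1) {φ : smoothForms (2 * 1)}
    (h : ∀ z ≠ 0, φ.1 z = extDeriv ψ.1 z) (p : ℝ × ℝ) :
    ∃ L M : ℝ × ℝ →L[ℝ] ℝ,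
      HasFDerivAt (fun q => ψ.1 (linePt q) fun _ => Complex.I • lineDir) L p ∧
      HasFDerivAt (fun q => -(ψ.1 (linePt q) fun _ => lineDir)) M p ∧
      L (1, 0) + M (0, 1) = lineForm φ p := by
  obtain ⟨S, hS, hS1, hS2⟩ := hasFDerivAt_linePt p
  have hdiff : ∀ v : Fin 1 → CV 3, DifferentiableAt ℝ (fun z => ψ.1 z v) (linePt p) := fun v =>
    differentiableAt_of_contDiffOn (contDiffOn_alternating_iff.1 ψ.2.2.1 v) (linePt_ne_zero p)
  have h1 := (hdiff fun _ => Complex.I • lineDir).hasFDerivAt.comp p hS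
  have h2 := ((hdiff fun _ => lineDir).hasFDerivAt.comp p hS).neg
  refine ⟨_, _, h1, h2, ?_⟩
  rw [lineForm, h _ (linePt_ne_zero p), extDeriv_apply
    (differentiableAt_of_contDiffOn ψ.2.2.1 (linePt_ne_zero p))]
  change _ = ∑ i : Fin 2, _
  rw [Fin.sum_univ_two]
  have e1 : (Fin.removeNth 0 (complexTuple fun _ : Fin 1 => lineDir) : Fin 1 → CV 3) =
      fun _ => Complex.I • lineDir := by
    funext i
    obtain rfl : i = 0 := Subsingleton.elim _ _
    exact complexTuple_one _
  have e2 : (Fin.removeNth 1 (complexTuple fun _ : Fin 1 => lineDir) : Fin 1 → CV 3) =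
      fun _ => lineDir := by
    funext i
    obtain rfl : i = 0 := Subsingleton.elim _ _
    exact complexTuple_zero _
  rw [e1, e2, complexTuple_zero, complexTuple_one]
  simp [hS1, hS2]

/-- Stokes on the squares `[-R, R]²`: the boundary has length `8 R` and the integrand there is at
most `M / R ^ 2`, so the boundary term tends to `0`. -/
theorem lineCurrent_closed : IsClosedFunctional lineCurrent := by
  intro ψ φ h
  change ∫ p, lineForm φ p = 0
  obtain ⟨M, hM⟩ := exists_norm_le _ ψ
  have hM0 : 0 ≤ M := (norm_nonneg _).trans (hM lineDir (by
    refine le_antisymm ((pi_norm_le_iff_of_nonneg zero_le_one).2 fun i => ?_) ?_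
    · fin_cases i <;> simp [lineDir]
    · simpa [lineDir] using norm_le_pi_norm lineDir 0))
  choose L K hL hK hLK using lineForm_extDeriv ψ h
  set f : ℝ × ℝ → ℝ := fun q => ψ.1 (linePt q) fun _ => Complex.I • lineDir
  set g : ℝ × ℝ → ℝ := fun q => -(ψ.1 (linePt q) fun _ => lineDir)
  have hfR : ∀ R : ℝ, 0 < R → ∀ q : ℝ × ℝ, (R ≤ |q.1| ∨ R ≤ |q.2|) → ‖f q‖ ≤ M / R ^ 2 :=
    fun R hR q hq => abs_oneForm_linePt_le ψ hM hM0 Complex.I Complex.norm_I hR hq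
  have hgR : ∀ R : ℝ, 0 < R → ∀ q : ℝ × ℝ, (R ≤ |q.1| ∨ R ≤ |q.2|) → ‖g q‖ ≤ M / R ^ 2 := by
    intro R hR q hq
    have := abs_oneForm_linePt_le ψ hM hM0 1 norm_one hR hq
    rw [norm_neg]
    simpa using this
  have hcover : Tendsto (fun n : ℕ => ∫ p in Set.Ioc (-(n : ℝ)) n ×ˢ Set.Ioc (-(n : ℝ)) n,
      lineForm φ p) atTop (𝓝 (∫ p in Set.univ, lineForm φ p)) := by
    have hU : (⋃ n : ℕ, Set.Ioc (-(n : ℝ)) n ×ˢ Set.Ioc (-(n : ℝ)) n) = Set.univ := by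
      refine Set.eq_univ_of_forall fun p => Set.mem_iUnion.2 ?_
      obtain ⟨n, hn⟩ := exists_nat_gt (max |p.1| |p.2|)
      have h1 := abs_lt.1 ((le_max_left _ _).trans_lt hn)
      have h2 := abs_lt.1 ((le_max_right _ _).trans_lt hn)
      exact ⟨n, ⟨h1.1, h1.2.le⟩, ⟨h2.1, h2.2.le⟩⟩
    rw [← hU]
    refine tendsto_setIntegral_of_monotone (fun n => measurableSet_Ioc.prod measurableSet_Ioc) ?_
      (integrable_lineForm φ).integrableOn
    intro m n hmn
    have : (m : ℝ) ≤ n := Nat.cast_le.2 hmn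
    exact Set.prod_mono (Set.Ioc_subset_Ioc (by linarith) this)
      (Set.Ioc_subset_Ioc (by linarith) this)
  rw [setIntegral_univ] at hcover
  refine tendsto_nhds_unique hcover ?_
  have hlim : Tendsto (fun n : ℕ => 8 * M * (n : ℝ)⁻¹) atTop (𝓝 0) := by
    simpa using (tendsto_inv_atTop_nhds_zero_nat (𝕜 := ℝ)).const_mul (8 * M)
  refine squeeze_zero_norm' ?_ hlim
  filter_upwards [eventually_gt_atTop 0] with n hn
  set R : ℝ := (n : ℝ) with hRn
  have hR : 0 < R := Nat.cast_pos.2 hn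
  have hRR : -R ≤ R := by linarith
  have hdiv := integral2_divergence_prod_of_hasFDerivAt f g L K (-R) (-R) R R
    (fun q _ => (hL q).continuousAt.continuousWithinAt)
    (fun q _ => (hK q).continuousAt.continuousWithinAt)
    (fun q _ => hL q) (fun q _ => hK q) (by
      simp only [hLK]
      exact (integrable_lineForm φ).integrableOn)
  simp only [hLK] at hdiv
  have heq : ∫ p in Set.Ioc (-R) R ×ˢ Set.Ioc (-R) R, lineForm φ p =
      ∫ x in (-R)..R, ∫ y in (-R)..R, lineForm φ (x, y) := by
    rw [intervalIntegral.integral_of_le hRR]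
    simp only [intervalIntegral.integral_of_le hRR]
    exact setIntegral_prod _ (integrable_lineForm φ).integrableOn
  rw [heq, hdiv]
  have hb : ∀ u : ℝ → ℝ, (∀ x, ‖u x‖ ≤ M / R ^ 2) → ‖∫ x in (-R)..R, u x‖ ≤ 2 * M * R⁻¹ := by
    intro u hu
    refine (intervalIntegral.norm_integral_le_of_norm_le_const fun x _ => hu x).trans (le_of_eq ?_)
    rw [abs_of_pos (by linarith)]
    field_simp
    ring
  have hRabs : R ≤ |R| := le_abs_self R
  have hRabs' : R ≤ |-R| := by rw [abs_neg]; exact le_abs_self R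
  have b1 := hb (fun x => g (x, R)) fun x => hgR R hR _ (Or.inr hRabs)
  have b2 := hb (fun x => g (x, -R)) fun x => hgR R hR _ (Or.inr hRabs')
  have b3 := hb (fun y => f (R, y)) fun x => hfR R hR _ (Or.inl hRabs)
  have b4 := hb (fun y => f (-R, y)) fun x => hfR R hR _ (Or.inl hRabs')
  refine (norm_sub_le _ _).trans ?_
  have h5 := norm_add_le ((∫ x in (-R)..R, g (x, R)) - ∫ x in (-R)..R, g (x, -R))
    (∫ y in (-R)..R, f (R, y))
  have h6 := norm_sub_le (∫ x in (-R)..R, g (x, R)) (∫ x in (-R)..R, g (x, -R))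
  linarith

/-! ### Push-forwards of the line and their limit -/

/-- The differential of `H` is complex linear, so it maps tuples `(v, i v)` to tuples of the same
kind. -/
theorem pull_positive {δ : ℕ} {H : CV 3 → CV 3} (hH : IsHomMap δ H)
    {T : smoothForms (2 * 1) →ₗ[ℝ] ℝ} (hT : IsPositiveFunctional T) :
    IsPositiveFunctional (T ∘ₗ hH.pull (2 * 1)) := by
  intro φ hφ
  refine hT _ fun z hz v => ?_
  rw [hH.pull_apply]
  convert hφ (H z) (hH.ne_zero z hz) (fun i => fderiv ℝ H z (v i)) using 2
  funext i
  simp only [complexTuple]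
  rw [hH.fderiv_smul_right]

theorem pull_closed {δ : ℕ} {H : CV 3 → CV 3} (hH : IsHomMap δ H)
    {T : smoothForms (2 * 1) →ₗ[ℝ] ℝ} (hT : IsClosedFunctional T) :
    IsClosedFunctional (T ∘ₗ hH.pull (2 * 1)) :=
  fun ψ φ h => hT (hH.pull 1 ψ) (hH.pull 2 φ) (hH.pull_extDeriv h)

theorem smul_positive {T : smoothForms (2 * 1) →ₗ[ℝ] ℝ} (hT : IsPositiveFunctional T) {a : ℝ}
    (ha : 0 ≤ a) : IsPositiveFunctional (a • T) := fun φ hφ => mul_nonneg ha (hT φ hφ)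

theorem smul_closed {T : smoothForms (2 * 1) →ₗ[ℝ] ℝ} (hT : IsClosedFunctional T) (a : ℝ) :
    IsClosedFunctional (a • T) := fun ψ φ h => by
  have h1 : T φ = 0 := hT ψ φ h
  change a * T φ = 0
  rw [h1, mul_zero]

/-- The normalized push-forwards of the line. -/
def pushLine {δ : ℕ} {H : CV 3 → CV 3} (hH : IsHomMap δ H) :
    ℕ → (smoothForms (2 * 1) →ₗ[ℝ] ℝ)
  | 0 => lineCurrent
  | n + 1 => (δ : ℝ)⁻¹ • (pushLine hH n ∘ₗ hH.pull (2 * 1))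

theorem pushLine_positive {δ : ℕ} {H : CV 3 → CV 3} (hH : IsHomMap δ H) (n : ℕ) :
    IsPositiveFunctional (pushLine hH n) := by
  induction n with
  | zero => exact lineCurrent_positive
  | succ n ih => exact smul_positive (pull_positive hH ih) (by positivity)

theorem pushLine_closed {δ : ℕ} {H : CV 3 → CV 3} (hH : IsHomMap δ H) (n : ℕ) :
    IsClosedFunctional (pushLine hH n) := by
  induction n with
  | zero => exact lineCurrent_closed
  | succ n ih => exact smul_closed (pull_closed hH ih) _

/-- Normalization by `δ` keeps the mass constant; this bounds the sequence and keeps its limit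
nonzero. -/
theorem pushLine_fs {δ : ℕ} (hδ : δ ≠ 0) {H : CV 3 → CV 3} (hH : IsHomMap δ H) (n : ℕ) :
    pushLine hH n fs = lineCurrent fs := by
  induction n with
  | zero => rfl
  | succ n ih =>
    change (δ : ℝ)⁻¹ * pushLine hH n (hH.pull (2 * 1) fs) = _
    rw [closed_apply_pull_fs hH (pushLine_closed hH n), ih, ← mul_assoc, inv_mul_cancel₀, one_mul]
    exact_mod_cast hδ

theorem abs_pushLine_le {δ : ℕ} (hδ : δ ≠ 0) {H : CV 3 → CV 3} (hH : IsHomMap δ H) (n : ℕ)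
    (φ : smoothForms (2 * 1)) {M : ℝ} (hM : ∀ z : CV 3, ‖z‖ = 1 → ‖φ.1 z‖ ≤ M) :
    |pushLine hH n φ| ≤ 3 / 2 * M * lineCurrent fs := by
  rw [← pushLine_fs hδ hH n]
  exact abs_le_of_positive (pushLine_positive hH n) φ hM

theorem pushLine_eq_zero {δ : ℕ} {H : CV 3 → CV 3} (hH : IsHomMap δ H) (n : ℕ)
    {φ : smoothForms (2 * 1)} (h : ∀ p, φ.1 (H^[n] (linePt p)) = 0) : pushLine hH n φ = 0 := by
  induction n generalizing φ with
  | zero =>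
    change ∫ p, lineForm φ p = 0
    have : lineForm φ = 0 := funext fun p => by
      have h1 : φ.1 (linePt p) = 0 := h p
      rw [lineForm, h1]; rfl
    rw [this]
    exact integral_zero _ _
  | succ n ih =>
    change (δ : ℝ)⁻¹ * pushLine hH n (hH.pull (2 * 1) φ) = _
    rw [ih, mul_zero]
    intro p
    have h1 := h p
    rw [Function.iterate_succ', Function.comp] at h1
    ext v
    rw [hH.pull_apply, h1]
    rfl

/-- Bounded sequences converge along an ultrafilter. Using the same one for all forms makes the
limit linear, without extraction of subsequences. -/
theorem exists_tendsto_pushLine {δ : ℕ} (hδ : δ ≠ 0) {H : CV 3 → CV 3} (hH : IsHomMap δ H)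
    (φ : smoothForms (2 * 1)) :
    ∃ x, Tendsto (fun n => pushLine hH n φ) (hyperfilter ℕ) (𝓝 x) := by
  obtain ⟨M, hM⟩ := exists_norm_le _ φ
  obtain ⟨x, -, hx⟩ := (isCompact_closedBall (0 : ℝ) (3 / 2 * M * lineCurrent fs)).ultrafilter_le_nhds
    ((hyperfilter ℕ).map fun n => pushLine hH n φ) (by
      rw [le_principal_iff, Ultrafilter.mem_coe, Ultrafilter.mem_map]
      refine univ_mem' fun n => ?_
      rw [Set.mem_preimage, mem_closedBall_zero_iff, Real.norm_eq_abs]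
      exact abs_pushLine_le hδ hH n φ hM)
  exact ⟨x, hx⟩

/-- A limit of the normalized push-forwards of the line. -/
def limitCurrent {δ : ℕ} (hδ : δ ≠ 0) {H : CV 3 → CV 3} (hH : IsHomMap δ H) :
    smoothForms (2 * 1) →ₗ[ℝ] ℝ where
  toFun φ := (exists_tendsto_pushLine hδ hH φ).choose
  map_add' φ ψ := by
    refine tendsto_nhds_unique (exists_tendsto_pushLine hδ hH (φ + ψ)).choose_spec ?_
    simp only [map_add]
    exact (exists_tendsto_pushLine hδ hH φ).choose_spec.add
      (exists_tendsto_pushLine hδ hH ψ).choose_spec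
  map_smul' a φ := by
    refine tendsto_nhds_unique (exists_tendsto_pushLine hδ hH (a • φ)).choose_spec ?_
    simp only [map_smul]
    exact (exists_tendsto_pushLine hδ hH φ).choose_spec.const_smul a

theorem tendsto_limitCurrent {δ : ℕ} (hδ : δ ≠ 0) {H : CV 3 → CV 3} (hH : IsHomMap δ H)
    (φ : smoothForms (2 * 1)) :
    Tendsto (fun n => pushLine hH n φ) (hyperfilter ℕ) (𝓝 (limitCurrent hδ hH φ)) :=
  (exists_tendsto_pushLine hδ hH φ).choose_spec

theorem limitCurrent_fs {δ : ℕ} (hδ : δ ≠ 0) {H : CV 3 → CV 3} (hH : IsHomMap δ H) :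
    limitCurrent hδ hH fs = lineCurrent fs :=
  tendsto_nhds_unique (tendsto_limitCurrent hδ hH fs)
    (tendsto_const_nhds.congr fun n => (pushLine_fs hδ hH n).symm)

/-- Positivity and closedness pass to the limit; positivity then gives continuity for the `C⁰` norm.
-/
theorem limitCurrent_isPositiveClosedCurrent {δ : ℕ} (hδ : δ ≠ 0) {H : CV 3 → CV 3}
    (hH : IsHomMap δ H) : IsPositiveClosedCurrent (limitCurrent hδ hH) := by
  have hpos : IsPositiveFunctional (limitCurrent hδ hH) := fun φ hφ =>
    ge_of_tendsto' (tendsto_limitCurrent hδ hH φ) fun n => pushLine_positive hH n φ hφ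
  refine ⟨⟨0, 3 / 2 * limitCurrent hδ hH fs, fun φ M hM => ?_⟩, hpos, ?_⟩
  · refine (abs_le_of_positive hpos φ (M := M) fun z hz => ?_).trans (le_of_eq (by ring))
    have := hM 0 le_rfl z hz
    rwa [norm_iteratedFDeriv_zero] at this
  · intro ψ φ h
    refine tendsto_nhds_unique (tendsto_limitCurrent hδ hH φ) (tendsto_const_nhds.congr fun n => ?_)
    exact (pushLine_closed hH n ψ φ h).symm

theorem limitCurrent_eq_zero {δ : ℕ} (hδ : δ ≠ 0) {H : CV 3 → CV 3}
    (hH : IsHomMap δ H) {φ : smoothForms (2 * 1)} {N : ℕ}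
    (h : ∀ n ≥ N, ∀ p, φ.1 (H^[n] (linePt p)) = 0) : limitCurrent hδ hH φ = 0 := by
  refine tendsto_nhds_unique (tendsto_limitCurrent hδ hH φ)
    (tendsto_const_nhds.congr' (EventuallyEq.filter_mono ?_ Nat.hyperfilter_le_atTop))
  filter_upwards [eventually_ge_atTop N] with n hn
  exact (pushLine_eq_zero hH n (h n hn)).symm

/-! ### A current of bidimension `(1, 1)` on the attracting set. -/

theorem HomTriple.iterate_f_mk {d : ℕ} (T : HomTriple d) (hd : d ≠ 0) (ε : ℂ) (n : ℕ) (z : CV 3)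
    (hz : z ≠ 0) : ∃ h : (T.F ε)^[n] z ≠ 0,
      (T.f hd ε)^[n] (Projectivization.mk ℂ z hz) = Projectivization.mk ℂ ((T.F ε)^[n] z) h := by
  induction n generalizing z with
  | zero => exact ⟨hz, rfl⟩
  | succ n ih =>
    rw [Function.iterate_succ, Function.iterate_succ, Function.comp, Function.comp, T.f_mk]
    exact ih _ _

theorem HomTriple.supportsCurrent_one {d : ℕ} (T : HomTriple d) (hd : d ≠ 0) {ε : ℂ} {ρ : ℝ}
    (hρ : 0 < ρ) (hU : IsTrappingRegion (T.f hd ε) (regionU ρ)) :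
    SupportsCurrent (attractingSet (T.f hd ε)^[3] (T.f hd ε '' regionU ρ)) 1 := by
  have hH := T.isHomMap_F hd ε
  refine ⟨limitCurrent hd hH, limitCurrent_isPositiveClosedCurrent hd hH, ?_, fun h => ?_⟩
  · rintro φ ⟨V, hV, hAV, hφ⟩
    obtain ⟨N, hN⟩ := exists_forall_iterate_image_subset (T.continuous_f hd ε) hU hV hAV
    refine limitCurrent_eq_zero hd hH (N := N) fun n hn p => ?_
    obtain ⟨h1, h2⟩ := T.iterate_f_mk hd ε n (linePt p) (linePt_ne_zero p)
    refine hφ _ h1 (hN n hn ⟨_, ?_, h2⟩)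
    rw [mk_mem_regionU]
    have h3 : head (linePt p) ≠ 0 := fun h => one_ne_zero (congrFun h 1)
    have h4 : linePt p 2 = 0 := rfl
    rw [h4, norm_zero]
    exact mul_pos hρ (norm_pos_iff.2 h3)
  · have h1 := limitCurrent_fs hd hH
    rw [h] at h1
    exact lineCurrent_fs_pos.ne h1

/-! ### Forms with compact support in an affine chart -/

/-- The affine chart `(z_k / z_i, z_j / z_i)` in real coordinates. -/
def chartMap (i j k : Fin 3) (z : CV 3) : Fin 4 → ℝ :=
  ![(z k / z i).re, (z k / z i).im, (z j / z i).re, (z j / z i).im]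

/-- The differential of `z_k / z_i`. -/
def ratioDer (i k : Fin 3) (z v : CV 3) : ℂ := (v k * z i - z k * v i) / z i ^ 2

theorem exists_hasFDerivAt_ratio (i k : Fin 3) {z : CV 3} (hz : z i ≠ 0) :
    ∃ L : CV 3 →L[ℝ] ℂ, HasFDerivAt (fun z : CV 3 => z k / z i) L z ∧
      ∀ v, L v = ratioDer i k z v := by
  have h1 : ∀ l, HasFDerivAt (fun z : CV 3 => z l) (ContinuousLinearMap.proj l : CV 3 →L[ℂ] ℂ) z :=
    fun l => (ContinuousLinearMap.proj l : CV 3 →L[ℂ] ℂ).hasFDerivAt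
  have h2 : HasFDerivAt (fun x : CV 3 => (x i)⁻¹)
      ((-(z i ^ 2)⁻¹) • (ContinuousLinearMap.proj i : CV 3 →L[ℂ] ℂ)) z :=
    (hasDerivAt_inv hz).comp_hasFDerivAt z (h1 i)
  have h3 := (HasFDerivAt.fun_mul (h1 k) h2).restrictScalars ℝ
  simp only [div_eq_mul_inv]
  refine ⟨_, h3, fun v => ?_⟩
  simp [ratioDer]
  field_simp
  ring

theorem hasFDerivAt_chartMap (i j k : Fin 3) {z : CV 3} (hz : z i ≠ 0) :
    ∃ L : CV 3 →L[ℝ] (Fin 4 → ℝ), HasFDerivAt (chartMap i j k) L z ∧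
      ∀ v, L v = ![(ratioDer i k z v).re, (ratioDer i k z v).im,
        (ratioDer i j z v).re, (ratioDer i j z v).im] := by
  obtain ⟨A, hA, hA'⟩ := exists_hasFDerivAt_ratio i k hz
  obtain ⟨B, hB, hB'⟩ := exists_hasFDerivAt_ratio i j hz
  refine ⟨ContinuousLinearMap.pi ![Complex.reCLM.comp A, Complex.imCLM.comp A,
    Complex.reCLM.comp B, Complex.imCLM.comp B], hasFDerivAt_pi.2 fun l => ?_, fun v => ?_⟩
  · fin_cases l
    · exact Complex.reCLM.hasFDerivAt.comp z hA
    · exact Complex.imCLM.hasFDerivAt.comp z hA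
    · exact Complex.reCLM.hasFDerivAt.comp z hB
    · exact Complex.imCLM.hasFDerivAt.comp z hB
  · funext l
    fin_cases l <;> simp [hA', hB']

theorem contDiffAt_chartMap (i j k : Fin 3) {z : CV 3} (hz : z i ≠ 0) :
    ContDiffAt ℝ ∞ (chartMap i j k) z := by
  have h1 : ∀ l : Fin 3, ContDiffAt ℝ ∞ (fun z : CV 3 => z l / z i) z := fun l => by
    have h2 : ∀ m : Fin 3, ContDiffAt ℂ ∞ (fun z : CV 3 => z m) z := fun m =>
      (ContinuousLinearMap.proj m : CV 3 →L[ℂ] ℂ).contDiff.contDiffAt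
    exact ((h2 l).div (h2 i) hz).restrict_scalars ℝ
  refine contDiffAt_pi.2 fun l => ?_
  fin_cases l
  · exact Complex.reCLM.contDiff.contDiffAt.comp z (h1 k)
  · exact Complex.imCLM.contDiff.contDiffAt.comp z (h1 k)
  · exact Complex.reCLM.contDiff.contDiffAt.comp z (h1 j)
  · exact Complex.imCLM.contDiff.contDiffAt.comp z (h1 j)

theorem chartMap_smul (i j k : Fin 3) {c : ℂ} (hc : c ≠ 0) (z : CV 3) :
    chartMap i j k (c • z) = chartMap i j k z := by
  simp only [chartMap, Pi.smul_apply, smul_eq_mul, mul_div_mul_left _ _ hc]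

theorem ratioDer_self (i k : Fin 3) (z : CV 3) (c : ℂ) : ratioDer i k z (c • z) = 0 := by
  simp only [ratioDer, Pi.smul_apply, smul_eq_mul]
  rw [div_eq_zero_iff]
  exact Or.inl (by ring)

theorem ratioDer_smul (i k : Fin 3) {c : ℂ} (hc : c ≠ 0) (z v : CV 3) :
    ratioDer i k (c • z) (c • v) = ratioDer i k z v := by
  simp only [ratioDer, Pi.smul_apply, smul_eq_mul]
  rw [show c * v k * (c * z i) - c * z k * (c * v i) = c ^ 2 * (v k * z i - z k * v i) by ring,
    mul_pow, mul_div_mul_left _ _ (pow_ne_zero 2 hc)]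

theorem ratioDer_smul_right (i k : Fin 3) (c : ℂ) (z v : CV 3) :
    ratioDer i k z (c • v) = c * ratioDer i k z v := by
  simp only [ratioDer, Pi.smul_apply, smul_eq_mul]
  ring

theorem fderiv_chartMap (i j k : Fin 3) {z : CV 3} (hz : z i ≠ 0) (v : CV 3) :
    fderiv ℝ (chartMap i j k) z v = ![(ratioDer i k z v).re, (ratioDer i k z v).im,
        (ratioDer i j z v).re, (ratioDer i j z v).im] := by
  obtain ⟨L, hL, hL'⟩ := hasFDerivAt_chartMap i j k hz
  rw [hL.fderiv, hL']

theorem norm_ratio_le (i j k : Fin 3) (z : CV 3) :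
    ‖z k / z i‖ ≤ 2 * ‖chartMap i j k z‖ ∧ ‖z j / z i‖ ≤ 2 * ‖chartMap i j k z‖ := by
  have h := fun l => norm_le_pi_norm (chartMap i j k z) l
  have h0 := h 0
  have h1 := h 1
  have h2 := h 2
  have h3 := h 3
  simp only [chartMap, Real.norm_eq_abs, Matrix.cons_val_zero, Matrix.cons_val_one,
    Matrix.cons_val] at h0 h1 h2 h3
  have h4 := Complex.norm_le_abs_re_add_abs_im (z k / z i)
  have h5 := Complex.norm_le_abs_re_add_abs_im (z j / z i)
  simp only [chartMap]
  constructor <;> linarith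

/-- Three indices that exhaust `Fin 3`. -/
def Exhaust (i j k : Fin 3) : Prop := ∀ l, l = i ∨ l = j ∨ l = k

/-- The affine coordinates blow up near the line `z_i = 0`, so that a compactly supported form
extends smoothly by zero across it. -/
theorem eventually_lt_norm_chartMap {i j k : Fin 3} (h : Exhaust i j k) (B : ℝ) {z : CV 3}
    (hz : z ≠ 0) (hzi : z i = 0) :
    ∀ᶠ w in 𝓝 z, w i ≠ 0 → B < ‖chartMap i j k w‖ := by
  have key : ∀ l, z l ≠ 0 → ∀ᶠ w : CV 3 in 𝓝 z, w i ≠ 0 → 2 * B < ‖w l / w i‖ := by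
    intro l hl
    have hcont : ∀ᶠ w : CV 3 in 𝓝 z, 2 * B * ‖w i‖ < ‖w l‖ := by
      refine ContinuousAt.eventually_lt
        (continuous_const.mul (continuous_apply i).norm).continuousAt
        (continuous_apply l).norm.continuousAt ?_
      rw [hzi, norm_zero, mul_zero]
      exact norm_pos_iff.2 hl
    filter_upwards [hcont] with w hw hwi
    rw [norm_div, lt_div_iff₀ (norm_pos_iff.2 hwi)]
    exact hw
  obtain ⟨l, hl⟩ := Function.ne_iff.1 hz
  rcases h l with rfl | rfl | rfl
  · exact absurd hzi hl
  · filter_upwards [key _ hl] with w hw hwi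
    have := hw hwi
    have := (norm_ratio_le i l k w).2
    linarith
  · filter_upwards [key _ hl] with w hw hwi
    have := hw hwi
    have := (norm_ratio_le i j l w).1
    linarith

open Classical in
/-- The form on the projective plane that is equal to a given form with compact support in an
affine chart. -/
def chartFun (i j k : Fin 3) {r : ℕ} (θ : (Fin 4 → ℝ) → (Fin 4 → ℝ) [⋀^Fin r]→L[ℝ] ℝ)
    (z : CV 3) : CV 3 [⋀^Fin r]→L[ℝ] ℝ :=
  if z i = 0 then 0 else
    (θ (chartMap i j k z)).compContinuousLinearMap (fderiv ℝ (chartMap i j k) z)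

section

variable {i j k : Fin 3} {r : ℕ} {θ : (Fin 4 → ℝ) → (Fin 4 → ℝ) [⋀^Fin r]→L[ℝ] ℝ} {B : ℝ}

theorem chartFun_of_ne {z : CV 3} (hz : z i ≠ 0) :
    chartFun i j k θ z =
      (θ (chartMap i j k z)).compContinuousLinearMap (fderiv ℝ (chartMap i j k) z) := if_neg hz

theorem chartFun_apply {z : CV 3} (hz : z i ≠ 0) (v : Fin r → CV 3) :
    chartFun i j k θ z v = θ (chartMap i j k z) fun l =>
      ![(ratioDer i k z (v l)).re, (ratioDer i k z (v l)).im,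
        (ratioDer i j z (v l)).re, (ratioDer i j z (v l)).im] := by
  rw [chartFun_of_ne hz]
  change θ (chartMap i j k z) (fun l => fderiv ℝ (chartMap i j k) z (v l)) = _
  simp only [fderiv_chartMap i j k hz]

theorem chartFun_eventuallyEq_zero (h : Exhaust i j k) (hB : ∀ x, B < ‖x‖ → θ x = 0)
    {z : CV 3} (hz : z ≠ 0) (hzi : z i = 0) : chartFun i j k θ =ᶠ[𝓝 z] 0 := by
  filter_upwards [eventually_lt_norm_chartMap h B hz hzi] with w hw
  by_cases hwi : w i = 0
  · exact if_pos hwi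
  · rw [chartFun_of_ne hwi, hB _ (hw hwi)]
    rfl

theorem chartFun_eventuallyEq {z : CV 3} (hz : z i ≠ 0) : chartFun i j k θ =ᶠ[𝓝 z] fun z =>
    (θ (chartMap i j k z)).compContinuousLinearMap (fderiv ℝ (chartMap i j k) z) := by
  have : ∀ᶠ w : CV 3 in 𝓝 z, w i ≠ 0 := (continuous_apply i).continuousAt.eventually_ne hz
  filter_upwards [this] with w hw
  exact chartFun_of_ne hw

theorem chartFun_mem (h : Exhaust i j k) (hθ : ContDiff ℝ ∞ θ) (hB : ∀ x, B < ‖x‖ → θ x = 0) :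
    chartFun i j k θ ∈ smoothForms r := by
  refine ⟨if_pos rfl, fun z hz => ?_, ?_, ?_⟩
  · refine ContDiffAt.contDiffWithinAt ?_
    by_cases hzi : z i = 0
    · exact (contDiffAt_const (c := 0)).congr_of_eventuallyEq (chartFun_eventuallyEq_zero h hB hz hzi)
    · have hs : IsOpen {w : CV 3 | w i ≠ 0} := isOpen_ne_fun (continuous_apply i) continuous_const
      have hchart : ContDiffOn ℝ ∞ (chartMap i j k) {w : CV 3 | w i ≠ 0} := fun w hw =>
        (contDiffAt_chartMap i j k hw).contDiffWithinAt
      have hon : ContDiffOn ℝ ∞ (chartFun i j k θ) {w : CV 3 | w i ≠ 0} := by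
        rw [contDiffOn_alternating_iff]
        intro v
        have h1 : ContDiffOn ℝ ∞ (fun z => θ (chartMap i j k z)) {w : CV 3 | w i ≠ 0} :=
          hθ.comp_contDiffOn hchart
        have h2 : ContDiffOn ℝ ∞ (fun z => θ (chartMap i j k z) fun l =>
            fderiv ℝ (chartMap i j k) z (v l)) {w : CV 3 | w i ≠ 0} := by
          refine ContDiffOn.alternating_apply (v := fun l z => fderiv ℝ (chartMap i j k) z (v l)) h1
            fun l => ?_
          exact (hchart.fderiv_of_isOpen hs (m := ∞) (by simp)).clm_apply contDiffOn_const
        refine h2.congr fun w hw => ?_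
        rw [chartFun_of_ne hw]
        rfl
      exact hon.contDiffAt (hs.mem_nhds hzi)
  · rintro z hz v ⟨l, c, hv⟩
    by_cases hzi : z i = 0
    · rw [chartFun, if_pos hzi]; rfl
    · rw [chartFun_apply hzi]
      refine (θ _).map_coord_zero l ?_
      rw [hv, ratioDer_self, ratioDer_self]
      funext m
      fin_cases m <;> rfl
  · intro z hz c hc v
    by_cases hzi : z i = 0
    · have : (c • z) i = 0 := by simp [hzi]
      rw [chartFun, chartFun, if_pos hzi, if_pos this]; rfl
    · have : (c • z) i ≠ 0 := mul_ne_zero hc hzi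
      rw [chartFun_apply hzi, chartFun_apply this, chartMap_smul i j k hc]
      simp only [ratioDer_smul _ _ hc]

theorem extDeriv_chartFun (h : Exhaust i j k) (hθ : ContDiff ℝ ∞ θ)
    (hB : ∀ x, B < ‖x‖ → θ x = 0) {z : CV 3} (hz : z ≠ 0) :
    chartFun i j k (extDeriv θ) z = extDeriv (chartFun i j k θ) z := by
  by_cases hzi : z i = 0
  · rw [(chartFun_eventuallyEq_zero h hB hz hzi).extDeriv_eq, chartFun, if_pos hzi]
    rw [extDeriv, fderiv_zero]
    exact (map_zero (ContinuousAlternatingMap.alternatizeUncurryFinCLM ℝ (CV 3) ℝ)).symm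
  · rw [(chartFun_eventuallyEq hzi).extDeriv_eq, chartFun_of_ne hzi]
    exact (extDeriv_pullback (hθ.differentiable (by simp) _) (contDiffAt_chartMap i j k hzi)
      IsHomMap.two_le_infty).symm

end

/-! ### The volume form of `ℝ⁴` -/

/-- The determinant, as a form of top degree. -/
def volForm : (Fin 4 → ℝ) [⋀^Fin 4]→L[ℝ] ℝ :=
  { (Matrix.detRowAlternating : (Fin 4 → ℝ) [⋀^Fin 4]→ₗ[ℝ] ℝ) with
    cont := continuous_id.matrix_det }

theorem volForm_apply (v : Fin 4 → Fin 4 → ℝ) : volForm v = Matrix.det (Matrix.of v) := rfl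

theorem volForm_basis : volForm (fun l => Pi.single l 1) = 1 := by
  have : (fun l : Fin 4 => Pi.single l (1 : ℝ)) = (1 : Matrix (Fin 4) (Fin 4) ℝ) := by
    funext l m
    rw [Matrix.one_apply, Pi.single_apply]
    simp only [eq_comm]
  rw [volForm_apply, this]
  exact Matrix.det_one

theorem eq_mul_volForm (Φ : (Fin 4 → ℝ) [⋀^Fin 4]→L[ℝ] ℝ) (v : Fin 4 → Fin 4 → ℝ) :
    Φ v = Φ (fun l => Pi.single l 1) * volForm v := by
  have h := AlternatingMap.eq_smul_basis_det (Pi.basisFun ℝ (Fin 4)) Φ.toAlternatingMap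
  rw [Pi.basisFun_det] at h
  have h1 := congrArg (fun f => f v) h
  have h2 : ⇑(Pi.basisFun ℝ (Fin 4)) = fun l => Pi.single l 1 := by
    funext l
    rw [Pi.basisFun_apply]
  rw [h2] at h1
  exact h1

/-- The real determinant of a complex linear map is the squared modulus of its complex determinant;
hence the volume form is positive on complex tuples. -/
theorem volForm_complex (a b a' b' : ℂ) :
    volForm ![![a.re, a.im, b.re, b.im],
      ![(Complex.I * a).re, (Complex.I * a).im, (Complex.I * b).re, (Complex.I * b).im],
      ![a'.re, a'.im, b'.re, b'.im],
      ![(Complex.I * a').re, (Complex.I * a').im, (Complex.I * b').re, (Complex.I * b').im]] =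
      Complex.normSq (a * b' - b * a') := by
  rw [volForm_apply, Matrix.det_succ_row_zero]
  simp [Fin.sum_univ_succ, Matrix.det_fin_three, Matrix.submatrix_apply, Fin.succAbove,
    Complex.normSq_apply]
  ring

/-- The contraction of the volume form with the first basis vector. -/
def volFormLeft : (Fin 4 → ℝ) [⋀^Fin 3]→L[ℝ] ℝ :=
  { AlternatingMap.curryLeft volForm.toAlternatingMap (Pi.single 0 1) with
    cont := by
      change Continuous fun m : Fin 3 → Fin 4 → ℝ => volForm (Matrix.vecCons (Pi.single 0 1) m)
      refine volForm.cont.comp (continuous_pi fun l => ?_)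
      refine Fin.cases ?_ (fun l => ?_) l
      · exact continuous_const
      · exact continuous_apply l }

theorem volFormLeft_apply (m : Fin 3 → Fin 4 → ℝ) :
    volFormLeft m = volForm (Matrix.vecCons (Pi.single 0 1) m) := rfl

/-- On the standard basis only the term of index `0` survives: in the others the contracted form
sees the first basis vector twice. -/
theorem extDeriv_smul_volFormLeft {g : (Fin 4 → ℝ) → ℝ} (hg : ContDiff ℝ ∞ g) (x : Fin 4 → ℝ) :
    extDeriv (fun x => g x • volFormLeft) x = fderiv ℝ g x (Pi.single 0 1) • volForm := by
  have hd : Differentiable ℝ g := hg.differentiable (by simp)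
  let b : Fin 4 → Fin 4 → ℝ := fun l => Pi.single l 1
  have key : extDeriv (fun x => g x • volFormLeft) x b =
      fderiv ℝ g x (Pi.single 0 1) := by
    rw [extDeriv_apply ((hd x).smul_const _), Finset.sum_eq_single 0]
    · have h1 : volFormLeft (Fin.removeNth 0 b) = 1 := by
        rw [volFormLeft_apply]
        refine Eq.trans (congrArg volForm ?_) volForm_basis
        exact Fin.cons_self_tail b
      have h2 : (fun y => (g y • volFormLeft)
          (Fin.removeNth 0 b)) = g := by
        funext y
        change g y • volFormLeft _ = _
        rw [h1, smul_eq_mul, mul_one]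
      rw [h2, Fin.val_zero, pow_zero, one_smul]
    · intro i _ hi
      have h1 : volFormLeft (Fin.removeNth i b) = 0 := by
        rw [volFormLeft_apply]
        refine volForm.map_eq_zero_of_eq _ (i := 0) (j := 1) ?_ (by decide)
        change _ = Fin.removeNth i b 0
        rw [Fin.removeNth, Fin.succAbove_ne_zero_zero hi]
        rfl
      have h2 : (fun y => (g y • volFormLeft)
          (Fin.removeNth i b)) = fun _ => 0 := by
        funext y
        change g y • volFormLeft _ = _
        rw [h1, smul_zero]
      rw [h2]
      simp
    · simp
  ext v
  rw [eq_mul_volForm]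
  change extDeriv _ _ b * _ = _
  rw [key]
  rfl

/-! ### Cut-off functions -/

/-- A cut-off function on `ℂ`, equal to `1` on the disc of radius `1`. -/
def cutOne : ContDiffBump (0 : ℂ) := ⟨1, 2, one_pos, one_lt_two⟩

/-- A cut-off function on `ℂ`, equal to `1` on the disc of radius `2`. -/
def cutTwo : ContDiffBump (0 : ℂ) := ⟨2, 3, two_pos, by norm_num⟩

theorem cutOne_eq_one {w : ℂ} (h : ‖w‖ ≤ 1) : cutOne w = 1 :=
  cutOne.one_of_mem_closedBall (by simpa [cutOne] using h)

theorem cutOne_eq_zero {w : ℂ} (h : 2 ≤ ‖w‖) : cutOne w = 0 :=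
  cutOne.zero_of_le_dist (by simpa [cutOne] using h)

theorem cutTwo_eq_one {w : ℂ} (h : ‖w‖ ≤ 2) : cutTwo w = 1 :=
  cutTwo.one_of_mem_closedBall (by simpa [cutTwo] using h)

theorem cutTwo_eq_zero {w : ℂ} (h : 3 ≤ ‖w‖) : cutTwo w = 0 :=
  cutTwo.zero_of_le_dist (by simpa [cutTwo] using h)

/-- The first complex coordinate of `ℝ⁴ = ℂ²`. -/
def fstC (x : Fin 4 → ℝ) : ℂ := ⟨x 0, x 1⟩

/-- The second complex coordinate of `ℝ⁴ = ℂ²`. -/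
def sndC (x : Fin 4 → ℝ) : ℂ := ⟨x 2, x 3⟩

theorem contDiff_fstC : ContDiff ℝ ∞ fstC :=
  Complex.equivRealProdCLM.symm.contDiff.comp ((contDiff_apply ℝ ℝ 0).prodMk (contDiff_apply ℝ ℝ 1))

theorem contDiff_sndC : ContDiff ℝ ∞ sndC :=
  Complex.equivRealProdCLM.symm.contDiff.comp ((contDiff_apply ℝ ℝ 2).prodMk (contDiff_apply ℝ ℝ 3))

theorem fstC_chartMap (i j k : Fin 3) (z : CV 3) : fstC (chartMap i j k z) = z k / z i := rfl

theorem sndC_chartMap (i j k : Fin 3) (z : CV 3) : sndC (chartMap i j k z) = z j / z i := rfl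

/-- A cut-off function on `ℂ²`. -/
def cutoff (x : Fin 4 → ℝ) : ℝ := cutOne (fstC x) * cutTwo (sndC x)

theorem contDiff_cutoff : ContDiff ℝ ∞ cutoff :=
  (cutOne.contDiff.comp contDiff_fstC).mul (cutTwo.contDiff.comp contDiff_sndC)

theorem cutoff_nonneg (x : Fin 4 → ℝ) : 0 ≤ cutoff x := mul_nonneg cutOne.nonneg cutTwo.nonneg

theorem cutoff_eq_zero_of_lt (x : Fin 4 → ℝ) (h : 3 < ‖x‖) : cutoff x = 0 := by
  by_contra h0
  have h1 : ‖fstC x‖ < 2 := by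
    by_contra h1
    exact h0 (by rw [cutoff, cutOne_eq_zero (not_lt.1 h1), zero_mul])
  have h2 : ‖sndC x‖ < 3 := by
    by_contra h1
    exact h0 (by rw [cutoff, cutTwo_eq_zero (not_lt.1 h1), mul_zero])
  refine h.not_ge ((pi_norm_le_iff_of_nonneg (by norm_num)).2 fun l => ?_)
  have a0 : |x 0| ≤ ‖fstC x‖ := Complex.abs_re_le_norm (fstC x)
  have a1 : |x 1| ≤ ‖fstC x‖ := Complex.abs_im_le_norm (fstC x)
  have a2 : |x 2| ≤ ‖sndC x‖ := Complex.abs_re_le_norm (sndC x)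
  have a3 : |x 3| ≤ ‖sndC x‖ := Complex.abs_im_le_norm (sndC x)
  rw [Real.norm_eq_abs]
  fin_cases l <;> simp only [Fin.zero_eta, Fin.mk_one, Fin.reduceFinMk] <;> linarith

/-- The product of a cut-off function on `ℂ²` by a real coordinate. -/
def cutCoord (x : Fin 4 → ℝ) : ℝ := x 0 * cutoff x

theorem contDiff_cutCoord : ContDiff ℝ ∞ cutCoord := (contDiff_apply ℝ ℝ 0).mul contDiff_cutoff

theorem cutCoord_eq_zero_of_lt (x : Fin 4 → ℝ) (h : 3 < ‖x‖) : cutCoord x = 0 := by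
  rw [cutCoord, cutoff_eq_zero_of_lt x h, mul_zero]

theorem fderiv_cutCoord_of_lt (x : Fin 4 → ℝ) (h : 3 < ‖x‖) : fderiv ℝ cutCoord x = 0 := by
  have : cutCoord =ᶠ[𝓝 x] fun _ => 0 := by
    filter_upwards [(isOpen_lt continuous_const continuous_norm).mem_nhds h] with y hy
    exact cutCoord_eq_zero_of_lt y hy
  rw [this.fderiv_eq, fderiv_fun_const]
  rfl

/-- In the first case the factor `cutOne` is locally `1`, so the cut-off does not depend on `x 0`
nearby; in the second it vanishes on the whole line in the direction of `x 0`. -/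
theorem fderiv_cutCoord (x : Fin 4 → ℝ) (h : ‖fstC x‖ < 1 ∨ 3 ≤ ‖sndC x‖) :
    fderiv ℝ cutCoord x (Pi.single 0 1) = cutoff x := by
  have hd : DifferentiableAt ℝ cutCoord x := contDiff_cutCoord.differentiable (by simp) x
  have hs : ∀ t : ℝ, sndC (x + t • Pi.single 0 1) = sndC x := fun t => by
    simp [sndC]
  rw [← hd.lineDeriv_eq_fderiv, lineDeriv]
  rcases h with h | h
  · have hc : Continuous fun t : ℝ => ‖fstC (x + t • Pi.single 0 1)‖ :=
      (contDiff_fstC.continuous.comp (by fun_prop)).norm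
    have hn : ∀ᶠ t : ℝ in 𝓝 0, ‖fstC (x + t • Pi.single 0 1)‖ < 1 :=
      hc.continuousAt.eventually_lt continuousAt_const (by simpa using h)
    have he : (fun t : ℝ => cutCoord (x + t • Pi.single 0 1)) =ᶠ[𝓝 0]
        fun t => (x 0 + t) * cutTwo (sndC x) := by
      filter_upwards [hn] with t ht
      rw [cutCoord, cutoff, hs, cutOne_eq_one ht.le, one_mul]
      simp
    rw [he.deriv_eq, cutoff, cutOne_eq_one h.le, one_mul]
    have : HasDerivAt (fun t : ℝ => (x 0 + t) * cutTwo (sndC x)) (1 * cutTwo (sndC x)) 0 :=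
      ((hasDerivAt_id (0 : ℝ)).const_add (x 0)).mul_const _
    rw [this.deriv, one_mul]
  · have he : (fun t : ℝ => cutCoord (x + t • Pi.single 0 1)) = fun _ => 0 := by
      funext t
      rw [cutCoord, cutoff, hs, cutTwo_eq_zero h, mul_zero, mul_zero]
    rw [he, deriv_const, cutoff, cutTwo_eq_zero h, mul_zero]

/-! ### Currents of bidimension `(2, 2)` -/

/-- The positive form of top degree supported in an affine chart. -/
def bumpForm (i j k : Fin 3) (h : Exhaust i j k) : smoothForms (2 * 2) :=
  ⟨chartFun i j k (r := 2 * 2) fun x => cutoff x • volForm,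
    chartFun_mem h (contDiff_cutoff.smul contDiff_const) (B := 3) fun x hx => by
      rw [cutoff_eq_zero_of_lt x hx]
      exact zero_smul ℝ volForm⟩

section

variable {i j k : Fin 3}

theorem bumpForm_of_eq (h : Exhaust i j k) {z : CV 3} (hz : z i = 0) :
    (bumpForm i j k h).1 z = 0 := if_pos hz

theorem bumpForm_apply (h : Exhaust i j k) {z : CV 3} (hz : z i ≠ 0) (v : Fin (2 * 2) → CV 3) :
    (bumpForm i j k h).1 z v = cutoff (chartMap i j k z) * volForm fun l =>
      ![(ratioDer i k z (v l)).re, (ratioDer i k z (v l)).im,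
        (ratioDer i j z (v l)).re, (ratioDer i j z (v l)).im] :=
  chartFun_apply (r := 2 * 2) (θ := fun x => cutoff x • volForm) hz v

theorem volForm_complexTuple_nonneg (z : CV 3) (v : Fin 2 → CV 3) :
    0 ≤ volForm fun l => ![(ratioDer i k z (complexTuple v l)).re,
      (ratioDer i k z (complexTuple v l)).im, (ratioDer i j z (complexTuple v l)).re,
      (ratioDer i j z (complexTuple v l)).im] := by
  have h := volForm_complex (ratioDer i k z (v 0)) (ratioDer i j z (v 0)) (ratioDer i k z (v 1))
    (ratioDer i j z (v 1))
  have h0 := Complex.normSq_nonneg (ratioDer i k z (v 0) * ratioDer i j z (v 1) -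
    ratioDer i j z (v 0) * ratioDer i k z (v 1))
  rw [← h] at h0
  convert h0 using 2
  funext l
  fin_cases l <;> simp [complexTuple, ratioDer_smul_right]

theorem bumpForm_complexTuple_nonneg (h : Exhaust i j k) (z : CV 3) (v : Fin 2 → CV 3) :
    0 ≤ (bumpForm i j k h).1 z (complexTuple v) := by
  by_cases hz : z i = 0
  · rw [bumpForm_of_eq h hz]
    exact le_rfl
  · rw [bumpForm_apply h hz]
    exact mul_nonneg (cutoff_nonneg _) (volForm_complexTuple_nonneg z v)

theorem abs_form_le_volForm (h : Exhaust i j k) (hij : i ≠ j) (hik : i ≠ k) (hjk : j ≠ k)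
    (φ : smoothForms (2 * 2)) {M : ℝ} (hM : ∀ z : CV 3, ‖z‖ = 1 → ‖φ.1 z‖ ≤ M) {z : CV 3}
    (hz : z i ≠ 0) (v : Fin (2 * 2) → CV 3) :
    |φ.1 z v| ≤ M * |volForm fun l => ![(ratioDer i k z (v l)).re,
      (ratioDer i k z (v l)).im, (ratioDer i j z (v l)).re, (ratioDer i j z (v l)).im]| := by
  have hz0 : z ≠ 0 := fun h => hz (congrFun h i)
  have hM0 : 0 ≤ M := by
    obtain ⟨w, -, hw, -⟩ := exists_mk_norm_one (Projectivization.mk ℂ z hz0)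
    exact (norm_nonneg _).trans (hM w hw)
  -- Lifts at `z` of the coordinate vectors of the chart. The scaling by `z i` makes their norms at
  -- most `‖z‖`, so the bound for `φ` on them is `M`.
  let e : Fin 4 → CV 3 := ![Pi.single k (z i), Pi.single k (Complex.I * z i),
    Pi.single j (z i), Pi.single j (Complex.I * z i)]
  have he : ∀ l, ‖e l‖ ≤ ‖z‖ := fun l => by
    have : ‖e l‖ = ‖z i‖ := by
      fin_cases l <;> simp [e, Pi.norm_single]
    exact this ▸ norm_le_pi_norm z i
  let L : (Fin 4 → ℝ) →L[ℝ] CV 3 :=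
    ∑ l, (ContinuousLinearMap.proj l : (Fin 4 → ℝ) →L[ℝ] ℝ).smulRight (e l)
  have hL : ∀ x, L x = ∑ l, x l • e l := fun x => by
    simp [L]
  have hLs : ∀ l, L (Pi.single l 1) = e l := fun l => by
    rw [hL, Finset.sum_eq_single l]
    · simp
    · intro m _ hm
      simp [hm]
    · simp
  have hdec : ∀ w : CV 3, w = L ![(ratioDer i k z w).re, (ratioDer i k z w).im,
      (ratioDer i j z w).re, (ratioDer i j z w).im] + (w i / z i) • z := by
    intro w
    have hc : ∀ (a b : ℂ), (a.re : ℂ) * b + (a.im : ℂ) * (Complex.I * b) = a * b := fun a b => by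
      rw [← mul_assoc, ← add_mul, Complex.re_add_im]
    funext m
    rw [hL]
    simp only [Fin.sum_univ_four, e, Pi.add_apply, Pi.smul_apply, Complex.real_smul, smul_eq_mul,
      Matrix.cons_val_zero, Matrix.cons_val_one, Matrix.cons_val]
    rcases h m with rfl | rfl | rfl
    · simp [hij, hik, hz]
    · simp only [Pi.single_apply, if_neg hjk, if_pos, mul_zero, zero_add, hc, ratioDer]
      field_simp
      ring
    · simp only [Pi.single_apply, if_neg hjk.symm, if_pos, mul_zero, add_zero, hc, ratioDer]
      field_simp
      ring
  have h1 : φ.1 z v = (φ.1 z).compContinuousLinearMap L fun l => ![(ratioDer i k z (v l)).re,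
      (ratioDer i k z (v l)).im, (ratioDer i j z (v l)).re, (ratioDer i j z (v l)).im] := by
    conv_lhs => rw [show v = fun l => L ![(ratioDer i k z (v l)).re, (ratioDer i k z (v l)).im,
      (ratioDer i j z (v l)).re, (ratioDer i j z (v l)).im] + (v l i / z i) • z from
        funext fun l => hdec (v l)]
    rw [form_add_smul φ hz0]
    rfl
  have h2 : (φ.1 z).compContinuousLinearMap L (fun l : Fin 4 => Pi.single l 1) = φ.1 z e :=
    congrArg (φ.1 z) (funext hLs)
  have h3 : |φ.1 z e| ≤ M := by
    refine (norm_form_le φ hM hz0 e).trans ?_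
    refine mul_le_of_le_one_right hM0 (Finset.prod_le_one (fun l _ => by positivity) fun l _ => ?_)
    exact div_le_one_of_le₀ (he l) (norm_nonneg z)
  rw [h1, eq_mul_volForm, h2, abs_mul]
  exact mul_le_mul_of_nonneg_right h3 (abs_nonneg _)

/-- Where `z_i` is the largest coordinate, the cut-off equals `1`. The three such regions cover
`ℙ²`. -/
theorem abs_form_le_bumpForm (h : Exhaust i j k) (hij : i ≠ j) (hik : i ≠ k) (hjk : j ≠ k)
    (φ : smoothForms (2 * 2)) {M : ℝ} (hM : ∀ z : CV 3, ‖z‖ = 1 → ‖φ.1 z‖ ≤ M) {z : CV 3}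
    (hz : z ≠ 0) (hzj : ‖z j‖ ≤ ‖z i‖) (hzk : ‖z k‖ ≤ ‖z i‖) (v : Fin 2 → CV 3) :
    |φ.1 z (complexTuple v)| ≤ M * (bumpForm i j k h).1 z (complexTuple v) := by
  have hzi : z i ≠ 0 := fun h0 => by
    rw [h0, norm_zero] at hzj hzk
    refine hz (funext fun l => ?_)
    rcases h l with rfl | rfl | rfl
    · exact h0
    · exact norm_le_zero_iff.1 hzj
    · exact norm_le_zero_iff.1 hzk
  have hc : cutoff (chartMap i j k z) = 1 := by
    rw [cutoff, fstC_chartMap, sndC_chartMap, cutOne_eq_one, cutTwo_eq_one, one_mul]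
    · rw [norm_div]
      exact (div_le_one_of_le₀ hzj (norm_nonneg _)).trans one_le_two
    · rw [norm_div]
      exact div_le_one_of_le₀ hzk (norm_nonneg _)
  rw [bumpForm_apply h hzi, hc, one_mul]
  refine (abs_form_le_volForm h hij hik hjk φ hM hzi _).trans_eq ?_
  congr 1
  exact abs_of_nonneg (volForm_complexTuple_nonneg z v)

/-- On `U_ρ` the bump form coincides with the exact form `d(cutCoord • volFormLeft)`, by
`fderiv_cutCoord`; the condition `hU` is exactly what this requires. -/
theorem apply_bumpForm_eq_zero_of_closed (h : Exhaust i j k) {A : Set (PS 3)} {ρ : ℝ}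
    (hA : A ⊆ regionU ρ) {T : smoothForms (2 * 2) →ₗ[ℝ] ℝ} (hT : IsPositiveClosedCurrent T)
    (hTA : IsSupportedIn T A)
    (hU : ∀ z : CV 3, z i ≠ 0 → ‖z 2‖ < ρ * ‖head z‖ → ‖z k‖ < ‖z i‖ ∨ 3 * ‖z i‖ ≤ ‖z j‖) :
    T (bumpForm i j k h) = 0 := by
  have hθ : ContDiff ℝ ∞ fun x => cutCoord x • volFormLeft :=
    contDiff_cutCoord.smul contDiff_const
  have hB : ∀ x : Fin 4 → ℝ, 3 < ‖x‖ → cutCoord x • volFormLeft = 0 := fun x hx => by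
    rw [cutCoord_eq_zero_of_lt x hx, zero_smul]
  have hext : extDeriv (fun x => cutCoord x • volFormLeft) =
      fun x => fderiv ℝ cutCoord x (Pi.single 0 1) • volForm :=
    funext (extDeriv_smul_volFormLeft contDiff_cutCoord)
  have hθ' : ContDiff ℝ ∞ (extDeriv fun x => cutCoord x • volFormLeft) := by
    rw [hext]
    exact ((contDiff_cutCoord.fderiv_right (m := ∞) (by simp)).clm_apply contDiff_const).smul
      contDiff_const
  have hB' : ∀ x : Fin 4 → ℝ, 3 < ‖x‖ → extDeriv (fun x => cutCoord x • volFormLeft) x = 0 :=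
    fun x hx => by
      rw [hext]
      change fderiv ℝ cutCoord x (Pi.single 0 1) • volForm = 0
      rw [fderiv_cutCoord_of_lt x hx]
      exact zero_smul ℝ volForm
  let ψ : smoothForms (2 * 1 + 1) :=
    ⟨chartFun i j k (r := 2 * 1 + 1) fun x => cutCoord x • volFormLeft, chartFun_mem h hθ hB⟩
  let φ : smoothForms (2 * 2) :=
    ⟨chartFun i j k (r := 2 * 2) (extDeriv fun x => cutCoord x • volFormLeft),
      chartFun_mem h hθ' hB'⟩
  have h1 : T φ = 0 := hT.closed ψ φ fun z hz => extDeriv_chartFun (r := 2 * 1 + 1) h hθ hB hz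
  have h2 : T (bumpForm i j k h + (-1 : ℝ) • φ) = 0 := by
    refine hTA _ ⟨regionU ρ, isOpen_regionU ρ, hA, fun z hz hzU => ?_⟩
    suffices hs : (bumpForm i j k h).1 z = φ.1 z by
      change (bumpForm i j k h).1 z + (-1 : ℝ) • φ.1 z = 0
      rw [hs]
      ext v
      exact (congrArg _ (neg_one_mul _)).trans (add_neg_cancel _)
    by_cases hzi : z i = 0
    · rw [bumpForm_of_eq h hzi]
      exact (if_pos hzi).symm
    · have hc : fderiv ℝ cutCoord (chartMap i j k z) (Pi.single 0 1) =
          cutoff (chartMap i j k z) := by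
        have hp := norm_pos_iff.2 hzi
        refine fderiv_cutCoord _ ((hU z hzi ((mk_mem_regionU hz).1 hzU)).imp ?_ ?_) <;> intro hlt
        · rw [fstC_chartMap, norm_div]
          exact (div_lt_one hp).2 hlt
        · rw [sndC_chartMap, norm_div]
          exact (le_div_iff₀ hp).2 hlt
      change chartFun i j k (r := 2 * 2) (fun x => cutoff x • volForm) z =
        chartFun i j k (r := 2 * 2) (extDeriv fun x => cutCoord x • volFormLeft) z
      rw [chartFun_of_ne hzi, chartFun_of_ne hzi, hext]
      simp only [hc]
  have h3 := (T.map_add _ ((-1 : ℝ) • φ)).symm.trans h2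
  rwa [T.map_smul (-1 : ℝ) φ, h1, smul_zero, add_zero] at h3

end

/-- The current kills the bump forms of the three charts, and their sum dominates a multiple of any
form of top degree; by positivity the current is zero. -/
theorem not_supportsCurrent_two {A : Set (PS 3)} {ρ : ℝ} (hρ : ρ ≤ 1 / 3) (hA : A ⊆ regionU ρ) :
    ¬ SupportsCurrent A 2 := by
  rintro ⟨T, hT, hTA, hT0⟩
  have e0 : Exhaust 0 1 2 := by intro l; fin_cases l <;> decide
  have e1 : Exhaust 1 0 2 := by intro l; fin_cases l <;> decide
  have e2 : Exhaust 2 0 1 := by intro l; fin_cases l <;> decide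
  have hreg : ∀ z : CV 3, ‖z 2‖ < ρ * ‖head z‖ → 3 * ‖z 2‖ < ‖z 0‖ ∨ 3 * ‖z 2‖ < ‖z 1‖ := by
    intro z hz
    have := mul_le_mul_of_nonneg_right hρ (norm_nonneg (head z))
    have h3 : 3 * ‖z 2‖ < ‖head z‖ := by linarith
    rw [norm_head] at h3
    exact lt_max_iff.1 h3
  have t0 : T (bumpForm 0 1 2 e0) = 0 := by
    refine apply_bumpForm_eq_zero_of_closed e0 hA hT hTA fun z _ hz => ?_
    have := norm_nonneg (z 2)
    by_contra! hcon
    rcases hreg z hz with h | h <;> linarith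
  have t1 : T (bumpForm 1 0 2 e1) = 0 := by
    refine apply_bumpForm_eq_zero_of_closed e1 hA hT hTA fun z _ hz => ?_
    have := norm_nonneg (z 2)
    by_contra! hcon
    rcases hreg z hz with h | h <;> linarith
  -- This bump form is supported near `[0 : 0 : 1]` and vanishes on `U_ρ`; the radius `3` of
  -- `cutTwo` is the reason for the bound `1 / 3`.
  have t2 : T (bumpForm 2 0 1 e2) = 0 := by
    refine hTA _ ⟨regionU ρ, isOpen_regionU ρ, hA, fun z hz hzU => ?_⟩
    by_cases hzi : z 2 = 0
    · exact bumpForm_of_eq e2 hzi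
    · have hp := norm_pos_iff.2 hzi
      have hc : cutoff (chartMap 2 0 1 z) = 0 := by
        rw [cutoff, fstC_chartMap, sndC_chartMap]
        rcases hreg z ((mk_mem_regionU hz).1 hzU) with h | h
        · rw [cutTwo_eq_zero, mul_zero]
          rw [norm_div, le_div_iff₀ hp]
          exact h.le
        · rw [cutOne_eq_zero, zero_mul]
          rw [norm_div, le_div_iff₀ hp]
          linarith
      ext v
      rw [bumpForm_apply e2 hzi, hc, zero_mul]
      rfl
  refine hT0 (LinearMap.ext fun φ => ?_)
  obtain ⟨M, hM⟩ := exists_norm_le (2 * 2) φ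
  let Ω := bumpForm 0 1 2 e0 + bumpForm 1 0 2 e1 + bumpForm 2 0 1 e2
  have hΩ : T Ω = 0 := by
    simp only [Ω, map_add, t0, t1, t2, add_zero]
  have hdom : ∀ z ≠ 0, ∀ v : Fin 2 → CV 3,
      |φ.1 z (complexTuple v)| ≤ M * Ω.1 z (complexTuple v) := by
    intro z hz v
    have hM0 : 0 ≤ M := by
      obtain ⟨w, -, hw, -⟩ := exists_mk_norm_one (Projectivization.mk ℂ z hz)
      exact (norm_nonneg _).trans (hM w hw)
    have n0 := mul_nonneg hM0 (bumpForm_complexTuple_nonneg e0 z v)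
    have n1 := mul_nonneg hM0 (bumpForm_complexTuple_nonneg e1 z v)
    have n2 := mul_nonneg hM0 (bumpForm_complexTuple_nonneg e2 z v)
    change _ ≤ M * ((bumpForm 0 1 2 e0).1 z (complexTuple v) +
      (bumpForm 1 0 2 e1).1 z (complexTuple v) + (bumpForm 2 0 1 e2).1 z (complexTuple v))
    rcases le_total ‖z 0‖ ‖z 1‖ with h01 | h01 <;> rcases le_total ‖z 1‖ ‖z 2‖ with h12 | h12
    · have := abs_form_le_bumpForm e2 (by decide) (by decide) (by decide) φ hM hz (h01.trans h12)
        h12 v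
      linarith
    · have := abs_form_le_bumpForm e1 (by decide) (by decide) (by decide) φ hM hz h01 h12 v
      linarith
    · rcases le_total ‖z 0‖ ‖z 2‖ with h02 | h02
      · have := abs_form_le_bumpForm e2 (by decide) (by decide) (by decide) φ hM hz h02 h12 v
        linarith
      · have := abs_form_le_bumpForm e0 (by decide) (by decide) (by decide) φ hM hz h01 h02 v
        linarith
    · have := abs_form_le_bumpForm e0 (by decide) (by decide) (by decide) φ hM hz h01
        (h12.trans h01) v
      linarith
  have p1 : 0 ≤ T (M • Ω + φ) := hT.positive _ fun z hz v => by
    have := neg_le_of_abs_le (hdom z hz v)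
    change 0 ≤ M * Ω.1 z (complexTuple v) + φ.1 z (complexTuple v)
    linarith
  have p2 : 0 ≤ T (M • Ω + (-1 : ℝ) • φ) := hT.positive _ fun z hz v => by
    have := le_of_abs_le (hdom z hz v)
    change 0 ≤ M * Ω.1 z (complexTuple v) + -1 * φ.1 z (complexTuple v)
    linarith
  rw [map_add, map_smul, hΩ, smul_zero, zero_add] at p1
  rw [map_add, map_smul, map_smul, hΩ, smul_zero, zero_add, neg_one_smul] at p2
  exact le_antisymm (neg_nonneg.1 p2) p1

end SmallDegree

end

/-! ### Choice of the constants and conclusion. -/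

theorem mainTheorem7 (d : ℕ) (hd : 2 ≤ d) (T : SmallDegree.HomTriple d)
    (hXY : Disjoint T.X T.Y)
    (hZ : T.fInf^[2] ⁻¹' T.Z ∩ T.fInf ⁻¹' T.Z ∩ T.Z = ∅) :
    ∃ ε₀ : ℝ, 0 < ε₀ ∧ ∀ ε : ℂ, 0 < ‖ε‖ → ‖ε‖ < ε₀ →
      ∃ ρ : ℝ, 0 < ρ ∧
        SmallDegree.IsTrappingRegion (T.f (by omega) ε) (SmallDegree.regionU ρ) ∧
        SmallDegree.IsOfSmallTopologicalDegreeOn (T.f (by omega) ε)^[3]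
          (T.f (by omega) ε '' SmallDegree.regionU ρ) := by
  have hd0 : d ≠ 0 := by omega
  obtain ⟨c, hc, hG⟩ := SmallDegree.exists_pos_lower_bound_of_homogeneous hd0 T.continuous_G
    T.G_smul fun _ => T.eq_zero_of_G_eq_zero
  obtain ⟨C, hC, hr⟩ := SmallDegree.exists_pos_bound_of_homogeneous hd0 T.continuous_r
    (fun t u => T.r_smul t u)
  obtain ⟨η₁, hη₁, hXY'⟩ := T.exists_not_nearX_and_nearY hd0 hXY
  obtain ⟨η₂, hη₂, hZ'⟩ := T.exists_not_nearZ_chain hd0 hZ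
  obtain ⟨η, hη, hle₁, hle₂⟩ : ∃ η > 0, η ≤ η₁ ∧ η ≤ η₂ :=
    ⟨min η₁ η₂, lt_min hη₁ hη₂, min_le_left .., min_le_right ..⟩
  -- With `ρ = K‖ε‖`, the term `2‖ε‖C` uses exactly half of the trapping budget `c ρ`.
  obtain ⟨K, hK, hKC⟩ : ∃ K > 0, 4 * C = c * K := ⟨4 * C / c, by positivity, by field_simp⟩
  -- The three conditions serve, in this order, to exclude currents of bidimension `(2, 2)`, to
  -- leave room for `2 ρ ^ d` in the trapping estimate, and to make the error `2 ρ ^ d / c` at most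
  -- `η‖ε‖`. The first one also gives `ρ ≤ 1`, hence `ρ ^ d ≤ ρ ^ 2`.
  obtain ⟨ε₀, hε₀, h1, h2, h3⟩ : ∃ ε₀ > 0, K * ε₀ ≤ 1 / 3 ∧ K * ε₀ ≤ c / 4 ∧
      2 * K ^ 2 * ε₀ ≤ η * c := by
    refine ⟨min (min (1 / 3 / K) (c / 4 / K)) (η * c / (2 * K ^ 2)), by positivity, ?_, ?_, ?_⟩
    · rw [← le_div_iff₀' hK]
      exact (min_le_left ..).trans (min_le_left ..)
    · rw [← le_div_iff₀' hK]
      exact (min_le_left ..).trans (min_le_right ..)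
    · rw [← le_div_iff₀' (by positivity)]
      exact min_le_right ..
  refine ⟨ε₀, hε₀, fun ε hε hlt => ?_⟩
  have hρ : 0 < K * ‖ε‖ := mul_pos hK hε
  have hKε : K * ‖ε‖ ≤ K * ε₀ := mul_le_mul_of_nonneg_left hlt.le hK.le
  have hpow : (K * ‖ε‖) ^ d ≤ (K * ‖ε‖) ^ 2 :=
    pow_le_pow_of_le_one hρ.le (by linarith) hd
  have hsmall : 2 * ((K * ‖ε‖) ^ d + ‖ε‖ * C) ≤ c * (K * ‖ε‖) := by
    have h4 : (K * ‖ε‖) ^ 2 ≤ c / 4 * (K * ‖ε‖) := by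
      rw [sq]
      exact mul_le_mul_of_nonneg_right (hKε.trans h2) hρ.le
    have h5 : ‖ε‖ * C = c / 4 * (K * ‖ε‖) := by linear_combination ‖ε‖ / 4 * hKC
    linarith
  have hκ : 2 * ((K * ‖ε‖) ^ d / c) ≤ η * ‖ε‖ := by
    rw [← mul_div_assoc, div_le_iff₀ hc]
    have h4 : 2 * K ^ 2 * ‖ε‖ ≤ η * c :=
      (mul_le_mul_of_nonneg_left hlt.le (by positivity)).trans h3
    have h5 := mul_le_mul_of_nonneg_right h4 hε.le
    linarith
  have himage := T.image_regionU_subset hd0 hG hr hsmall hρ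
  have htrap := T.isTrappingRegion_regionU hd0 hρ himage
  have hU : T.f hd0 ε '' SmallDegree.regionU (K * ‖ε‖) ⊆ SmallDegree.regionU (K * ‖ε‖) :=
    himage.trans (SmallDegree.closedRegion_subset_regionU (half_lt_self hρ))
  have hend : SmallDegree.IsEndomorphism (T.f hd0 ε) d := ⟨_, _, _, rfl⟩
  have hend3 : SmallDegree.IsEndomorphism (T.f hd0 ε)^[3] (d ^ 3) := by
    have := hend.comp (hend.comp hend)
    rwa [show d * d * d = d ^ 3 by ring] at this
  refine ⟨K * ‖ε‖, hρ, htrap, d ^ 3, 1, hend3, T.isTrappingRegion_image hd0 htrap,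
    ⟨one_le_two, T.supportsCurrent_one hd0 hρ htrap, fun l hl hl2 => ?_⟩, fun p _ => ?_⟩
  · obtain rfl : l = 2 := by omega
    exact SmallDegree.not_supportsCurrent_two (hKε.trans h1)
      ((SmallDegree.attractingSet_subset _ _).trans hU)
  · rw [pow_one]
    exact T.encard_preim_three_lt hd hd0 hc hε hG hU hκ
      (fun b hb h => hXY' b hb ⟨SmallDegree.HomTriple.NearX.mono T hle₁ h.1,
        SmallDegree.HomTriple.NearY.mono T hle₁ h.2⟩)
      (fun b hb h => hZ' b hb ⟨SmallDegree.HomTriple.NearZ.mono T hle₂ h.1,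
        SmallDegree.HomTriple.NearZ.mono T hle₂ h.2.1,
        SmallDegree.HomTriple.NearZ.mono T hle₂ h.2.2⟩) p
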